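/- Let $\gamma>1$ and let $U_\infty=(u_\infty,0,p_\infty,\rho_\infty)$ be a constant state with $p_\infty,\rho_\infty>0$ and $u_\infty>c_\infty$, where $c=\sqrt{\gamma p/\rho}$ is the sonic speed. For states $U=(u,v,p,\rho)$ let $q=\sqrt{u^2+v^2}$, $\theta=\arctan(v/u)$, $\tilde h=\frac{\gamma p}{(\gamma-1)\rho}$, $$W(U)=\Big(\rho u,\ \rho u^2+p,\ \rho uv,\ \rho u\big(\tilde h+\tfrac{q^2}{2}\big)\Big),\qquad H(U)=\Big(\rho v,\ \rho uv,\ \rho v^2+p,\ \rho v\big(\tilde h+\tfrac{q^2}{2}\big)\Big),\qquad \lambda_5=\frac{uv+c\sqrt{u^2+v^2-c^2}}{u^2-c^2}.$$ Let $R_5^+(U_\infty)$ be the set of states $U$ with $\rho<\rho_\infty$ that can be joined to $U_\infty$, within $\{p>0,\ \rho>0,\ u>c\}$, by a differentiable curve satisfying $dp=c^2\,d\rho$, $du=-\lambda_5\,dv$, $\rho(\lambda_5u-v)\,dv=dp$. Put $$c_*=\sqrt{\tfrac{(\gamma-1)u_\infty^2}{\gamma+1}+\tfrac{2c_\infty^2}{\gamma+1}},\qquad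 q_*=\sqrt{u_\infty^2+\tfrac{2c_\infty^2}{\gamma-1}},\qquad \theta_{\rm crit}=\inf\{\theta(U):\ U\in R_5^+(U_\infty),\ u>c_*,\ q<q_*\}.$$ Let $g_*$ be Lipschitz with $g_*(x)=0$ for $x\le 0$, and suppose that for every $x>0$ the right derivative $g_*'(x)$ exists, that $g_*'$ is monotone decreasing with bounded total variation on $(0,\infty)$, and that $\arctan g_*'(x)\in(\theta_{\rm crit},0)$ for all $x>0$. Let $\Omega=\{(x,y): x>0,\ y>g_*(x)\}$. An entropy solution is a measurable $U:\Omega\to\mathbb R^4$, in $BV_{loc}(\Omega)$, whose values on each bounded part of $\Omega$ lie a.e. in a compact subset of $\{p>0,\ \rho>0,\ u>c\}$, such that (i) for all $\eta\in C^2$, $Q\in C^1$ (as functions of $W$, near the values of $W$ on $\{p>0,\rho>0,u>c\}$) with $\nabla^2\eta(W)\ge 0$ and $\nabla Q(W)=\nabla\eta(W)\,\nabla_W H(U(W))$ there, and all $0\le\psi\in C_c^\infty(\mathbb R^2)$ with support in $\{y>g_*(x)\}$, $$\iint_\Omega\big(\eta(W(U))\psi_x+Q(W(U))\psi_y\big)\,dx\,dy+\int_0^\infty\eta(W(U_\infty))\,\psi(0,y)\,dy\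 \ge\ 0;$$ (ii) the trace of $(u,v)\cdot\mathbf n$ on the wall is zero, where $\mathbf n=(g_*',-1)/\sqrt{1+(g_*')^2}$: for every $R>0$, $$\frac1\varepsilon\iint_{0<x<R,\ g_*(x)<y<g_*(x)+\varepsilon}|(u,v)\cdot\mathbf n|\,dx\,dy\to0\qquad(\varepsilon\to0^+).$$ Then there is an entropy solution $U^*$ with values in the region $\{u>c_*,\ q<q_*\}$, and every entropy solution with values a.e. in this region equals $U^*$ a.e. in $\Omega$. Moreover $U^*$ connects to $U_\infty$ through a strong rarefaction wave $R_5^+(U_\infty)$: $U^*$ is continuous in $\Omega$; $U^*=U_\infty$ where $y\ge\lambda_5(U_\infty)x$; and for each $(x,y)\in\Omega$ with $y<\lambda_5(U_\infty)x$ one has $U^*(x,y)\in R_5^+(U_\infty)$, and $(x,y)$ lies on a ray $\{(x',\,g_*(t)+\lambda_5(U^*(x,y))(x'-t)):\ x'>t\}\subset\Omega$, $0\le t<x$, issuing from the wall, along which $U^*$ is constant. -/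

import Mathlib

open Set Filter Topology MeasureTheory
open scoped ContDiff

noncomputable section

namespace SteadyEuler

/-- States `(u, v, p, ρ)` of a non-reacting gas (reactant fraction `Z = 0`). -/
abbrev State := Fin 4 → ℝ

/-- Horizontal velocity `u`. -/
def velX (U : State) : ℝ := U 0

/-- Vertical velocity `v`. -/
def velY (U : State) : ℝ := U 1

/-- Pressure `p`. -/
def pres (U : State) : ℝ := U 2

/-- Density `ρ`. -/
def dens (U : State) : ℝ := U 3

/-- Flow speed `q = √(u² + v²)`. -/
def speed (U : State) : ℝ := √(velX U ^ 2 + velY U ^ 2)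

/-- Flow angle `θ = arctan (v / u)`. -/
def angle (U : State) : ℝ := Real.arctan (velY U / velX U)

/-- Sonic speed `c = √(γ p / ρ)` of an ideal polytropic gas. -/
def sonic (γ : ℝ) (U : State) : ℝ := √(γ * pres U / dens U)

/-- Specific enthalpy plus kinetic energy, `γ p / ((γ - 1) ρ) + (u² + v²) / 2`. -/
def totalEnthalpy (γ : ℝ) (U : State) : ℝ :=
  γ * pres U / ((γ - 1) * dens U) + (velX U ^ 2 + velY U ^ 2) / 2

/-- The conserved quantities `W(U)`, i.e. the fluxes in the time-like direction `x`. -/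
def fluxX (γ : ℝ) (U : State) : Fin 4 → ℝ :=
  ![dens U * velX U,
    dens U * velX U ^ 2 + pres U,
    dens U * velX U * velY U,
    dens U * velX U * totalEnthalpy γ U]

/-- The fluxes `H(U)` in the direction `y`. The Euler equations are `W(U)_x + H(U)_y = 0`. -/
def fluxY (γ : ℝ) (U : State) : Fin 4 → ℝ :=
  ![dens U * velY U,
    dens U * velX U * velY U,
    dens U * velY U ^ 2 + pres U,
    dens U * velY U * totalEnthalpy γ U]

/-- The states with positive pressure and density and with `u > c`, where the system is hyperbolic
with `x` as time and `W` is a change of variables. -/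
def supersonicStates (γ : ℝ) : Set State :=
  {U | 0 < pres U ∧ 0 < dens U ∧ sonic γ U < velX U}

/-- The characteristic speed (slope) of the fifth family. -/
def lambda5 (γ : ℝ) (U : State) : ℝ :=
  (velX U * velY U + sonic γ U * √(velX U ^ 2 + velY U ^ 2 - sonic γ U ^ 2)) /
    (velX U ^ 2 - sonic γ U ^ 2)

/-- The rarefaction curve `R₅⁺(U₀)`: the states `U` with `ρ < ρ₀` that can be joined to `U₀`
within the supersonic states by a curve along which
`dp = c² dρ`, `du = - λ₅ dv` and `ρ (λ₅ u - v) dv = dp`. -/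
def rarefaction5 (γ : ℝ) (U₀ : State) : Set State :=
  {U | dens U < dens U₀ ∧
    ∃ Y Y' : ℝ → State, Y 0 = U₀ ∧ Y 1 = U ∧
      ∀ s ∈ Icc (0 : ℝ) 1,
        Y s ∈ supersonicStates γ ∧
        HasDerivWithinAt Y (Y' s) (Icc 0 1) s ∧
        pres (Y' s) = sonic γ (Y s) ^ 2 * dens (Y' s) ∧
        velX (Y' s) = -lambda5 γ (Y s) * velY (Y' s) ∧
        dens (Y s) * (lambda5 γ (Y s) * velX (Y s) - velY (Y s)) * velY (Y' s) = pres (Y' s)}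

/-- The critical sonic speed `c_*` of the incoming state. -/
def cStar (γ : ℝ) (Uinf : State) : ℝ :=
  √((γ - 1) * velX Uinf ^ 2 / (γ + 1) + 2 * sonic γ Uinf ^ 2 / (γ + 1))

/-- The critical (limit) speed `q_*` of the incoming state. -/
def qStar (γ : ℝ) (Uinf : State) : ℝ :=
  √(velX Uinf ^ 2 + 2 * sonic γ Uinf ^ 2 / (γ - 1))

/-- The region `{u > c_*, q < q_*}`. -/
def region (γ : ℝ) (Uinf : State) : Set State :=
  {U | cStar γ Uinf < velX U ∧ speed U < qStar γ Uinf}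

/-- The critical angle: the infimum of the flow angles of the states on `R₅⁺(U_∞)` that lie in
the region `{u > c_*, q < q_*}`. -/
def thetaCrit (γ : ℝ) (Uinf : State) : ℝ :=
  sInf (angle '' (rarefaction5 γ Uinf ∩ region γ Uinf))

/-- The slope `g'(x+)` of the wall `y = g(x)`. -/
def wallSlope (g : ℝ → ℝ) (x : ℝ) : ℝ := derivWithin g (Ioi x) x

/-- The flow domain `Ω` above the wall. -/
def flowDomain (g : ℝ → ℝ) : Set (ℝ × ℝ) := {z | 0 < z.1 ∧ g z.1 < z.2}

/-- Convex entropy pairs `(η, Q)` with respect to the conserved quantities `W`, on the set of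
values of `W` at supersonic states: `∇²η(W) ≥ 0`, and `∇Q(W) = ∇η(W) ∇_W H`. The latter identity
is written after multiplication by the invertible matrix `∇_U W`. -/
structure IsConvexEntropyPair (γ : ℝ) (η Q : (Fin 4 → ℝ) → ℝ) : Prop where
  smooth_entropy : ∀ U ∈ supersonicStates γ, ContDiffAt ℝ 2 η (fluxX γ U)
  smooth_flux : ∀ U ∈ supersonicStates γ, ContDiffAt ℝ 1 Q (fluxX γ U)
  hessian_nonneg : ∀ U ∈ supersonicStates γ, ∀ w : Fin 4 → ℝ,
    0 ≤ iteratedFDeriv ℝ 2 η (fluxX γ U) ![w, w]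
  compatible : ∀ U ∈ supersonicStates γ,
    (fderiv ℝ Q (fluxX γ U)).comp (fderiv ℝ (fluxX γ) U) =
      (fderiv ℝ η (fluxX γ U)).comp (fderiv ℝ (fluxY γ) U)

/-- `f` is locally of bounded variation in `D`: it is locally integrable there and its first
distributional derivatives are locally finite measures, i.e. of order zero on each compact set. -/
def IsLocBV (D : Set (ℝ × ℝ)) (f : ℝ × ℝ → ℝ) : Prop :=
  LocallyIntegrableOn f D ∧
  ∀ K ⊆ D, IsCompact K → ∀ e ∈ ({(1, 0), (0, 1)} : Set (ℝ × ℝ)), ∃ C : ℝ,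
    ∀ φ : ℝ × ℝ → ℝ, ContDiff ℝ ∞ φ → tsupport φ ⊆ K →
      ∀ M : ℝ, (∀ z, |φ z| ≤ M) → |∫ z in D, f z * fderiv ℝ φ z e| ≤ C * M

/-- Entropy solutions of the steady Euler equations in the domain above the wall `y = g(x)`, with
`U = U_∞` at `x = 0` and `(u, v) · n = 0` on the wall. -/
structure IsEntropySolution (γ : ℝ) (g : ℝ → ℝ) (Uinf : State) (U : ℝ × ℝ → State) : Prop where
  measurable : AEStronglyMeasurable U (volume.restrict (flowDomain g))
  /-- On each bounded part of the domain `U` is essentially bounded and essentially bounded away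
  from vacuum and from sonic states. -/
  compact_range : ∀ R : ℝ, ∃ K ⊆ supersonicStates γ, IsCompact K ∧
    ∀ᵐ z ∂(volume.restrict (flowDomain g ∩ Metric.ball 0 R)), U z ∈ K
  locBV : ∀ i, IsLocBV (flowDomain g) (fun z => U z i)
  /-- The entropy inequality, including the initial condition. For `η = ± W_i` it is the weak form
  of the equations. -/
  entropy : ∀ η Q, IsConvexEntropyPair γ η Q →
    ∀ ψ : ℝ × ℝ → ℝ, ContDiff ℝ ∞ ψ → HasCompactSupport ψ →
      tsupport ψ ⊆ {z | g z.1 < z.2} → (∀ z, 0 ≤ ψ z) →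
      0 ≤ (∫ z in flowDomain g,
            (η (fluxX γ (U z)) * fderiv ℝ ψ z (1, 0) + Q (fluxX γ (U z)) * fderiv ℝ ψ z (0, 1)))
          + ∫ y in Ioi (0 : ℝ), η (fluxX γ Uinf) * ψ (0, y)
  /-- The trace of `(u, v) · n` on the wall vanishes, where
  `n = (g', -1) / √(1 + g'²)`: its averages over thin layers along the wall tend to zero in `L¹`. -/
  slip : ∀ R : ℝ, Tendsto
    (fun ε : ℝ => ε⁻¹ * ∫ z in {z : ℝ × ℝ | 0 < z.1 ∧ z.1 < R ∧ g z.1 < z.2 ∧ z.2 < g z.1 + ε},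
      |(velX (U z) * wallSlope g z.1 - velY (U z)) / √(1 + wallSlope g z.1 ^ 2)|)
    (𝓝[>] 0) (𝓝 0)

/-- `U` connects to `U_∞` by a strong `5`-rarefaction wave issuing from the wall: `U` is continuous
in the domain, equals `U_∞` on and above the leading characteristic `y = λ₅(U_∞) x`, and below it
takes values on `R₅⁺(U_∞)` and is constant along straight `5`-characteristics that start at the
points of the wall. -/
structure ConnectsByRarefaction (γ : ℝ) (g : ℝ → ℝ) (Uinf : State) (U : ℝ × ℝ → State) :
    Prop where
  continuousOn : ContinuousOn U (flowDomain g)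
  upstream : ∀ z ∈ flowDomain g, lambda5 γ Uinf * z.1 ≤ z.2 → U z = Uinf
  wave : ∀ z ∈ flowDomain g, z.2 < lambda5 γ Uinf * z.1 →
    U z ∈ rarefaction5 γ Uinf ∧
    ∃ t ∈ Ico 0 z.1, z.2 = g t + lambda5 γ (U z) * (z.1 - t) ∧
      ∀ x > t, (x, g t + lambda5 γ (U z) * (x - t)) ∈ flowDomain g ∧
        U (x, g t + lambda5 γ (U z) * (x - t)) = U z

end SteadyEuler

end

/-! Existence is explicit. Along the curve R₅⁺ the entropy and the total enthalpy are constant, and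
the curve is parametrized by the angle α of the 5-characteristic: the velocity component along the
characteristic is q_* cos φ and the one across it is the sound speed c_* sin φ, with a phase φ that
is affine in α (the Prandtl–Meyer epicycloid). On the part with u > c_* the slope v/u of the flow is
strictly increasing in α, so every wall slope beyond the critical one selects one angle, the
upstream Mach angle corresponding to slope zero. The flow is less steep than its characteristic and
the wall is concave; hence the straight characteristics issuing from the wall spread out, never
cross and fill the domain, with a centred fan at each corner (`FanData.exists_onRay`,
`FanData.ray_compare`). Their slope l is locally Lipschitz away from the wall, solves l_x + l l_y =
0 and satisfies l_y ≥ 0. Since the derivatives of W and H along the curve are cos α and sin α times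
the same vector, the resulting simple wave `fanState` satisfies every entropy relation with
equality. Its slip defect in a layer of width ε is dominated by a shift of the monotone wall slope
by O(ε), so the trace vanishes although the slope may jump.

Uniqueness is a relative energy argument. For the wave U and another solution V, `relEnergy` and
`relFlux` combine the mass and momentum fluxes of V and the pressure of U with coefficients that
depend on U only. Four facts carry the proof. (a) V has the total enthalpy of U_∞ and at least its
entropy. This follows from the entropies ρu(B − b)² and ρu max(S − b, 0)³, where B is the enthalpy
and S the negative entropy; both are nonnegative and vanish upstream. (b) For such V the relative
energy is positive unless V = U (`Upstream.rel_pos`). This rests on Bernoulli's law, on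
supersonicity, and on the scalar inequality `rpow_mul_lt_one`. (c) The relative energy is dissipated
(`Admissible.relEnergy_dissipative`): U is an expansion wave, and the pressure is a convex function
of the density at fixed entropy. (d) No relative energy enters through the wall, because its flux
there is linear in the two slip defects (`relFlux_sub`), nor from above, because lines of large
slope are crossed in one direction only (`Upstream.exists_lateral`). The second point is delicate,
since the region u > c_* touches the sonic state (c_*, 0), where the propagation speed is unbounded;
there the energy has a positive lower bound that dominates its flux. A weak inequality with these
properties, tested with a function that decreases linearly in x, forces the energy to vanish
(`ae_eq_zero_of_dissipative`). The same estimate, applied to the entropies in (a), gives (a). -/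

noncomputable section


namespace SteadyEuler

/-! ### The scalar inequality behind the positivity of the relative energy -/

/-- Second-order binomial inequality for exponents in `(0, 1)`. -/
theorem one_sub_rpow_lt {s ζ : ℝ} (hs0 : 0 < s) (hs1 : s < 1) (hζ : 0 < ζ) (hζ1 : ζ < 1) :
    (1 - ζ) ^ s < 1 - s * ζ - s * (1 - s) * ζ ^ 2 / 2 := by
  -- Bernoulli's inequality for the exponent 1 - s, inverted: (1 - x)^(1 - s) ≤ 1 - (1 - s) x, and
  -- (1 + t)(1 - t) < 1 with t = (1 - s) x.
  have key : ∀ x ∈ Ioo (0 : ℝ) 1, (1 - x) ^ (s - 1) > 1 + (1 - s) * x := by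
    intro x hx
    have h1 : 0 < 1 - x := by linarith [hx.2]
    have h4 : 0 < (1 - x) ^ (s - 1) := Real.rpow_pos_of_pos h1 _
    have h5 : (1 - x) ^ (s - 1) * (1 - x) ^ (1 - s) = 1 := by
      rw [← Real.rpow_add h1]; norm_num
    have h6 : (1 - x) ^ (1 - s) ≤ 1 + (1 - s) * (-x) := by
      have := rpow_one_add_le_one_add_mul_self (s := -x) (by linarith [hx.2])
        (p := 1 - s) (by linarith) (by linarith)
      simpa [sub_eq_add_neg] using this
    have h7 : 0 < (1 - x) ^ (1 - s) := Real.rpow_pos_of_pos h1 _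
    have h8 : (1 + (1 - s) * x) * (1 - x) ^ (1 - s) < 1 := by
      have hp : 0 < (1 - s) * x := mul_pos (by linarith) hx.1
      nlinarith
    by_contra hcon
    push Not at hcon
    nlinarith
  have hanti : StrictAntiOn (fun x : ℝ => (1 - x) ^ s - (1 - s * x - s * (1 - s) * x ^ 2 / 2))
      (Icc 0 ζ) := by
    apply strictAntiOn_of_deriv_neg (convex_Icc _ _)
    · intro x hx
      have : (1 - x) ≠ 0 := by linarith [hx.2]
      apply ContinuousAt.continuousWithinAt
      apply ContinuousAt.sub _ (by fun_prop)
      exact ContinuousAt.rpow_const (by fun_prop) (Or.inl this)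
    · intro x hx
      rw [interior_Icc] at hx
      have h1 : (1 - x) ≠ 0 := by linarith [hx.2]
      have hd : HasDerivAt (fun x : ℝ => (1 - x) ^ s - (1 - s * x - s * (1 - s) * x ^ 2 / 2))
          ((-1) * s * (1 - x) ^ (s - 1) - (0 - s * 1 - s * (1 - s) * (2 * x) / 2)) x := by
        apply HasDerivAt.sub
        · apply HasDerivAt.rpow_const _ (Or.inl h1)
          simpa using (hasDerivAt_id x).const_sub 1
        · apply HasDerivAt.sub
          · exact (hasDerivAt_const x (1:ℝ)).sub ((hasDerivAt_id x).const_mul s)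
          · simpa using (((hasDerivAt_id x).pow 2).const_mul (s * (1 - s))).div_const 2
      rw [hd.deriv]
      have := key x ⟨hx.1, by linarith [hx.2]⟩
      nlinarith
  have := hanti (left_mem_Icc.2 hζ.le) (right_mem_Icc.2 hζ.le) hζ
  simp at this
  linarith

/-- `P` stands for u(a - u) + v(b - v). With ζ = -aP/(uTy) the left side is y^n (1 - ζ), so it
suffices that y (1 - ζ)^(1/n) < 1. The second-order binomial inequality turns this into a polynomial
inequality: Bernoulli's law `hB'` bounds y from above, and the supersonicity `hV` of (a, b) absorbs
the quadratic remainder. -/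
theorem rpow_mul_lt_one_of_neg {n u v a b T y P : ℝ} (hn : 1 < n) (hT : 0 < T) (hu : 0 < u)
    (hy : 0 < y) (ha : 0 < a) (hV : n * (y * T) ≤ (n - 1) * a ^ 2)
    (hB' : n * T * (y - 1) = -(P + ((a - u) ^ 2 + (b - v) ^ 2) / 2)) (hP0 : P < 0) :
    y ^ (n - 1) * (y + a * P / (u * T)) < 1 := by
  have hn0 : 0 < n := by linarith
  obtain ⟨e, he⟩ : ∃ e, e = -P / u := ⟨_, rfl⟩
  have he0 : 0 < e := by rw [he]; exact div_pos (by linarith) hu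
  have hPe : P = -(u * e) := by rw [he]; field_simp
  obtain ⟨ζ, hζ⟩ : ∃ ζ, ζ = a * e / (T * y) := ⟨_, rfl⟩
  have hζ0 : 0 < ζ := by rw [hζ]; positivity
  have hfac : y + a * P / (u * T) = y * (1 - ζ) := by
    rw [hPe, hζ]; field_simp; ring
  rw [hfac]
  have hyn : y ^ (n - 1) * (y * (1 - ζ)) = y ^ n * (1 - ζ) := by
    rw [← mul_assoc, ← Real.rpow_add_one hy.ne']; norm_num
  rw [hyn]
  have hyp : 0 < y ^ n := Real.rpow_pos_of_pos hy _
  rcases le_or_gt 1 ζ with h1 | h1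
  · nlinarith
  have hb := one_sub_rpow_lt (s := 1 / n) (by positivity) (by rw [div_lt_one hn0]; exact hn) hζ0 h1
  have haζ : a * e = ζ * (T * y) := by rw [hζ]; field_simp
  have hq : y * (1 - 1 / n * ζ - 1 / n * (1 - 1 / n) * ζ ^ 2 / 2) ≤ 1 := by
    have h2 : n * T * (y - 1) ≤ a * e + e ^ 2 / 2 := by
      rw [hB', hPe]
      nlinarith [sq_nonneg (a - u + e), sq_nonneg (b - v)]
    have h3 : n * e ^ 2 ≤ (n - 1) * ζ ^ 2 * T * y := by
      have h4 : a ^ 2 * e ^ 2 = ζ ^ 2 * (T * y) ^ 2 := by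
        rw [← mul_pow, haζ]; ring
      have h5 : n * (y * T) * e ^ 2 ≤ (n - 1) * (ζ ^ 2 * (T * y) ^ 2) := by
        rw [← h4]; linarith [mul_le_mul_of_nonneg_right hV (sq_nonneg e)]
      have h6 : 0 < y * T := by positivity
      have h7 : (y * T) * (n * e ^ 2) ≤ (y * T) * ((n - 1) * ζ ^ 2 * T * y) := by
        calc _ = n * (y * T) * e ^ 2 := by ring
          _ ≤ _ := h5
          _ = _ := by ring
      exact le_of_mul_le_mul_left h7 h6
    have h8 : n * T * (y - 1) ≤ ζ * (T * y) + (n - 1) * ζ ^ 2 * T * y / (2 * n) := by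
      rw [haζ] at h2
      have : e ^ 2 / 2 ≤ (n - 1) * ζ ^ 2 * T * y / (2 * n) := by
        rw [div_le_div_iff₀ (by norm_num) (by positivity)]; linarith
      linarith
    have h9 : n * T * (y * (1 - 1 / n * ζ - 1 / n * (1 - 1 / n) * ζ ^ 2 / 2)) =
        n * T * y - ζ * (T * y) - (n - 1) * ζ ^ 2 * T * y / (2 * n) := by
      field_simp
    have : n * T * (y * (1 - 1 / n * ζ - 1 / n * (1 - 1 / n) * ζ ^ 2 / 2)) ≤ n * T * 1 := by
      rw [h9]; linarith
    exact le_of_mul_le_mul_left this (by positivity)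
  have h1ζ : 0 < 1 - ζ := by linarith
  have hlt : y * (1 - ζ) ^ (1 / n) < 1 := lt_of_lt_of_le (mul_lt_mul_of_pos_left hb hy) hq
  have hpos : 0 ≤ y * (1 - ζ) ^ (1 / n) := by positivity
  have := Real.rpow_lt_one hpos hlt hn0
  rwa [Real.mul_rpow hy.le (by positivity), ← Real.rpow_mul h1ζ.le, one_div,
    inv_mul_cancel₀ hn0.ne', Real.rpow_one] at this

/-- The velocity moves from (u, v) to (a, b) along a segment with parameter t, the temperature ratio
`Y t` being dictated by Bernoulli's law. The quantity is 1 at t = 0 and strictly decreases, thanks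
to the supersonicity `hU` of the starting point. -/
theorem rpow_mul_lt_one_of_nonneg {n u v a b T y P : ℝ} (hn : 1 < n) (hT : 0 < T) (hu : 0 < u)
    (hU : n * T < (n - 1) * u ^ 2) (hy : 0 < y) (ha : 0 < a)
    (hB' : n * T * (y - 1) = -(P + ((a - u) ^ 2 + (b - v) ^ 2) / 2)) (hP0 : 0 ≤ P)
    (hd : 0 < (a - u) ^ 2 + (b - v) ^ 2) :
    y ^ (n - 1) * (y + a * P / (u * T)) < 1 := by
  obtain ⟨D, hD⟩ : ∃ D, D = (a - u) ^ 2 + (b - v) ^ 2 := ⟨_, rfl⟩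
  rw [← hD] at hB' hd
  let Y : ℝ → ℝ := fun t => 1 - (t * P + t ^ 2 * D / 2) / (n * T)
  let Z : ℝ → ℝ := fun t => (u + t * (a - u)) * (t * P) / (u * T)
  have hnT : 0 < n * T := by positivity
  have hY1 : Y 1 = y := by
    simp only [Y]; field_simp; linarith
  have hYle : ∀ t ∈ Icc (0 : ℝ) 1, y ≤ Y t ∧ Y t ≤ 1 := by
    intro t ht
    constructor
    · rw [← hY1]
      simp only [Y]
      have : (t * P + t ^ 2 * D / 2) / (n * T) ≤ (1 * P + 1 ^ 2 * D / 2) / (n * T) := by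
        apply div_le_div_of_nonneg_right _ hnT.le
        have := ht.1; have := ht.2
        have : t ^ 2 ≤ 1 := by nlinarith
        nlinarith
      linarith
    · simp only [Y]
      have : 0 ≤ (t * P + t ^ 2 * D / 2) / (n * T) := by
        have := ht.1; positivity
      linarith
  have hY' : ∀ t, HasDerivAt Y (-(P + t * D) / (n * T)) t := by
    intro t
    have : HasDerivAt Y (-((1 * P + (2 * t) * D / 2) / (n * T))) t := by
      apply HasDerivAt.const_sub
      apply HasDerivAt.div_const
      apply HasDerivAt.add ((hasDerivAt_id t).mul_const P)
      apply HasDerivAt.div_const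
      apply HasDerivAt.mul_const
      simpa using hasDerivAt_pow 2 t
    convert this using 1; ring
  have hZ' : ∀ t, HasDerivAt Z ((u * P + 2 * t * (a - u) * P) / (u * T)) t := by
    intro t
    have : HasDerivAt Z (((1 * (a - u)) * (t * P) + (u + t * (a - u)) * (1 * P)) / (u * T)) t := by
      apply HasDerivAt.div_const
      exact (((hasDerivAt_id t).mul_const (a - u)).const_add u).mul
        ((hasDerivAt_id t).mul_const P)
    convert this using 1; ring
  have hanti : StrictAntiOn (fun t => Y t ^ (n - 1) * (Y t + Z t)) (Icc 0 1) := by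
    have hder : ∀ t ∈ Icc (0 : ℝ) 1, HasDerivAt (fun t => Y t ^ (n - 1) * (Y t + Z t))
        ((-(P + t * D) / (n * T)) * (n - 1) * Y t ^ (n - 1 - 1) * (Y t + Z t) +
          Y t ^ (n - 1) * (-(P + t * D) / (n * T) + (u * P + 2 * t * (a - u) * P) / (u * T))) t := by
      intro t ht
      have hYt : Y t ≠ 0 := by linarith [(hYle t ht).1]
      exact ((hY' t).rpow_const (Or.inl hYt)).mul ((hY' t).add (hZ' t))
    apply strictAntiOn_of_deriv_neg (convex_Icc _ _)
    · intro t ht; exact (hder t ht).continuousAt.continuousWithinAt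
    · intro t ht
      rw [interior_Icc] at ht
      have ht' : t ∈ Icc (0 : ℝ) 1 := ⟨ht.1.le, ht.2.le⟩
      rw [(hder t ht').deriv]
      obtain ⟨h1, h2⟩ := hYle t ht'
      have hYt : 0 < Y t := by linarith
      have hpow : Y t ^ (n - 1) = Y t ^ (n - 1 - 1) * Y t := by
        rw [← Real.rpow_add_one hYt.ne']; norm_num
      rw [hpow]
      have hp0 : 0 < Y t ^ (n - 1 - 1) := Real.rpow_pos_of_pos hYt _
      have hut : 0 < u + t * (a - u) := by nlinarith [ht.1, ht.2]
      -- Up to a positive factor this is the derivative in t. If a < u the first term is negative.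
      -- Otherwise completing a square gives 2(a - u)Pu - Du² ≤ P², and for P > 0 this is beaten by
      -- the second term because of `hU` and Y ≤ 1.
      have hbr : Y t * (2 * (a - u) * P * u - D * u ^ 2) * (n * T)
          - (n - 1) * (P + t * D) * (u + t * (a - u)) * P * u < 0 := by
        have hs0 : 0 ≤ (n - 1) * (P + t * D) * (u + t * (a - u)) * P * u := by
          have := ht.1
          have : 0 ≤ n - 1 := by linarith
          positivity
        rcases lt_or_ge (a - u) 0 with ha1 | ha1
        · have : 2 * (a - u) * P * u - D * u ^ 2 < 0 := by
            have h3 : (a - u) * P * u ≤ 0 := by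
              have : 0 ≤ P * u := by positivity
              nlinarith
            have : 0 < D * u ^ 2 := by positivity
            linarith
          have := mul_neg_of_neg_of_pos (mul_neg_of_pos_of_neg hYt this) hnT
          linarith
        · rcases hP0.eq_or_lt with hP00 | hP00
          · rw [← hP00] at hs0 ⊢
            have : 0 < Y t * (D * u ^ 2) * (n * T) := by positivity
            linarith
          · have h3 : 2 * (a - u) * P * u - D * u ^ 2 ≤ P ^ 2 := by
              have : P ^ 2 - 2 * (a - u) * P * u + D * u ^ 2 =
                  (P - (a - u) * u) ^ 2 + (b - v) ^ 2 * u ^ 2 := by rw [hD]; ring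
              linarith [sq_nonneg (P - (a - u) * u), mul_nonneg (sq_nonneg (b - v)) (sq_nonneg u)]
            have h4 : Y t * (2 * (a - u) * P * u - D * u ^ 2) ≤ P ^ 2 := by
              calc _ ≤ Y t * P ^ 2 := mul_le_mul_of_nonneg_left h3 hYt.le
                _ ≤ 1 * P ^ 2 := mul_le_mul_of_nonneg_right h2 (sq_nonneg _)
                _ = _ := one_mul _
            have h5 : (n - 1) * P * u * P * u ≤
                (n - 1) * (P + t * D) * (u + t * (a - u)) * P * u := by
              have := ht.1
              have : 0 ≤ n - 1 := by linarith
              gcongr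
              · exact le_add_of_nonneg_right (by positivity)
              · exact le_add_of_nonneg_right (mul_nonneg ht.1.le ha1)
            have h6 : P ^ 2 * (n * T) < (n - 1) * P * u * P * u := by
              have := mul_lt_mul_of_pos_left hU (by positivity : 0 < P ^ 2)
              linarith
            linarith [mul_le_mul_of_nonneg_right h4 hnT.le]
      have heq : (-(P + t * D) / (n * T)) * (n - 1) * Y t ^ (n - 1 - 1) * (Y t + Z t) +
          Y t ^ (n - 1 - 1) * Y t *
            (-(P + t * D) / (n * T) + (u * P + 2 * t * (a - u) * P) / (u * T)) =
          Y t ^ (n - 1 - 1) * (t / (u ^ 2 * T * (n * T))) *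
            (Y t * (2 * (a - u) * P * u - D * u ^ 2) * (n * T)
              - (n - 1) * (P + t * D) * (u + t * (a - u)) * P * u) := by
        simp only [Z]; field_simp; ring
      rw [heq]
      have := ht.1
      exact mul_neg_of_pos_of_neg (by positivity) hbr
  have := hanti (left_mem_Icc.2 zero_le_one) (right_mem_Icc.2 zero_le_one) one_pos
  simp only [hY1] at this
  simp only [Y, Z] at this
  simpa [add_sub_cancel] using this

/-- The strict relative-entropy inequality behind uniqueness: `(u, v)` is a velocity with
temperature `T`, `(a, b)` a velocity with temperature `y T`, with the same total enthalpy. -/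
theorem rpow_mul_lt_one {n u v a b T y : ℝ} (hn : 1 < n) (hT : 0 < T) (hu : 0 < u)
    (hU : n * T < (n - 1) * u ^ 2) (hy : 0 ≤ y) (ha : 0 < a) (hV : n * (y * T) ≤ (n - 1) * a ^ 2)
    (hB : n * T * (y - 1) = ((u ^ 2 + v ^ 2) - (a ^ 2 + b ^ 2)) / 2) (hne : a ≠ u ∨ b ≠ v) :
    y ^ (n - 1) * (y + a * (u * (a - u) + v * (b - v)) / (u * T)) < 1 := by
  rcases hy.eq_or_lt with rfl | hy
  · rw [Real.zero_rpow (by linarith)]; simp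
  obtain ⟨P, hP⟩ : ∃ P, P = u * (a - u) + v * (b - v) := ⟨_, rfl⟩
  have hd : 0 < (a - u) ^ 2 + (b - v) ^ 2 := by
    rcases hne with h | h
    · have := sub_ne_zero.2 h; positivity
    · have := sub_ne_zero.2 h; positivity
  have hB' : n * T * (y - 1) = -(P + ((a - u) ^ 2 + (b - v) ^ 2) / 2) := by
    rw [hB, hP]; ring
  rw [← hP]
  rcases lt_or_ge P 0 with hP0 | hP0
  · exact rpow_mul_lt_one_of_neg hn hT hu hy ha hV hB' hP0
  · exact rpow_mul_lt_one_of_nonneg hn hT hu hU hy ha hB' hP0 hd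

/-! ### Mollification, and weak inequalities tested with Lipschitz functions -/

/-- The directional derivatives of a mollified Lipschitz function are the mollified directional
derivatives. -/
theorem fderiv_normed_convolution {χ : ℝ × ℝ → ℝ} {C : NNReal} (hχ : LipschitzWith C χ)
    (φ : ContDiffBump (0 : ℝ × ℝ)) (z v : ℝ × ℝ) :
    fderiv ℝ (convolution (φ.normed volume) χ (ContinuousLinearMap.lsmul ℝ ℝ) volume) z v =
      convolution (φ.normed volume) (fun z => fderiv ℝ χ z v) (ContinuousLinearMap.lsmul ℝ ℝ)
        volume z := by
  have hsm : ContDiff ℝ 1 (convolution (φ.normed volume) χ (ContinuousLinearMap.lsmul ℝ ℝ) volume) :=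
    HasCompactSupport.contDiff_convolution_left (n := 1) _ φ.hasCompactSupport_normed
      φ.contDiff_normed hχ.continuous.locallyIntegrable
  have h1 : HasDerivAt (fun s : ℝ => convolution (φ.normed volume) χ
      (ContinuousLinearMap.lsmul ℝ ℝ) volume (z + s • v))
      (fderiv ℝ (convolution (φ.normed volume) χ (ContinuousLinearMap.lsmul ℝ ℝ) volume) z v) 0 := by
    have h2 := (hsm.differentiable (by norm_num)).differentiableAt (x := z) |>.hasFDerivAt
    have h3 : HasDerivAt (fun s : ℝ => z + s • v) v 0 := by
      simpa using ((hasDerivAt_id (0 : ℝ)).smul_const v).const_add z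
    exact HasFDerivAt.comp_hasDerivAt (f := fun s : ℝ => z + s • v) 0 (by simpa using h2) h3
  have hcφ : Continuous (φ.normed volume) := (φ.contDiff_normed (n := 0)).continuous
  have hmd : Measurable (fun t => fderiv ℝ χ (z - t) v) :=
    (measurable_fderiv_apply_const ℝ χ v).comp (measurable_const.sub measurable_id)
  have hae : ∀ᵐ t : ℝ × ℝ, DifferentiableAt ℝ χ (z - t) :=
    (quasiMeasurePreserving_sub_left volume z).ae hχ.ae_differentiableAt
  -- Differentiation under the integral: the difference quotients of χ are bounded by its Lipschitz
  -- constant and converge almost everywhere by Rademacher's theorem.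
  have h4 := hasDerivAt_integral_of_dominated_loc_of_lip (μ := (volume : Measure (ℝ × ℝ)))
    (F := fun (s : ℝ) (t : ℝ × ℝ) => φ.normed volume t * χ (z + s • v - t))
    (F' := fun t => φ.normed volume t * fderiv ℝ χ (z - t) v)
    (bound := fun t => φ.normed volume t * (C * ‖v‖)) (x₀ := 0) (s := univ) univ_mem ?_ ?_ ?_ ?_ ?_ ?_
  · exact h1.unique h4.2
  · refine Eventually.of_forall fun s => ?_
    exact (hcφ.mul (hχ.continuous.comp (by fun_prop))).aestronglyMeasurable
  · apply Continuous.integrable_of_hasCompactSupport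
    · exact hcφ.mul (hχ.continuous.comp (by fun_prop))
    · exact φ.hasCompactSupport_normed.mul_right
  · exact (hcφ.measurable.mul hmd).aestronglyMeasurable
  · refine Eventually.of_forall fun t => ?_
    apply LipschitzOnWith.of_dist_le_mul
    intro a _ b _
    have hφ0 := φ.nonneg_normed (μ := volume) t
    have hb0 : 0 ≤ φ.normed volume t * (C * ‖v‖) := mul_nonneg hφ0 (by positivity)
    rw [Real.dist_eq, ← mul_sub, abs_mul, abs_of_nonneg hφ0, Real.coe_nnabs, abs_of_nonneg hb0,
      mul_assoc]
    apply mul_le_mul_of_nonneg_left _ hφ0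
    have := hχ.dist_le_mul (z + a • v - t) (z + b • v - t)
    rw [Real.dist_eq] at this
    refine this.trans (le_of_eq ?_)
    rw [dist_eq_norm, show z + a • v - t - (z + b • v - t) = (a - b) • v by module, norm_smul,
      Real.dist_eq, Real.norm_eq_abs]
    ring
  · exact φ.integrable_normed.mul_const _
  · filter_upwards [hae] with t ht
    apply HasDerivAt.const_mul
    have h3 : HasDerivAt (fun s : ℝ => z + s • v - t) v 0 := by
      simpa using (((hasDerivAt_id (0 : ℝ)).smul_const v).const_add z).sub_const t
    exact HasFDerivAt.comp_hasDerivAt (f := fun s : ℝ => z + s • v - t) 0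
      (by simpa using ht.hasFDerivAt) h3

/-- Smooth approximation of a compactly supported nonnegative Lipschitz function. -/
theorem exists_smooth_approx {χ : ℝ × ℝ → ℝ} {C : NNReal} (hχ : LipschitzWith C χ)
    (h0 : ∀ z, 0 ≤ χ z) {δ : ℝ} (hδ : 0 < δ) :
    ∃ ψ : ℕ → ℝ × ℝ → ℝ, (∀ n, ContDiff ℝ ∞ (ψ n)) ∧
      (∀ n, tsupport (ψ n) ⊆ Metric.cthickening δ (tsupport χ)) ∧ (∀ n z, 0 ≤ ψ n z) ∧
      (∀ n z v, |fderiv ℝ (ψ n) z v| ≤ C * ‖v‖) ∧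
      ∀ v, ∀ᵐ z, Tendsto (fun n => fderiv ℝ (ψ n) z v) atTop (𝓝 (fderiv ℝ χ z v)) := by
  -- The ratio of the outer to the inner radius stays equal to 2; a bounded ratio is what gives
  -- convergence at almost every point.
  let φ : ℕ → ContDiffBump (0 : ℝ × ℝ) := fun n =>
    ⟨δ / (2 * (n + 1)), δ / (n + 1), by positivity, by
      apply div_lt_div_of_pos_left hδ (by positivity); linarith [n.cast_nonneg (α := ℝ)]⟩
  have hbd : ∀ (z v : ℝ × ℝ), ‖fderiv ℝ χ z v‖ ≤ C * ‖v‖ := fun z v =>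
    (ContinuousLinearMap.le_opNorm _ _).trans
      (mul_le_mul_of_nonneg_right (norm_fderiv_le_of_lipschitz ℝ hχ) (norm_nonneg _))
  have hloc : ∀ v : ℝ × ℝ, LocallyIntegrable (fun z => fderiv ℝ χ z v) := by
    intro v
    refine (locallyIntegrable_const (C * ‖v‖ : ℝ)).mono
      (measurable_fderiv_apply_const ℝ χ v).aestronglyMeasurable (Eventually.of_forall fun z => ?_)
    refine (hbd z v).trans ?_
    rw [Real.norm_of_nonneg (by positivity)]
  refine ⟨fun n => convolution ((φ n).normed volume) χ (ContinuousLinearMap.lsmul ℝ ℝ) volume,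
    ?_, ?_, ?_, ?_, ?_⟩
  · intro n
    exact HasCompactSupport.contDiff_convolution_left (n := ⊤) _ (φ n).hasCompactSupport_normed
      (φ n).contDiff_normed hχ.continuous.locallyIntegrable
  · intro n
    apply closure_minimal _ Metric.isClosed_cthickening
    refine (support_convolution_subset _).trans ?_
    rw [ContDiffBump.support_normed_eq]
    rintro _ ⟨a, ha, b, hb, rfl⟩
    rw [mem_ball_zero_iff] at ha
    apply Metric.mem_cthickening_of_dist_le (a + b) b δ _ (subset_tsupport _ hb)
    rw [dist_eq_norm, add_sub_cancel_right]
    refine ha.le.trans ?_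
    exact div_le_self hδ.le (by linarith [n.cast_nonneg (α := ℝ)])
  · intro n z
    apply integral_nonneg
    intro t
    exact mul_nonneg ((φ n).nonneg_normed t) (h0 _)
  · intro n z v
    rw [fderiv_normed_convolution hχ]
    have : ‖convolution ((φ n).normed volume) (fun z => fderiv ℝ χ z v)
        (ContinuousLinearMap.lsmul ℝ ℝ) volume z‖ ≤ ∫ t, (φ n).normed volume t * (C * ‖v‖) := by
      apply norm_integral_le_of_norm_le ((φ n).integrable_normed.mul_const _)
      refine Eventually.of_forall fun t => ?_
      rw [ContinuousLinearMap.lsmul_apply, norm_smul, Real.norm_of_nonneg ((φ n).nonneg_normed t)]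
      exact mul_le_mul_of_nonneg_left (hbd _ _) ((φ n).nonneg_normed t)
    rwa [integral_mul_const, ContDiffBump.integral_normed, one_mul] at this
  · intro v
    have := ContDiffBump.ae_convolution_tendsto_right_of_locallyIntegrable (φ := φ) (l := atTop)
      (K := 2) ?_ ?_ (hloc v)
    · filter_upwards [this] with z hz
      simpa only [fderiv_normed_convolution hχ] using hz
    · have := (tendsto_one_div_add_atTop_nhds_zero_nat (𝕜 := ℝ)).const_mul δ
      simpa [φ, div_eq_mul_inv] using this
    · refine Eventually.of_forall fun n => ?_
      simp only [φ]
      apply le_of_eq; field_simp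

/-- The weak inequality `F_x + G_y ≤ 0` in `O`, tested with Lipschitz functions. -/
def Dissipative (O : Set (ℝ × ℝ)) (F G : ℝ × ℝ → ℝ) : Prop :=
  ∀ χ : ℝ × ℝ → ℝ, (∃ C, LipschitzWith C χ) → HasCompactSupport χ → tsupport χ ⊆ O →
    (∀ z, 0 ≤ χ z) → 0 ≤ ∫ z in O, (F z * fderiv ℝ χ z (1, 0) + G z * fderiv ℝ χ z (0, 1))

theorem fderiv_eq_zero_of_notMem_tsupport {χ : ℝ × ℝ → ℝ} {z : ℝ × ℝ} (hz : z ∉ tsupport χ) :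
    fderiv ℝ χ z = 0 := by
  have := (tsupport_fderiv_subset ℝ (f := χ))
  by_contra h
  exact hz (this (subset_tsupport _ h))

/-- Mollifying a Lipschitz test function keeps it nonnegative, its gradient bounded, and its support
in one fixed compact subset of `O`. The gradients converge almost everywhere, so dominated
convergence transfers the inequality. -/
theorem dissipative_of_smooth {O : Set (ℝ × ℝ)} (hO : IsOpen O) {F G : ℝ × ℝ → ℝ}
    (hF : LocallyIntegrableOn F O) (hG : LocallyIntegrableOn G O)
    (hs : ∀ ψ : ℝ × ℝ → ℝ, ContDiff ℝ ∞ ψ → HasCompactSupport ψ → tsupport ψ ⊆ O →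
      (∀ z, 0 ≤ ψ z) → 0 ≤ ∫ z in O, (F z * fderiv ℝ ψ z (1, 0) + G z * fderiv ℝ ψ z (0, 1))) :
    Dissipative O F G := by
  rintro χ ⟨C, hχ⟩ hc hsupp h0
  obtain ⟨δ, hδ, hδO⟩ := hc.isCompact.exists_cthickening_subset_open hO hsupp
  obtain ⟨ψ, hsm, hsup, hnn, hbd, hlim⟩ := exists_smooth_approx hχ h0 hδ
  have hK : IsCompact (Metric.cthickening δ (tsupport χ)) := hc.isCompact.cthickening
  have hcs : ∀ n, HasCompactSupport (ψ n) := fun n =>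
    hK.of_isClosed_subset (isClosed_tsupport _) (hsup n)
  have hFK := hF.integrableOn_compact_subset hδO hK
  have hGK := hG.integrableOn_compact_subset hδO hK
  have hred : ∀ (θ : ℝ × ℝ → ℝ), tsupport θ ⊆ Metric.cthickening δ (tsupport χ) →
      ∫ z in O, (F z * fderiv ℝ θ z (1, 0) + G z * fderiv ℝ θ z (0, 1)) =
      ∫ z in Metric.cthickening δ (tsupport χ),
        (F z * fderiv ℝ θ z (1, 0) + G z * fderiv ℝ θ z (0, 1)) := by
    intro θ hθ
    apply (setIntegral_eq_of_subset_of_forall_sdiff_eq_zero hO.measurableSet hδO _)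
    intro z hz
    rw [fderiv_eq_zero_of_notMem_tsupport (fun h => hz.2 (hθ h))]
    simp
  rw [hred χ (Metric.self_subset_cthickening _)]
  have hm : ∀ (θ : ℝ × ℝ → ℝ) (v : ℝ × ℝ), AEStronglyMeasurable (fun z => fderiv ℝ θ z v)
      (volume.restrict (Metric.cthickening δ (tsupport χ))) := fun θ v =>
    (measurable_fderiv_apply_const ℝ θ v).aestronglyMeasurable
  have htend := tendsto_integral_of_dominated_convergence
    (μ := volume.restrict (Metric.cthickening δ (tsupport χ)))
    (F := fun n z => F z * fderiv ℝ (ψ n) z (1, 0) + G z * fderiv ℝ (ψ n) z (0, 1))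
    (f := fun z => F z * fderiv ℝ χ z (1, 0) + G z * fderiv ℝ χ z (0, 1))
    (fun z => ‖F z‖ * (C * ‖((1 : ℝ), (0 : ℝ))‖) + ‖G z‖ * (C * ‖((0 : ℝ), (1 : ℝ))‖)) ?_ ?_ ?_ ?_
  · refine ge_of_tendsto' htend fun n => ?_
    rw [← hred (ψ n) (hsup n)]
    exact hs (ψ n) (hsm n) (hcs n) ((hsup n).trans hδO) (hnn n)
  · exact fun n => (hFK.aestronglyMeasurable.mul (hm _ _)).add (hGK.aestronglyMeasurable.mul (hm _ _))
  · exact (hFK.norm.mul_const _).add (hGK.norm.mul_const _)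
  · refine fun n => Eventually.of_forall fun z => ?_
    refine (norm_add_le _ _).trans ?_
    rw [norm_mul, norm_mul]
    gcongr
    · exact hbd n z _
    · exact hbd n z _
  · filter_upwards [ae_restrict_of_ae (hlim (1, 0)), ae_restrict_of_ae (hlim (0, 1))] with z h1 h2
    exact (h1.const_mul _).add (h2.const_mul _)

theorem Dissipative.integrable {O : Set (ℝ × ℝ)} {F G : ℝ × ℝ → ℝ}
    (hF : LocallyIntegrableOn F O) (hG : LocallyIntegrableOn G O) {χ : ℝ × ℝ → ℝ} {C : NNReal}
    (hχ : LipschitzWith C χ) (hc : HasCompactSupport χ) (hsupp : tsupport χ ⊆ O) :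
    IntegrableOn (fun z => F z * fderiv ℝ χ z (1, 0) + G z * fderiv ℝ χ z (0, 1)) O := by
  have hFK := hF.integrableOn_compact_subset hsupp hc.isCompact
  have hGK := hG.integrableOn_compact_subset hsupp hc.isCompact
  have hbd : ∀ (z v : ℝ × ℝ), ‖fderiv ℝ χ z v‖ ≤ C * ‖v‖ := fun z v =>
    (ContinuousLinearMap.le_opNorm _ _).trans
      (mul_le_mul_of_nonneg_right (norm_fderiv_le_of_lipschitz ℝ hχ) (norm_nonneg _))
  have hm : ∀ v : ℝ × ℝ, AEStronglyMeasurable (fun z => fderiv ℝ χ z v)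
      (volume.restrict (tsupport χ)) := fun v =>
    (measurable_fderiv_apply_const ℝ χ v).aestronglyMeasurable
  have h1 : IntegrableOn (fun z => F z * fderiv ℝ χ z (1, 0) + G z * fderiv ℝ χ z (0, 1))
      (tsupport χ) :=
    (hFK.mul_bdd (hm _) (Eventually.of_forall fun z => hbd z _)).add
      (hGK.mul_bdd (hm _) (Eventually.of_forall fun z => hbd z _))
  refine IntegrableOn.mono_set ?_ (subset_univ O)
  rw [integrableOn_univ]
  refine (integrableOn_iff_integrable_of_support_subset ?_).1 h1
  intro z hz
  by_contra h
  apply hz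
  simp [fderiv_eq_zero_of_notMem_tsupport h]

/-- If both `(F, G)` and `(-F, -G)` are dissipative, the weak equation holds for signed Lipschitz
test functions. -/
theorem Dissipative.integral_eq_zero {O : Set (ℝ × ℝ)} {F G : ℝ × ℝ → ℝ}
    (hF : LocallyIntegrableOn F O) (hG : LocallyIntegrableOn G O)
    (h1 : Dissipative O F G) (h2 : Dissipative O (fun z => -F z) (fun z => -G z))
    {χ : ℝ × ℝ → ℝ} {C : NNReal} (hχ : LipschitzWith C χ) (hc : HasCompactSupport χ)
    (hsupp : tsupport χ ⊆ O) :
    ∫ z in O, (F z * fderiv ℝ χ z (1, 0) + G z * fderiv ℝ χ z (0, 1)) = 0 := by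
  have hpos : ∀ θ : ℝ × ℝ → ℝ, (∃ C, LipschitzWith C θ) → HasCompactSupport θ → tsupport θ ⊆ O →
    (∀ z, 0 ≤ θ z) →
      ∫ z in O, (F z * fderiv ℝ θ z (1, 0) + G z * fderiv ℝ θ z (0, 1)) = 0 := by
    intro θ hθ hcθ hsθ h0θ
    have ha := h1 θ hθ hcθ hsθ h0θ
    have hb := h2 θ hθ hcθ hsθ h0θ
    have : ∫ z in O, (-F z * fderiv ℝ θ z (1, 0) + -G z * fderiv ℝ θ z (0, 1)) =
        -∫ z in O, (F z * fderiv ℝ θ z (1, 0) + G z * fderiv ℝ θ z (0, 1)) := by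
      rw [← integral_neg]; congr 1; ext z; ring
    rw [this] at hb
    linarith
  -- The positive and negative parts of χ are again Lipschitz test functions; smooth functions would
  -- not be stable under this splitting.
  have key : ∀ f : ℝ → ℝ, LipschitzWith 1 f → f 0 = 0 →
      LipschitzWith (1 * C) (fun z => f (χ z)) ∧ HasCompactSupport (fun z => f (χ z)) ∧
      tsupport (fun z => f (χ z)) ⊆ O := by
    intro f hf hf0
    refine ⟨hf.comp hχ, hc.comp_left hf0, ?_⟩
    refine (closure_mono ?_).trans hsupp
    intro z hz h
    simp only [Function.mem_support] at hz
    exact hz (by rw [h, hf0])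
  obtain ⟨p1, p2, p3⟩ := key (fun x => max x 0) (LipschitzWith.id.max_const 0) (by simp)
  obtain ⟨n1, n2, n3⟩ := key (fun x => max (-x) 0)
    ((LipschitzWith.id.neg).max_const 0) (by simp)
  have hp := hpos _ ⟨_, p1⟩ p2 p3 (fun z => le_max_right _ _)
  have hn := hpos _ ⟨_, n1⟩ n2 n3 (fun z => le_max_right _ _)
  have hsplit : ∀ᵐ z ∂(volume.restrict O),
      F z * fderiv ℝ χ z (1, 0) + G z * fderiv ℝ χ z (0, 1) =
      (F z * fderiv ℝ (fun z => max (χ z) 0) z (1, 0) +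
        G z * fderiv ℝ (fun z => max (χ z) 0) z (0, 1)) -
      (F z * fderiv ℝ (fun z => max (-χ z) 0) z (1, 0) +
        G z * fderiv ℝ (fun z => max (-χ z) 0) z (0, 1)) := by
    filter_upwards [ae_restrict_of_ae p1.ae_differentiableAt,
      ae_restrict_of_ae n1.ae_differentiableAt] with z hz1 hz2
    have : χ = fun z => max (χ z) 0 - max (-χ z) 0 := by
      ext z
      rcases le_total (χ z) 0 with h | h
      · rw [max_eq_right h, max_eq_left (by linarith)]; ring
      · rw [max_eq_left h, max_eq_right (by linarith)]; ring
    have hfd : fderiv ℝ χ z = fderiv ℝ (fun z => max (χ z) 0) z -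
        fderiv ℝ (fun z => max (-χ z) 0) z := by
      conv_lhs => rw [this]
      exact fderiv_fun_sub hz1 hz2
    rw [hfd]
    simp only [sub_apply]
    ring
  rw [integral_congr_ae hsplit, integral_sub (Dissipative.integrable hF hG p1 p2 p3)
    (Dissipative.integrable hF hG n1 n2 n3), hp, hn, sub_zero]

/-- The derivative of a truncation. -/
theorem fderiv_clamp {f : ℝ × ℝ → ℝ} {z : ℝ × ℝ} (hf : ContinuousAt f z) :
    (fderiv ℝ (fun z => max 0 (min 1 (f z))) z = fderiv ℝ f z ∧ 0 < f z ∧ f z < 1) ∨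
      fderiv ℝ (fun z => max 0 (min 1 (f z))) z = 0 := by
  rcases le_or_gt (f z) 0 with h0 | h0
  · right
    apply IsLocalMin.fderiv_eq_zero
    refine Eventually.of_forall fun x => ?_
    simp only [max_eq_left ((min_le_right 1 (f z)).trans h0), le_max_left]
  rcases le_or_gt 1 (f z) with h1 | h1
  · right
    apply IsLocalMax.fderiv_eq_zero
    refine Eventually.of_forall fun x => ?_
    simp [min_eq_left h1]
  · left
    refine ⟨Filter.EventuallyEq.fderiv_eq ?_, h0, h1⟩
    filter_upwards [hf.eventually (lt_mem_nhds h0), hf.eventually (gt_mem_nhds h1)] with x hx0 hx1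
    rw [min_eq_right hx1.le, max_eq_right hx0.le]

theorem lipschitzWith_mul_of_bounded {f h : ℝ × ℝ → ℝ} {C D : NNReal} (hf : LipschitzWith C f)
    (hh : LipschitzWith D h) {A B : ℝ} (hA : ∀ z, |f z| ≤ A) (hB : ∀ z, |h z| ≤ B) :
    ∃ E, LipschitzWith E (fun z => f z * h z) := by
  have hA0 : 0 ≤ A := (abs_nonneg _).trans (hA 0)
  have hB0 : 0 ≤ B := (abs_nonneg _).trans (hB 0)
  refine ⟨⟨C * B + A * D, by positivity⟩, LipschitzWith.of_dist_le_mul fun x y => ?_⟩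
  have h1 := hf.dist_le_mul x y
  have h2 := hh.dist_le_mul x y
  rw [Real.dist_eq] at h1 h2 ⊢
  calc |f x * h x - f y * h y| = |(f x - f y) * h x + f y * (h x - h y)| := by ring_nf
    _ ≤ |f x - f y| * |h x| + |f y| * |h x - h y| := by
        refine (abs_add_le _ _).trans ?_
        rw [abs_mul, abs_mul]
    _ ≤ (C * dist x y) * B + A * (D * dist x y) := by
        gcongr
        · exact hB x
        · exact hA y
    _ = (C * B + A * D) * dist x y := by ring

/-! ### The energy estimate above the wall -/

/-- The epigraph of `g`: the flow domain extended to the half plane `x ≤ 0`. -/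
def above (g : ℝ → ℝ) : Set (ℝ × ℝ) := {z | g z.1 < z.2}

theorem isOpen_above {g : ℝ → ℝ} (hg : Continuous g) : IsOpen (above g) :=
  isOpen_lt (hg.comp continuous_fst) continuous_snd

/-- The layer of width `ε` along the wall. -/
def layer (g : ℝ → ℝ) (R ε : ℝ) : Set (ℝ × ℝ) :=
  {z | 0 < z.1 ∧ z.1 < R ∧ g z.1 < z.2 ∧ z.2 < g z.1 + ε}

theorem measurableSet_layer {g : ℝ → ℝ} (hg : Continuous g) (R ε : ℝ) :
    MeasurableSet (layer g R ε) := by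
  apply IsOpen.measurableSet
  exact (isOpen_lt continuous_const continuous_fst).inter
    ((isOpen_lt continuous_fst continuous_const).inter
    ((isOpen_lt (hg.comp continuous_fst) continuous_snd).inter
    (isOpen_lt continuous_snd ((hg.comp continuous_fst).add continuous_const))))

/-- Essentially bounded on bounded parts of `O`. -/
def LocallyEssBounded (O : Set (ℝ × ℝ)) (F : ℝ × ℝ → ℝ) : Prop :=
  ∀ R : ℝ, ∃ C, ∀ᵐ z ∂(volume.restrict (O ∩ Metric.ball 0 R)), |F z| ≤ C

theorem LocallyEssBounded.integrableOn {O : Set (ℝ × ℝ)} {F : ℝ × ℝ → ℝ}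
    (hF : LocallyEssBounded O F) (hm : AEStronglyMeasurable F (volume.restrict O))
    {S : Set (ℝ × ℝ)} (hS : S ⊆ O) (hb : Bornology.IsBounded S) : IntegrableOn F S := by
  obtain ⟨R, hR⟩ := hb.subset_ball 0
  obtain ⟨C, hC⟩ := hF R
  have hfin : volume S < ⊤ := hb.measure_lt_top
  have : IsFiniteMeasure (volume.restrict S) := ⟨by simpa using hfin⟩
  refine Integrable.of_bound (hm.mono_set hS) C ?_
  exact ae_restrict_of_ae_restrict_of_subset (subset_inter hS hR) hC

theorem LocallyEssBounded.locallyIntegrableOn {O : Set (ℝ × ℝ)} {F : ℝ × ℝ → ℝ} (hO : IsOpen O)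
    (hF : LocallyEssBounded O F) (hm : AEStronglyMeasurable F (volume.restrict O)) :
    LocallyIntegrableOn F O := by
  rw [locallyIntegrableOn_iff hO.isLocallyClosed]
  intro k hk hc
  exact hF.integrableOn hm hk hc.isBounded

theorem isBounded_region {g : ℝ → ℝ} {K : NNReal} (hg : LipschitzWith K g) {a X L M : ℝ} :
    Bornology.IsBounded {z : ℝ × ℝ | a ≤ z.1 ∧ z.1 ≤ X ∧ g z.1 ≤ z.2 ∧ z.2 + L * z.1 ≤ M} := by
  have hc : IsCompact (Icc a X) := isCompact_Icc
  obtain ⟨A, hA⟩ := hc.bddBelow_image hg.continuous.continuousOn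
  obtain ⟨B, hB⟩ := hc.bddAbove_image (f := fun x => M - L * x) (by fun_prop)
  apply (Metric.isBounded_Icc a X |>.prod (Metric.isBounded_Icc A B)).subset
  rintro ⟨x, y⟩ ⟨h1, h2, h3, h4⟩
  have h5 := hA ⟨x, ⟨h1, h2⟩, rfl⟩
  have h6 := hB ⟨x, ⟨h1, h2⟩, rfl⟩
  simp only at *
  exact ⟨⟨h1, h2⟩, by simp only; linarith, by simp only; linarith⟩

/-- The energy estimate: a nonnegative density `Φ` that vanishes for `x ≤ 0`, dissipates, has finite
propagation speed from above and no flux through the wall vanishes identically. -/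
theorem ae_eq_zero_of_dissipative {g w : ℝ → ℝ} {K : NNReal} (hg : LipschitzWith K g)
    (hw : ∀ᵐ x, HasDerivAt g (w x) x) (hwm : Measurable w) {Φ Ψ : ℝ × ℝ → ℝ}
    (hΦm : AEStronglyMeasurable Φ (volume.restrict (above g)))
    (hΨm : AEStronglyMeasurable Ψ (volume.restrict (above g)))
    (hΦb : LocallyEssBounded (above g) Φ) (hΨb : LocallyEssBounded (above g) Ψ)
    (hzero : ∀ z : ℝ × ℝ, z.1 ≤ 0 → Φ z = 0 ∧ Ψ z = 0)
    (hdis : Dissipative (above g) Φ Ψ)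
    (hpos : ∀ᵐ z ∂(volume.restrict (above g)), 0 ≤ Φ z)
    (hlat : ∀ X : ℝ, ∃ L ≥ 0, ∃ R₀, ∀ᵐ z ∂(volume.restrict (above g)),
      0 < z.1 → z.1 < X → R₀ < z.2 → 0 ≤ L * Φ z + Ψ z)
    (hwall : ∀ R : ℝ, Tendsto (fun ε : ℝ => ε⁻¹ * ∫ z in layer g R ε, |Ψ z - w z.1 * Φ z|)
      (𝓝[>] 0) (𝓝 0)) :
    ∀ᵐ z ∂(volume.restrict (above g)), Φ z = 0 := by
  have hO := isOpen_above hg.continuous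
  have hFint := hΦb.locallyIntegrableOn hO hΦm
  have hGint := hΨb.locallyIntegrableOn hO hΨm
  have hwae : ∀ᵐ z : ℝ × ℝ, HasDerivAt g (w z.1) z.1 :=
    Measure.quasiMeasurePreserving_fst.ae hw
  have hlayb : ∀ X ε, Bornology.IsBounded (layer g X ε) := by
    intro X ε
    obtain ⟨B, hB⟩ := (isCompact_Icc (a := (0 : ℝ)) (b := X)).bddAbove_image
      (f := fun x => g x + ε) (hg.continuous.add continuous_const).continuousOn
    refine (isBounded_region hg (a := 0) (X := X) (L := 0) (M := B)).subset ?_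
    rintro z ⟨h1, h2, h3, h4⟩
    have := hB ⟨z.1, ⟨h1.le, h2.le⟩, rfl⟩
    simp only at this
    exact ⟨h1.le, h2.le, h3.le, by simp only [zero_mul, add_zero]; linarith⟩
  have hlayO : ∀ X ε, layer g X ε ⊆ above g := fun X ε z hz => hz.2.2.1
  have hlayint : ∀ X ε, IntegrableOn (fun z => |Ψ z - w z.1 * Φ z|) (layer g X ε) := by
    intro X ε
    apply Integrable.abs
    apply (hΨb.integrableOn hΨm (hlayO X ε) (hlayb X ε)).sub
    apply (hΦb.integrableOn hΦm (hlayO X ε) (hlayb X ε)).bdd_mul (c := (K : ℝ))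
    · exact (hwm.comp measurable_fst).aestronglyMeasurable
    · filter_upwards [ae_restrict_of_ae hwae] with z hz
      exact hz.le_of_lipschitz hg
  -- the estimate on a fixed region
  have key : ∀ X > 0, ∃ L ≥ 0, ∃ M₀, ∀ M ≥ M₀, ∀ δ > 0, ∀ᵐ z ∂(volume.restrict (above g)),
      0 < z.1 → z.1 < X → z.2 + L * z.1 < M → g z.1 + δ < z.2 → Φ z = 0 := by
    intro X hX
    obtain ⟨L, hL, R₀, hlatX⟩ := hlat X
    -- Where the lateral cut-off decays, y + Lx > M, hence y > R₀ because x < X, and `hlat` applies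
    -- there.
    refine ⟨L, hL, R₀ + L * X, fun M hM δ hδ => ?_⟩
    let D : Set (ℝ × ℝ) := {z | 0 < z.1 ∧ z.1 < X ∧ z.2 + L * z.1 < M ∧ g z.1 + δ < z.2}
    have hDO : D ⊆ above g := fun z hz => by
      have := hz.2.2.2
      show g z.1 < z.2
      linarith
    have hDopen : IsOpen D := by
      refine (isOpen_lt continuous_const continuous_fst).inter
        ((isOpen_lt continuous_fst continuous_const).inter
          ((isOpen_lt (f := fun z : ℝ × ℝ => z.2 + L * z.1) (by fun_prop)
          continuous_const).inter (isOpen_lt ((hg.continuous.comp continuous_fst).add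
            continuous_const) continuous_snd)))
    have hDb : Bornology.IsBounded D := by
      refine (isBounded_region hg (a := 0) (X := X) (L := L) (M := M)).subset ?_
      rintro z ⟨h1, h2, h3, h4⟩
      exact ⟨h1.le, h2.le, by linarith, h3.le⟩
    have hDint : IntegrableOn Φ D := hΦb.integrableOn hΦm hDO hDb
    have hest : ∀ ε > 0, 2 * ε ≤ δ →
        ∫ z in D, Φ z ≤ 2 * X * ((2 * ε)⁻¹ * ∫ z in layer g X (2 * ε), |Ψ z - w z.1 * Φ z|) := by
      intro ε hε hεδ
      -- The test function is a·b·k. For 0 < x < X the factor `a` is X - x, whose derivative -1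
      -- produces -∫Φ; the branch X(x + 1) is active only for x ≤ 0, where Φ and Ψ vanish, and
      -- serves to make the support compact. The factor `b` cuts off along lines of slope -L, and
      -- `k` rises from 0 to 1 between the heights ε and 2ε above the wall.
      let a : ℝ × ℝ → ℝ := fun z => max 0 (min (X - z.1) (X * (z.1 + 1)))
      let fb : ℝ × ℝ → ℝ := fun z => M + 1 - z.2 - L * z.1
      let fk : ℝ × ℝ → ℝ := fun z => (z.2 - g z.1 - ε) / ε
      let b : ℝ × ℝ → ℝ := fun z => max 0 (min 1 (fb z))
      let k : ℝ × ℝ → ℝ := fun z => max 0 (min 1 (fk z))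
      have hl1 : LipschitzWith 1 (fun z : ℝ × ℝ => z.1) := LipschitzWith.prod_fst
      have hl2 : LipschitzWith 1 (fun z : ℝ × ℝ => z.2) := LipschitzWith.prod_snd
      have ha_lip : ∃ C, LipschitzWith C a := by
        have h1 : LipschitzWith (0 + 1) (fun z : ℝ × ℝ => X - z.1) :=
          (LipschitzWith.const X).sub hl1
        have h2 : LipschitzWith (‖X‖₊ * (1 + 0)) (fun z : ℝ × ℝ => X * (z.1 + 1)) :=
          (lipschitzWith_smul X).comp (hl1.add (LipschitzWith.const 1))
        exact ⟨_, (h1.min h2).const_max 0⟩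
      have hb_lip : ∃ C, LipschitzWith C b := by
        have h1 : LipschitzWith (‖L‖₊ * 1) (fun z : ℝ × ℝ => L * z.1) :=
          (lipschitzWith_smul L).comp hl1
        exact ⟨_, ((((LipschitzWith.const (M + 1)).sub hl2).sub h1).const_min 1).const_max 0⟩
      have hk_lip : ∃ C, LipschitzWith C k := by
        have h1 : LipschitzWith (‖ε⁻¹‖₊ * (1 + K * 1 + 0)) fk := by
          have := (lipschitzWith_smul ε⁻¹).comp
            ((hl2.sub (hg.comp hl1)).sub (LipschitzWith.const ε))
          have h2 : fk = (fun x => ε⁻¹ • x) ∘ fun x : ℝ × ℝ => x.2 - (g ∘ fun z : ℝ × ℝ => z.1) x - ε := by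
            ext z; simp [fk, div_eq_inv_mul]
          rw [h2]; exact this
        exact ⟨_, (h1.const_min 1).const_max 0⟩
      have hb01 : ∀ z, 0 ≤ b z ∧ b z ≤ 1 := fun z =>
        ⟨le_max_left _ _, max_le zero_le_one (min_le_left _ _)⟩
      have hk01 : ∀ z, 0 ≤ k z ∧ k z ≤ 1 := fun z =>
        ⟨le_max_left _ _, max_le zero_le_one (min_le_left _ _)⟩
      have ha0 : ∀ z, 0 ≤ a z := fun z => le_max_left _ _
      have haX : ∀ z, a z ≤ X := by
        intro z
        refine max_le hX.le ?_
        rcases le_total 0 z.1 with h | h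
        · exact (min_le_left _ _).trans (by linarith)
        · exact (min_le_right _ _).trans (by nlinarith)
      have hbk_abs : ∀ z, |b z * k z| ≤ 1 := by
        intro z
        rw [abs_of_nonneg (mul_nonneg (hb01 z).1 (hk01 z).1)]
        exact mul_le_one₀ (hb01 z).2 (hk01 z).1 (hk01 z).2
      obtain ⟨Ca, ha_lip⟩ := ha_lip
      obtain ⟨Cb, hb_lip⟩ := hb_lip
      obtain ⟨Ck, hk_lip⟩ := hk_lip
      obtain ⟨Cbk, hbk_lip⟩ := lipschitzWith_mul_of_bounded hb_lip hk_lip (A := 1) (B := 1)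
        (fun z => abs_le.2 ⟨by linarith [(hb01 z).1], (hb01 z).2⟩)
        (fun z => abs_le.2 ⟨by linarith [(hk01 z).1], (hk01 z).2⟩)
      obtain ⟨Cχ, hχ_lip⟩ := lipschitzWith_mul_of_bounded ha_lip hbk_lip (A := X) (B := 1)
        (fun z => abs_le.2 ⟨by linarith [ha0 z], haX z⟩) hbk_abs
      let S : Set (ℝ × ℝ) :=
        {z | -1 ≤ z.1 ∧ z.1 ≤ X ∧ g z.1 + ε ≤ z.2 ∧ z.2 + L * z.1 ≤ M + 1}
      have hSclosed : IsClosed S := by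
        refine (isClosed_le continuous_const continuous_fst).inter
          ((isClosed_le continuous_fst continuous_const).inter ((isClosed_le
            ((hg.continuous.comp continuous_fst).add continuous_const) continuous_snd).inter
              (isClosed_le (f := fun z : ℝ × ℝ => z.2 + L * z.1) (by fun_prop)
                continuous_const)))
      have hSb : Bornology.IsBounded S := by
        refine (isBounded_region hg (a := -1) (X := X) (L := L) (M := M + 1)).subset ?_
        rintro z ⟨h1, h2, h3, h4⟩
        exact ⟨h1, h2, by linarith, h4⟩
      have hsupp : tsupport (fun z => a z * (b z * k z)) ⊆ S := by
        apply closure_minimal _ hSclosed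
        intro z hz
        simp only [Function.mem_support, mul_ne_zero_iff] at hz
        obtain ⟨h1, h2, h3⟩ := hz
        have h1' : 0 < min (X - z.1) (X * (z.1 + 1)) := by
          by_contra h; exact h1 (max_eq_left (not_lt.1 h))
        have h2' : 0 < min 1 (fb z) := by
          by_contra h; exact h2 (max_eq_left (not_lt.1 h))
        have h3' : 0 < min 1 (fk z) := by
          by_contra h; exact h3 (max_eq_left (not_lt.1 h))
        rw [lt_min_iff] at h1' h2' h3'
        have h4 := pos_of_mul_pos_right h1'.2 hX.le
        have h5 := h2'.2
        have h6 := (div_pos_iff_of_pos_right hε).1 h3'.2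
        simp only [fb] at h5
        exact ⟨by linarith, by linarith, by linarith, by linarith⟩
      have hSO : S ⊆ above g := fun z hz => by
        have := hz.2.2.1
        show g z.1 < z.2
        linarith
      have hcs : HasCompactSupport (fun z => a z * (b z * k z)) :=
        (Metric.isCompact_of_isClosed_isBounded hSclosed hSb).of_isClosed_subset
          (isClosed_tsupport _) hsupp
      have h0 := hdis _ ⟨_, hχ_lip⟩ hcs (hsupp.trans hSO)
        (fun z => mul_nonneg (ha0 z) (mul_nonneg (hb01 z).1 (hk01 z).1))
      have hint := Dissipative.integrable hFint hGint hχ_lip hcs (hsupp.trans hSO)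
      have hDind : IntegrableOn (D.indicator Φ) (above g) := by
        rw [IntegrableOn, integrable_indicator_iff hDopen.measurableSet]
        exact hDint.mono_measure Measure.restrict_le_self
      have hLind : IntegrableOn ((layer g X (2 * ε)).indicator
          (fun z => X * ε⁻¹ * |Ψ z - w z.1 * Φ z|)) (above g) := by
        rw [IntegrableOn, integrable_indicator_iff (measurableSet_layer hg.continuous _ _)]
        exact IntegrableOn.mono_measure ((hlayint X (2 * ε)).const_mul _) Measure.restrict_le_self
      have hle : ∀ᵐ z ∂(volume.restrict (above g)),
          Φ z * fderiv ℝ (fun z => a z * (b z * k z)) z (1, 0) +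
            Ψ z * fderiv ℝ (fun z => a z * (b z * k z)) z (0, 1) ≤
          -D.indicator Φ z + (layer g X (2 * ε)).indicator
            (fun z => X * ε⁻¹ * |Ψ z - w z.1 * Φ z|) z := by
        filter_upwards [hpos, hlatX, ae_restrict_of_ae hwae, ae_restrict_of_ae
          ha_lip.ae_differentiableAt, ae_restrict_of_ae hb_lip.ae_differentiableAt,
          ae_restrict_of_ae hk_lip.ae_differentiableAt, ae_restrict_mem hO.measurableSet]
          with z hz1 hz2 hz3 hda hdb hdk hzO
        have hlay0 : 0 ≤ (layer g X (2 * ε)).indicator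
            (fun z => X * ε⁻¹ * |Ψ z - w z.1 * Φ z|) z :=
          indicator_nonneg (fun z _ => by positivity) z
        rcases le_or_gt z.1 0 with hx0 | hx0
        · obtain ⟨e1, e2⟩ := hzero z hx0
          have : z ∉ D := fun h => absurd h.1 (not_lt.2 hx0)
          rw [e1, e2, indicator_of_notMem this]
          linarith
        have hfd : fderiv ℝ (fun z => a z * (b z * k z)) z =
            a z • (b z • fderiv ℝ k z + k z • fderiv ℝ b z) + (b z * k z) • fderiv ℝ a z := by
          rw [fderiv_fun_mul hda (hdb.fun_mul hdk), fderiv_fun_mul hdb hdk]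
        rcases le_or_gt X z.1 with hxX | hxX
        · have haz : a z = 0 := max_eq_left ((min_le_left _ _).trans (by linarith))
          have hfa : fderiv ℝ a z = 0 := by
            apply IsLocalMin.fderiv_eq_zero
            exact Eventually.of_forall fun x => by rw [haz]; exact ha0 x
          have : z ∉ D := fun h => absurd h.2.1 (not_lt.2 hxX)
          rw [hfd, haz, hfa, indicator_of_notMem this]
          simpa using hlay0
        have hev : a =ᶠ[𝓝 z] fun z => X - z.1 := by
          have h1 : ∀ᶠ x : ℝ × ℝ in 𝓝 z, 0 < x.1 :=
            continuous_fst.continuousAt.eventually (lt_mem_nhds hx0)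
          have h2 : ∀ᶠ x : ℝ × ℝ in 𝓝 z, x.1 < X :=
            continuous_fst.continuousAt.eventually (gt_mem_nhds hxX)
          filter_upwards [h1, h2] with x h1 h2
          simp only [a]
          rw [min_eq_left (by nlinarith), max_eq_right (by linarith)]
        have hfa : fderiv ℝ a z = -ContinuousLinearMap.fst ℝ ℝ ℝ := by
          rw [hev.fderiv_eq]
          exact (hasFDerivAt_fst.const_sub X).fderiv
        have haz : a z = X - z.1 := hev.self_of_nhds
        have hb' : (fderiv ℝ b z = fderiv ℝ fb z ∧ 0 < fb z ∧ fb z < 1) ∨ fderiv ℝ b z = 0 :=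
          fderiv_clamp (by fun_prop)
        have hk' : (fderiv ℝ k z = fderiv ℝ fk z ∧ 0 < fk z ∧ fk z < 1) ∨ fderiv ℝ k z = 0 := by
          apply fderiv_clamp
          have := hg.continuous
          fun_prop
        -- In the strip where b decays its gradient is (-L, -1), so the contribution is -(LΦ + Ψ) ≤
        -- 0.
        have hbt : Φ z * fderiv ℝ b z (1, 0) + Ψ z * fderiv ℝ b z (0, 1) ≤ 0 := by
          rcases hb' with ⟨e, p1, p2⟩ | e
          · have hfb : fderiv ℝ fb z =
                -ContinuousLinearMap.snd ℝ ℝ ℝ - L • ContinuousLinearMap.fst ℝ ℝ ℝ :=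
              ((hasFDerivAt_snd.const_sub (M + 1)).sub (hasFDerivAt_fst.const_mul L)).fderiv
            rw [e, hfb]
            simp only [fb] at p1 p2
            have := hz2 hx0 hxX (by nlinarith)
            simp
            linarith
          · rw [e]; simp
        -- Inside the layer of width 2ε the gradient of k is (-w, 1)/ε or 0; only the flux Ψ - wΦ
        -- through the wall enters.
        have hkt : a z * b z * (Φ z * fderiv ℝ k z (1, 0) + Ψ z * fderiv ℝ k z (0, 1)) ≤
            (layer g X (2 * ε)).indicator (fun z => X * ε⁻¹ * |Ψ z - w z.1 * Φ z|) z := by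
          rcases hk' with ⟨e, p1, p2⟩ | e
          · have hfg : HasFDerivAt (fun z : ℝ × ℝ => g z.1)
                (w z.1 • ContinuousLinearMap.fst ℝ ℝ ℝ) z :=
              HasDerivAt.comp_hasFDerivAt z hz3 hasFDerivAt_fst
            have hfk : fderiv ℝ fk z = ε⁻¹ •
                (ContinuousLinearMap.snd ℝ ℝ ℝ - w z.1 • ContinuousLinearMap.fst ℝ ℝ ℝ) := by
              have := ((hasFDerivAt_snd (𝕜 := ℝ) (p := z)).sub hfg).sub_const ε |>.const_smul ε⁻¹
              have h2 : fk = fun x : ℝ × ℝ => ε⁻¹ • (x.2 - g x.1 - ε) := by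
                ext x; simp [fk, div_eq_inv_mul]
              rw [h2]; exact this.fderiv
            have hmem : z ∈ layer g X (2 * ε) := by
              simp only [fk] at p1 p2
              rw [div_lt_one hε] at p2
              exact ⟨hx0, hxX, hzO, by linarith⟩
            rw [indicator_of_mem hmem, e, hfk]
            simp only [smul_apply, sub_apply, ContinuousLinearMap.coe_fst',
              ContinuousLinearMap.coe_snd', smul_eq_mul]
            have hab : a z * b z ≤ X * 1 :=
              mul_le_mul (haX z) (hb01 z).2 (hb01 z).1 hX.le
            have hab0 : 0 ≤ a z * b z := mul_nonneg (ha0 z) (hb01 z).1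
            calc _ = (a z * b z) * (ε⁻¹ * (Ψ z - w z.1 * Φ z)) := by ring
              _ ≤ (a z * b z) * (ε⁻¹ * |Ψ z - w z.1 * Φ z|) := by
                  gcongr; exact le_abs_self _
              _ ≤ (X * 1) * (ε⁻¹ * |Ψ z - w z.1 * Φ z|) := by gcongr
              _ = _ := by ring
          · rw [e]; simpa using hlay0
        have hDt : D.indicator Φ z ≤ b z * k z * Φ z := by
          by_cases hzD : z ∈ D
          · rw [indicator_of_mem hzD]
            obtain ⟨_, _, q3, q4⟩ := hzD
            have e1 : b z = 1 := by
              simp only [b, fb]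
              rw [min_eq_left (by linarith), max_eq_right zero_le_one]
            have e2 : k z = 1 := by
              simp only [k, fk]
              rw [min_eq_left, max_eq_right zero_le_one]
              rw [le_div_iff₀ hε]; linarith
            rw [e1, e2]; linarith
          · rw [indicator_of_notMem hzD]
            exact mul_nonneg (mul_nonneg (hb01 z).1 (hk01 z).1) hz1
        rw [hfd, hfa]
        simp only [add_apply, smul_apply, neg_apply, ContinuousLinearMap.coe_fst', smul_eq_mul]
        have h5 : a z * k z * (Φ z * fderiv ℝ b z (1, 0) + Ψ z * fderiv ℝ b z (0, 1)) ≤ 0 :=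
          mul_nonpos_of_nonneg_of_nonpos (mul_nonneg (ha0 z) (hk01 z).1) hbt
        linarith
      have h6 := integral_mono_ae hint (hDind.neg.add hLind) hle
      have h7 : ∫ z in above g, (-D.indicator Φ z + (layer g X (2 * ε)).indicator
            (fun z => X * ε⁻¹ * |Ψ z - w z.1 * Φ z|) z) =
          -(∫ z in D, Φ z) + X * ε⁻¹ * ∫ z in layer g X (2 * ε), |Ψ z - w z.1 * Φ z| := by
        have hneg : IntegrableOn (fun z => -D.indicator Φ z) (above g) := hDind.neg
        rw [integral_add hneg hLind, integral_neg,
          setIntegral_indicator hDopen.measurableSet,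
          setIntegral_indicator (measurableSet_layer hg.continuous _ _),
          inter_eq_self_of_subset_right hDO, inter_eq_self_of_subset_right (hlayO _ _),
          integral_const_mul]
      have h8 : 2 * X * ((2 * ε)⁻¹ * ∫ z in layer g X (2 * ε), |Ψ z - w z.1 * Φ z|) =
          X * ε⁻¹ * ∫ z in layer g X (2 * ε), |Ψ z - w z.1 * Φ z| := by
        rw [mul_inv]; ring
      rw [h8]
      have h9 := h0.trans (h6.trans_eq h7)
      linarith
    have hle0 : ∫ z in D, Φ z ≤ 0 := by
      have htend : Tendsto (fun ε : ℝ => 2 * X * ((2 * ε)⁻¹ *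
          ∫ z in layer g X (2 * ε), |Ψ z - w z.1 * Φ z|)) (𝓝[>] 0) (𝓝 (2 * X * 0)) := by
        apply Tendsto.const_mul
        refine (hwall X).comp (f := fun ε : ℝ => 2 * ε) ?_
        apply tendsto_nhdsWithin_of_tendsto_nhds_of_eventually_within
        · have : Tendsto (fun ε : ℝ => 2 * ε) (𝓝 0) (𝓝 (2 * 0)) := tendsto_id.const_mul 2
          rw [mul_zero] at this
          exact this.mono_left nhdsWithin_le_nhds
        · filter_upwards [self_mem_nhdsWithin] with ε hε
          exact mul_pos (two_pos : (0 : ℝ) < 2) (show (0 : ℝ) < ε from hε)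
      rw [mul_zero] at htend
      refine ge_of_tendsto htend ?_
      have : Ioo (0 : ℝ) (δ / 2) ∈ 𝓝[>] (0 : ℝ) := Ioo_mem_nhdsGT (by positivity)
      filter_upwards [this] with ε hε
      exact hest ε hε.1 (by linarith [hε.2])
    have hposD : 0 ≤ᵐ[volume.restrict D] Φ := ae_restrict_of_ae_restrict_of_subset hDO hpos
    have heq := (setIntegral_eq_zero_iff_of_nonneg_ae hposD hDint).1
      (le_antisymm hle0 (setIntegral_nonneg_of_ae_restrict hposD))
    rw [Filter.EventuallyEq, ae_restrict_iff' hDopen.measurableSet] at heq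
    filter_upwards [ae_restrict_of_ae heq] with z hz h1 h2 h3 h4
    exact hz ⟨h1, h2, h3, h4⟩
  have hall : ∀ N : ℕ, ∃ L ≥ 0, ∃ M₀ : ℝ, ∀ m : ℕ, ∀ᵐ z : ℝ × ℝ ∂(volume.restrict (above g)),
      0 < z.1 → z.1 < N + 1 → z.2 + L * z.1 < M₀ + m → g z.1 + 1 / (m + 1) < z.2 → Φ z = 0 := by
    intro N
    obtain ⟨L, hL, M₀, h⟩ := key ((N : ℝ) + 1) (by positivity)
    exact ⟨L, hL, M₀, fun m => h (M₀ + m) (by simp) (1 / ((m : ℝ) + 1)) (by positivity)⟩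
  choose L hL M₀ hLM using hall
  have hall2 : ∀ᵐ z : ℝ × ℝ ∂(volume.restrict (above g)), ∀ N m : ℕ,
      0 < z.1 → z.1 < N + 1 → z.2 + L N * z.1 < M₀ N + m → g z.1 + 1 / (m + 1) < z.2 → Φ z = 0 :=
    ae_all_iff.2 fun N => ae_all_iff.2 fun m => hLM N m
  filter_upwards [hall2, ae_restrict_mem hO.measurableSet] with z hz hzO
  rcases le_or_gt z.1 0 with h | h
  · exact (hzero z h).1
  obtain ⟨N, hN⟩ := exists_nat_gt z.1
  obtain ⟨m₁, hm₁⟩ := exists_nat_gt (z.2 + L N * z.1 - M₀ N)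
  obtain ⟨m₂, hm₂⟩ := exists_nat_one_div_lt (K := ℝ) (show (0 : ℝ) < z.2 - g z.1 from sub_pos.2 hzO)
  refine hz N (max m₁ m₂) h (by linarith) ?_ ?_
  · have : (m₁ : ℝ) ≤ (max m₁ m₂ : ℕ) := by exact_mod_cast le_max_left _ _
    linarith
  · have h1 : (m₂ : ℝ) ≤ (max m₁ m₂ : ℕ) := by exact_mod_cast le_max_right _ _
    have h2 : 1 / (((max m₁ m₂ : ℕ) : ℝ) + 1) ≤ 1 / ((m₂ : ℝ) + 1) := by
      apply one_div_le_one_div_of_le (by positivity); linarith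
    linarith

/-! ### Straight characteristics issuing from a concave wall -/

/-- A concave wall `y = g x` with slope `w`, flat for `x ≤ 0`, from each point `t` of which a
characteristic of slope `Λ t > w t` issues. -/
structure FanData (g w Λ : ℝ → ℝ) (lam0 : ℝ) (K : NNReal) : Prop where
  lip : LipschitzWith K g
  concave : ∀ a b, a < b → w b * (b - a) ≤ g b - g a ∧ g b - g a ≤ w a * (b - a)
  flat : ∀ t ≤ 0, g t = 0
  anti : Antitone Λ
  slope_lt : ∀ t, w t < Λ t
  speed_flat : ∀ t ≤ 0, Λ t = lam0
  speed_lt : ∀ t > 0, Λ t < lam0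
  pos : 0 < lam0

/-- `z` lies on a characteristic of slope `l` that issues from the wall at `t`; at a corner all
slopes between the one-sided limits of `Λ` occur. -/
def OnRay (g Λ : ℝ → ℝ) (t l : ℝ) (z : ℝ × ℝ) : Prop :=
  t < z.1 ∧ z.2 = g t + l * (z.1 - t) ∧ (∀ s < t, l ≤ Λ s) ∧ ∀ s > t, Λ s ≤ l

open Classical in
/-- The slope of the characteristic through `z`. -/
def fanSpeed (g Λ : ℝ → ℝ) (z : ℝ × ℝ) : ℝ :=
  if h : ∃ p : ℝ × ℝ, OnRay g Λ p.1 p.2 z then h.choose.2 else 0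

namespace FanData

variable {g w Λ : ℝ → ℝ} {lam0 : ℝ} {K : NNReal}

/-- Concavity bounds the chords from points r > t; letting r tend to t uses only continuity. Nothing
is required of the slope at `t` itself, where the wall may have a corner. -/
theorem chord_le (F : FanData g w Λ lam0 K) {t x σ : ℝ} (h : ∀ s > t, w s ≤ σ) (htx : t < x) :
    g x - g t ≤ σ * (x - t) := by
  have hg := F.lip.continuous
  have h1 : Tendsto (fun r => g x - g r) (𝓝[>] t) (𝓝 (g x - g t)) :=
    (continuous_const.sub hg).continuousAt.tendsto.mono_left nhdsWithin_le_nhds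
  have h2 : Tendsto (fun r => σ * (x - r)) (𝓝[>] t) (𝓝 (σ * (x - t))) :=
    (continuous_const.mul (continuous_const.sub continuous_id)).continuousAt.tendsto.mono_left
      nhdsWithin_le_nhds
  refine le_of_tendsto_of_tendsto h1 h2 ?_
  filter_upwards [Ioo_mem_nhdsGT htx] with r hr
  exact ((F.concave r x hr.2).2).trans
    (mul_le_mul_of_nonneg_right (h r hr.1) (by linarith [hr.2]))

/-- Beyond t the wall is less steep than its characteristics, and these are at most as steep as l.
The chord is split at the midpoint because `chord_le` is a weak inequality; strictness comes from
the second half. -/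
theorem below_ray (F : FanData g w Λ lam0 K) {t l : ℝ} {z : ℝ × ℝ} (h : OnRay g Λ t l z) {s : ℝ}
    (hs : t < s) : g s < g t + l * (s - t) := by
  have h1 := F.chord_le (t := t) (x := (t + s) / 2) (σ := l)
    (fun r hr => (F.slope_lt r).le.trans (h.2.2.2 r hr)) (by linarith)
  have h2 := (F.concave ((t + s) / 2) s (by linarith)).2
  have h3 : w ((t + s) / 2) < l := (F.slope_lt _).trans_le (h.2.2.2 _ (by linarith))
  nlinarith

theorem ray_mem (F : FanData g w Λ lam0 K) {t l : ℝ} {z : ℝ × ℝ} (h : OnRay g Λ t l z) :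
    z ∈ above g := by
  have := F.below_ray h h.1
  rw [← h.2.1] at this
  exact this

theorem le_speed (F : FanData g w Λ lam0 K) (t : ℝ) : Λ t ≤ lam0 := by
  rcases le_or_gt t 0 with h | h
  · exact (F.speed_flat t h).le
  · exact (F.speed_lt t h).le

theorem ray_le (F : FanData g w Λ lam0 K) {t l : ℝ} {z : ℝ × ℝ} (h : OnRay g Λ t l z) :
    l ≤ lam0 :=
  (h.2.2.1 (t - 1) (by linarith)).trans (F.le_speed _)

theorem ray_ge {t l : ℝ} {z : ℝ × ℝ} (h : OnRay g Λ t l z) : Λ z.1 ≤ l := h.2.2.2 _ h.1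

/-- The foot is the infimum of the points t whose characteristic passes below z at the abscissa of
z. Points just upstream of z qualify, since z is above the wall; points far upstream do not, since
`lam0` is positive. At the infimum the slope of the segment from the wall to z lies between the
one-sided limits of Λ, which is all that `OnRay` asks for. -/
theorem exists_onRay (F : FanData g w Λ lam0 K) {z : ℝ × ℝ} (hz : z ∈ above g) :
    ∃ t l, OnRay g Λ t l z := by
  obtain ⟨x, y⟩ := z
  have hz : g x < y := hz
  have hg := F.lip.continuous
  let S : Set ℝ := {t | t < x ∧ g t + Λ t * (x - t) < y}
  have hne : S.Nonempty := by
    have h1 : Tendsto (fun t => g t + lam0 * (x - t)) (𝓝[<] x) (𝓝 (g x + lam0 * (x - x))) :=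
      (hg.add (continuous_const.mul (continuous_const.sub continuous_id))).continuousAt.tendsto.mono_left
        nhdsWithin_le_nhds
    rw [sub_self, mul_zero, add_zero] at h1
    obtain ⟨t, ht1, ht2⟩ := ((h1.eventually (gt_mem_nhds hz)).and self_mem_nhdsWithin).exists
    refine ⟨t, ht2, lt_of_le_of_lt ?_ ht1⟩
    have := mul_le_mul_of_nonneg_right (F.le_speed t) (sub_nonneg.2 (le_of_lt ht2))
    linarith
  have hbd : BddBelow S := by
    refine ⟨min 0 (x - y / lam0), fun t ht => ?_⟩
    rcases le_or_gt t 0 with h | h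
    · have h2 := ht.2
      rw [F.flat t h, F.speed_flat t h, zero_add] at h2
      refine (min_le_right _ _).trans ?_
      have : x - t < y / lam0 := by rw [lt_div_iff₀ F.pos]; linarith
      linarith
    · exact (min_le_left _ _).trans h.le
  have hS0 : ∀ t ∈ S, sInf S ≤ t := fun t ht => csInf_le hbd ht
  obtain ⟨t₀, ht₀⟩ : ∃ t₀, t₀ = sInf S := ⟨_, rfl⟩
  have htx : t₀ < x := by
    obtain ⟨t, ht⟩ := hne
    rw [ht₀]; exact (hS0 t ht).trans_lt ht.1
  have hm : ContinuousAt (fun t => (y - g t) / (x - t)) t₀ :=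
    (continuous_const.sub hg).continuousAt.div (continuous_const.sub continuous_id).continuousAt
      (by linarith)
  refine ⟨t₀, (y - g t₀) / (x - t₀), htx, ?_, ?_, ?_⟩
  · have : x - t₀ ≠ 0 := by linarith
    simp only; field_simp; ring
  · intro s hs
    have : ∀ᶠ r in 𝓝[<] t₀, (y - g r) / (x - r) ≤ Λ s := by
      filter_upwards [Ioo_mem_nhdsLT hs] with r hr
      have hr' : r ∉ S := fun h => absurd (hS0 r h) (by rw [← ht₀]; exact not_le.2 hr.2)
      have hrx : r < x := hr.2.trans htx
      have h3 : y ≤ g r + Λ r * (x - r) := by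
        by_contra h
        exact hr' ⟨hrx, not_le.1 h⟩
      rw [div_le_iff₀ (by linarith)]
      have := mul_le_mul_of_nonneg_right (F.anti hr.1.le) (sub_nonneg.2 hrx.le)
      linarith
    exact le_of_tendsto (hm.tendsto.mono_left nhdsWithin_le_nhds) this
  · intro s hs
    by_contra hcon
    push Not at hcon
    have h1 := hm.eventually (gt_mem_nhds hcon)
    rw [Metric.eventually_nhds_iff] at h1
    obtain ⟨ε, hε, h1⟩ := h1
    obtain ⟨r, hrS, hr⟩ := exists_lt_of_csInf_lt hne
      (show sInf S < min s (t₀ + ε) by rw [← ht₀]; exact lt_min hs (by linarith))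
    have hr0 := hS0 r hrS
    rw [← ht₀] at hr0
    have h2 := h1 (y := r) (by
      rw [Real.dist_eq, abs_of_nonneg (by linarith)]
      linarith [hr.trans_le (min_le_right _ _)])
    have hrx := hrS.1
    rw [div_lt_iff₀ (by linarith)] at h2
    have h3 := mul_le_mul_of_nonneg_right (F.anti (hr.trans_le (min_le_left _ _)).le)
      (sub_nonneg.2 hrx.le)
    linarith [hrS.2]

/-- By monotonicity of Λ the steeper ray starts no further downstream, so the foot of the flatter
one lies on or below the line of the steeper one. This quantitative form of non-crossing yields
uniqueness of the slope, its Lipschitz continuity and its monotonicity in y. -/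
theorem ray_compare (F : FanData g w Λ lam0 K) {t₁ l₁ t₂ l₂ : ℝ} {z₁ z₂ : ℝ × ℝ}
    (h₁ : OnRay g Λ t₁ l₁ z₁) (h₂ : OnRay g Λ t₂ l₂ z₂) (hl : l₁ < l₂) :
    (l₂ - l₁) * (z₁.1 - t₁) ≤ z₂.2 - z₁.2 + l₂ * (z₁.1 - z₂.1) := by
  have ht : t₂ ≤ t₁ := by
    by_contra h
    push Not at h
    have := h₁.2.2.2 ((t₁ + t₂) / 2) (by linarith)
    have := h₂.2.2.1 ((t₁ + t₂) / 2) (by linarith)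
    linarith
  have hg : g t₁ ≤ g t₂ + l₂ * (t₁ - t₂) := by
    rcases ht.eq_or_lt with rfl | h
    · simp
    · exact (F.below_ray h₂ h).le
  rw [h₁.2.1, h₂.2.1]
  nlinarith

theorem ray_unique (F : FanData g w Λ lam0 K) {t₁ l₁ t₂ l₂ : ℝ} {z : ℝ × ℝ}
    (h₁ : OnRay g Λ t₁ l₁ z) (h₂ : OnRay g Λ t₂ l₂ z) : l₁ = l₂ := by
  by_contra hne
  rcases lt_or_gt_of_ne hne with h | h
  · have := F.ray_compare h₁ h₂ h
    have := mul_pos (sub_pos.2 h) (sub_pos.2 h₁.1)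
    linarith
  · have := F.ray_compare h₂ h₁ h
    have := mul_pos (sub_pos.2 h) (sub_pos.2 h₂.1)
    linarith

theorem fanSpeed_eq (F : FanData g w Λ lam0 K) {t l : ℝ} {z : ℝ × ℝ} (h : OnRay g Λ t l z) :
    fanSpeed g Λ z = l := by
  have hex : ∃ p : ℝ × ℝ, OnRay g Λ p.1 p.2 z := ⟨(t, l), h⟩
  rw [fanSpeed, dif_pos hex]
  exact F.ray_unique hex.choose_spec h

theorem exists_ray (F : FanData g w Λ lam0 K) {z : ℝ × ℝ} (hz : z ∈ above g) :
    ∃ t, OnRay g Λ t (fanSpeed g Λ z) z := by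
  obtain ⟨t, l, h⟩ := F.exists_onRay hz
  exact ⟨t, by rwa [F.fanSpeed_eq h]⟩

theorem fanSpeed_le (F : FanData g w Λ lam0 K) {z : ℝ × ℝ} (hz : z ∈ above g) :
    fanSpeed g Λ z ≤ lam0 :=
  F.ray_le (F.exists_ray hz).choose_spec

theorem le_fanSpeed (F : FanData g w Λ lam0 K) {z : ℝ × ℝ} (hz : z ∈ above g) :
    Λ z.1 ≤ fanSpeed g Λ z :=
  ray_ge (F.exists_ray hz).choose_spec

/-- Forward along a ray. -/
theorem onRay_forward {t l : ℝ} {z : ℝ × ℝ} (h : OnRay g Λ t l z) {x : ℝ} (hx : t < x) :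
    OnRay g Λ t l (x, g t + l * (x - t)) :=
  ⟨hx, rfl, h.2.2.1, h.2.2.2⟩

theorem fanSpeed_upstream (F : FanData g w Λ lam0 K) {z : ℝ × ℝ} (hz : z ∈ above g)
    (h : lam0 * z.1 ≤ z.2) : fanSpeed g Λ z = lam0 := by
  have hy : 0 < z.2 := by
    rcases le_or_gt z.1 0 with h0 | h0
    · have : g z.1 < z.2 := hz
      rwa [F.flat _ h0] at this
    · exact (mul_pos F.pos h0).trans_le h
  have hle : z.1 - z.2 / lam0 ≤ 0 := by
    rw [sub_nonpos, le_div_iff₀ F.pos]; linarith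
  apply F.fanSpeed_eq (t := z.1 - z.2 / lam0)
  refine ⟨sub_lt_self _ (div_pos hy F.pos), ?_, ?_, ?_⟩
  · rw [F.flat _ hle]
    have := F.pos.ne'
    field_simp; ring
  · intro s hs
    rw [F.speed_flat s (hs.le.trans hle)]
  · exact fun s _ => F.le_speed s

/-- A foot at t < 0 would force the slope `lam0` and put the point above the leading characteristic.
-/
theorem fanSpeed_wave (F : FanData g w Λ lam0 K) {z : ℝ × ℝ} {t l : ℝ} (h : OnRay g Λ t l z)
    (hlt : z.2 < lam0 * z.1) : 0 ≤ t ∧ l < lam0 := by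
  have ht : 0 ≤ t := by
    by_contra hneg
    push Not at hneg
    have h1 := h.2.2.2 (t / 2) (by linarith)
    rw [F.speed_flat _ (by linarith)] at h1
    have h2 := le_antisymm (F.ray_le h) h1
    have h3 := h.2.1
    rw [F.flat _ hneg.le, h2] at h3
    nlinarith [F.pos]
  refine ⟨ht, ?_⟩
  rcases ht.eq_or_lt with h0 | h0
  · have h3 := h.2.1
    have h1 := h.1
    rw [← h0, F.flat 0 le_rfl] at h3
    rw [← h0] at h1
    by_contra hcon
    push Not at hcon
    nlinarith
  · exact (h.2.2.1 (t / 2) (by linarith)).trans_lt (F.speed_lt _ (by linarith))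

/-- Rays that end well above the wall are long, which controls the factor `z₁.1 - t₁` in
`ray_compare` from below. -/
theorem foot_dist (F : FanData g w Λ lam0 K) {z : ℝ × ℝ} {t l : ℝ} (h : OnRay g Λ t l z) :
    z.2 - g z.1 ≤ (lam0 + K) * (z.1 - t) := by
  have h1 := F.lip.dist_le_mul t z.1
  rw [Real.dist_eq, Real.dist_eq, abs_sub_comm t, abs_of_pos (sub_pos.2 h.1)] at h1
  have h2 := le_of_abs_le h1
  have h3 := mul_le_mul_of_nonneg_right (F.ray_le h) (sub_pos.2 h.1).le
  rw [h.2.1]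
  linarith

/-- `ray_compare` and `foot_dist` together, with the slopes bounded above by `lam0` and below by `Λ
X`. The constant blows up as δ tends to 0, as it must when a centred fan issues from a corner. -/
theorem fanSpeed_lipschitzOn (F : FanData g w Λ lam0 K) (X : ℝ) {δ : ℝ} (hδ : 0 < δ) :
    ∃ C, LipschitzOnWith C (fanSpeed g Λ) {z | z.1 ≤ X ∧ g z.1 + δ ≤ z.2} := by
  have hlK : 0 < lam0 + K := add_pos_of_pos_of_nonneg F.pos K.2
  let M : ℝ := max lam0 (-Λ X)
  have hM0 : 0 < M := F.pos.trans_le (le_max_left _ _)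
  have hmem : ∀ z : ℝ × ℝ, g z.1 + δ ≤ z.2 → z ∈ above g := fun z hz => by
    show g z.1 < z.2
    linarith
  have key : ∀ z₁ z₂ : ℝ × ℝ, z₁.1 ≤ X → g z₁.1 + δ ≤ z₁.2 → z₂.1 ≤ X → g z₂.1 + δ ≤ z₂.2 →
      fanSpeed g Λ z₂ - fanSpeed g Λ z₁ ≤ ((lam0 + K) * (1 + M) / δ) * dist z₁ z₂ := by
    intro z₁ z₂ hx₁ hy₁ hx₂ hy₂
    rcases le_or_gt (fanSpeed g Λ z₂) (fanSpeed g Λ z₁) with h | h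
    · have : 0 ≤ ((lam0 + K) * (1 + M) / δ) * dist z₁ z₂ := by positivity
      linarith
    obtain ⟨t₁, h₁⟩ := F.exists_ray (hmem z₁ hy₁)
    obtain ⟨t₂, h₂⟩ := F.exists_ray (hmem z₂ hy₂)
    have h3 := F.ray_compare h₁ h₂ h
    have h4 := F.foot_dist h₁
    have h5 : |fanSpeed g Λ z₂| ≤ M := by
      rw [abs_le]
      constructor
      · have h6 := F.le_fanSpeed (hmem z₂ hy₂)
        have h7 := F.anti hx₂
        have h8 : -Λ X ≤ M := le_max_right _ _
        linarith
      · exact (F.fanSpeed_le (hmem z₂ hy₂)).trans (le_max_left _ _)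
    have hd1 : |z₁.1 - z₂.1| ≤ dist z₁ z₂ := by
      rw [Prod.dist_eq, ← Real.dist_eq]; exact le_max_left _ _
    have hd2 : |z₁.2 - z₂.2| ≤ dist z₁ z₂ := by
      rw [Prod.dist_eq, ← Real.dist_eq]; exact le_max_right _ _
    have h9 : fanSpeed g Λ z₂ * (z₁.1 - z₂.1) ≤ M * dist z₁ z₂ :=
      (le_abs_self _).trans (by rw [abs_mul]; gcongr)
    have h10 : z₂.2 - z₁.2 ≤ dist z₁ z₂ := by
      rw [abs_sub_comm] at hd2; exact (le_abs_self _).trans hd2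
    have h11 : (fanSpeed g Λ z₂ - fanSpeed g Λ z₁) * δ ≤ (lam0 + K) * (1 + M) * dist z₁ z₂ := by
      have hpos : 0 < fanSpeed g Λ z₂ - fanSpeed g Λ z₁ := sub_pos.2 h
      calc (fanSpeed g Λ z₂ - fanSpeed g Λ z₁) * δ
          ≤ (fanSpeed g Λ z₂ - fanSpeed g Λ z₁) * ((lam0 + K) * (z₁.1 - t₁)) := by
            gcongr; linarith
        _ = (lam0 + K) * ((fanSpeed g Λ z₂ - fanSpeed g Λ z₁) * (z₁.1 - t₁)) := by ring
        _ ≤ (lam0 + K) * (dist z₁ z₂ + M * dist z₁ z₂) := by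
            gcongr; linarith
        _ = _ := by ring
    rw [div_mul_eq_mul_div, le_div_iff₀ hδ]
    exact h11
  refine ⟨_, LipschitzOnWith.of_dist_le' (K := (lam0 + K) * (1 + M) / δ) ?_⟩
  rintro z₁ ⟨hx₁, hy₁⟩ z₂ ⟨hx₂, hy₂⟩
  rw [Real.dist_eq, abs_le]
  have a1 := key z₁ z₂ hx₁ hy₁ hx₂ hy₂
  have a2 := key z₂ z₁ hx₂ hy₂ hx₁ hy₁
  rw [dist_comm z₂ z₁] at a2
  constructor <;> linarith

theorem fanSpeed_mono (F : FanData g w Λ lam0 K) {x y y' : ℝ} (hy : g x < y) (hyy : y ≤ y') :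
    fanSpeed g Λ (x, y) ≤ fanSpeed g Λ (x, y') := by
  obtain ⟨t₁, h₁⟩ := F.exists_ray (z := (x, y)) hy
  obtain ⟨t₂, h₂⟩ := F.exists_ray (z := (x, y')) (hy.trans_le hyy)
  by_contra hcon
  push Not at hcon
  have h3 := F.ray_compare h₂ h₁ hcon
  have h4 := mul_pos (sub_pos.2 hcon) (sub_pos.2 h₂.1)
  simp only [sub_self, mul_zero, add_zero] at h3 h4
  linarith

/-- The equation `l_x + l l_y = 0` of a fan, where its speed is differentiable. -/
theorem fanSpeed_transport (F : FanData g w Λ lam0 K) {z : ℝ × ℝ} (hz : z ∈ above g)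
    {D : ℝ × ℝ →L[ℝ] ℝ} (hD : HasFDerivAt (fanSpeed g Λ) D z) :
    D (1, 0) + fanSpeed g Λ z * D (0, 1) = 0 ∧ 0 ≤ D (0, 1) := by
  constructor
  · obtain ⟨t, ht⟩ := F.exists_ray hz
    have h1 : HasDerivAt (fun s : ℝ => z + s • ((1 : ℝ), fanSpeed g Λ z)) (1, fanSpeed g Λ z) 0 := by
      simpa using ((hasDerivAt_id (0 : ℝ)).smul_const ((1 : ℝ), fanSpeed g Λ z)).const_add z
    have h2 : HasDerivAt (fun s : ℝ => fanSpeed g Λ (z + s • ((1 : ℝ), fanSpeed g Λ z)))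
        (D (1, fanSpeed g Λ z)) 0 :=
      HasFDerivAt.comp_hasDerivAt (l := fanSpeed g Λ) (l' := D) (0 : ℝ) (by simpa using hD) h1
    have h3 : (fun s : ℝ => fanSpeed g Λ (z + s • ((1 : ℝ), fanSpeed g Λ z))) =ᶠ[𝓝 0]
        fun _ => fanSpeed g Λ z := by
      filter_upwards [lt_mem_nhds (show t - z.1 < 0 by linarith [ht.1])] with s hs
      have h4 := F.fanSpeed_eq (onRay_forward ht (x := z.1 + s) (by linarith))
      have h5 : z + s • ((1 : ℝ), fanSpeed g Λ z) =
          (z.1 + s, g t + fanSpeed g Λ z * (z.1 + s - t)) := by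
        ext
        · simp
        · have := ht.2.1
          simp only [Prod.snd_add, Prod.smul_snd, smul_eq_mul]
          linarith
      rw [h5, h4]
    have h6 : D (1, fanSpeed g Λ z) = 0 :=
      h2.unique ((hasDerivAt_const _ _).congr_of_eventuallyEq h3)
    have h7 : ((1 : ℝ), fanSpeed g Λ z) = (1, 0) + fanSpeed g Λ z • ((0 : ℝ), (1 : ℝ)) := by
      simp
    rw [h7, map_add, map_smul, smul_eq_mul] at h6
    exact h6
  · have h1 : HasDerivAt (fun s : ℝ => z + s • ((0 : ℝ), (1 : ℝ))) (0, 1) 0 := by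
      simpa using ((hasDerivAt_id (0 : ℝ)).smul_const ((0 : ℝ), (1 : ℝ))).const_add z
    have h2 : HasDerivAt (fun s : ℝ => fanSpeed g Λ (z + s • ((0 : ℝ), (1 : ℝ)))) (D (0, 1)) 0 :=
      HasFDerivAt.comp_hasDerivAt (l := fanSpeed g Λ) (l' := D) (0 : ℝ) (by simpa using hD) h1
    have h3 := h2.tendsto_slope_zero_right
    refine ge_of_tendsto h3 ?_
    filter_upwards [self_mem_nhdsWithin] with s hs
    have hs : (0 : ℝ) < s := hs
    have h4 := F.fanSpeed_mono (x := z.1) (y := z.2) (y' := z.2 + s) hz (by linarith)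
    have h5 : z + s • ((0 : ℝ), (1 : ℝ)) = (z.1, z.2 + s) := by ext <;> simp
    simp only [zero_add, zero_smul, add_zero, h5, smul_eq_mul]
    exact mul_nonneg (inv_nonneg.2 hs.le) (sub_nonneg.2 h4)

end FanData

/-! ### The rarefaction curve as an epicycloid in the hodograph plane -/

/-- A constant supersonic upstream state `(u, 0, p, ρ)` of a polytropic gas. -/
structure Upstream where
  γ : ℝ
  u : ℝ
  p : ℝ
  ρ : ℝ
  one_lt : 1 < γ
  p_pos : 0 < p
  ρ_pos : 0 < ρ
  supersonic : √(γ * p / ρ) < u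

namespace Upstream

variable (G : Upstream)

/-- The upstream state. -/
def state₀ : State := ![G.u, 0, G.p, G.ρ]

/-- The upstream sonic speed. -/
def c : ℝ := √(G.γ * G.p / G.ρ)

/-- `√((γ - 1) / (γ + 1))`. -/
def k : ℝ := √((G.γ - 1) / (G.γ + 1))

/-- The limit speed. -/
def qs : ℝ := √(G.u ^ 2 + 2 * G.c ^ 2 / (G.γ - 1))

/-- The critical speed. -/
def cs : ℝ := G.k * G.qs

/-- The upstream Mach angle. -/
def mach₀ : ℝ := Real.arcsin (G.c / G.u)

/-- The phase of the upstream state on the hodograph epicycloid. -/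
def phase₀ : ℝ := Real.arcsin (G.c / G.cs)

/-- The phase of the state whose `5`-characteristic has the angle `α`. -/
def phase (α : ℝ) : ℝ := G.k * (α - G.mach₀) + G.phase₀

/-- The velocity component along the `5`-characteristic. -/
def tang (α : ℝ) : ℝ := G.qs * Real.cos (G.phase α)

/-- The sonic speed, which is the velocity component normal to the `5`-characteristic. -/
def snd (α : ℝ) : ℝ := G.cs * Real.sin (G.phase α)

/-- The characteristic has the direction (cos α, sin α). The flow is this direction turned clockwise
by the Mach angle, so that its component across the characteristic is the sound speed. -/
def velU (α : ℝ) : ℝ := G.tang α * Real.cos α + G.snd α * Real.sin α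

def velV (α : ℝ) : ℝ := G.tang α * Real.sin α - G.snd α * Real.cos α

/-- At constant entropy the density is proportional to c^(2/(γ - 1)). The pressure `prs` is then
read off from c² = γp/ρ. -/
def rho (α : ℝ) : ℝ := G.ρ * (G.snd α / G.c) ^ (2 / (G.γ - 1))

def prs (α : ℝ) : ℝ := G.rho α * G.snd α ^ 2 / G.γ

/-- The rarefaction curve, parametrized by the angle of the `5`-characteristic. -/
def state (α : ℝ) : State := ![G.velU α, G.velV α, G.prs α, G.rho α]

/-- The angles that correspond to the states with `u > c_*` on the rarefaction curve. -/
def arc : Set ℝ := {α | -(Real.pi / 2) < α ∧ α ≤ G.mach₀ ∧ 0 < G.phase α ∧ G.cs < G.velU α}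

theorem γ_pos : 0 < G.γ := by linarith [G.one_lt]
theorem γ_sub_pos : 0 < G.γ - 1 := by linarith [G.one_lt]
theorem γ_add_pos : 0 < G.γ + 1 := by linarith [G.one_lt]

theorem c_pos : 0 < G.c :=
  Real.sqrt_pos.2 (div_pos (mul_pos G.γ_pos G.p_pos) G.ρ_pos)

theorem c_sq : G.c ^ 2 = G.γ * G.p / G.ρ :=
  Real.sq_sqrt (div_pos (mul_pos G.γ_pos G.p_pos) G.ρ_pos).le

theorem c_lt_u : G.c < G.u := G.supersonic
theorem u_pos : 0 < G.u := G.c_pos.trans G.c_lt_u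

theorem k_pos : 0 < G.k := Real.sqrt_pos.2 (div_pos G.γ_sub_pos G.γ_add_pos)

theorem k_sq : G.k ^ 2 = (G.γ - 1) / (G.γ + 1) :=
  Real.sq_sqrt (div_pos G.γ_sub_pos G.γ_add_pos).le

theorem one_sub_k_sq : 1 - G.k ^ 2 = 2 / (G.γ + 1) := by
  rw [k_sq]; have := G.γ_add_pos.ne'; field_simp; ring

theorem qs_pos : 0 < G.qs := Real.sqrt_pos.2 (by
  have := G.u_pos; have := G.γ_sub_pos; positivity)

theorem qs_sq : G.qs ^ 2 = G.u ^ 2 + 2 * G.c ^ 2 / (G.γ - 1) := Real.sq_sqrt (by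
  have := G.γ_sub_pos; positivity)

theorem cs_pos : 0 < G.cs := mul_pos G.k_pos G.qs_pos

theorem cs_sq : G.cs ^ 2 = ((G.γ - 1) * G.u ^ 2 + 2 * G.c ^ 2) / (G.γ + 1) := by
  rw [cs, mul_pow, k_sq, qs_sq]
  have := G.γ_sub_pos.ne'; have := G.γ_add_pos.ne'; field_simp

theorem cs_lt_u : G.cs < G.u := by
  apply lt_of_pow_lt_pow_left₀ 2 G.u_pos.le
  rw [cs_sq, div_lt_iff₀ G.γ_add_pos]
  nlinarith [G.c_lt_u, G.c_pos]

theorem c_lt_cs : G.c < G.cs := by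
  apply lt_of_pow_lt_pow_left₀ 2 G.cs_pos.le
  rw [cs_sq, lt_div_iff₀ G.γ_add_pos]
  have : G.c ^ 2 < G.u ^ 2 := by nlinarith [G.c_lt_u, G.c_pos]
  nlinarith [G.γ_sub_pos]

theorem sin_mach₀ : Real.sin G.mach₀ = G.c / G.u :=
  Real.sin_arcsin (by linarith [div_pos G.c_pos G.u_pos]) ((div_le_one G.u_pos).2 G.c_lt_u.le)

theorem mach₀_pos : 0 < G.mach₀ := Real.arcsin_pos.2 (div_pos G.c_pos G.u_pos)
theorem mach₀_lt : G.mach₀ < Real.pi / 2 := Real.arcsin_lt_pi_div_two.2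
  ((div_lt_one G.u_pos).2 G.c_lt_u)

theorem sin_phase₀ : Real.sin G.phase₀ = G.c / G.cs :=
  Real.sin_arcsin (by linarith [div_pos G.c_pos G.cs_pos]) ((div_le_one G.cs_pos).2 G.c_lt_cs.le)

theorem phase₀_pos : 0 < G.phase₀ := Real.arcsin_pos.2 (div_pos G.c_pos G.cs_pos)
theorem phase₀_lt : G.phase₀ < Real.pi / 2 := Real.arcsin_lt_pi_div_two.2
  ((div_lt_one G.cs_pos).2 G.c_lt_cs)

theorem phase_mach₀ : G.phase G.mach₀ = G.phase₀ := by simp [phase]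

/-- Bernoulli's law for the components along and across the characteristic is an ellipse with
semi-axes `qs` and `cs`, which the phase parametrizes. -/
theorem bernoulli (α : ℝ) : G.k ^ 2 * G.tang α ^ 2 + G.snd α ^ 2 = G.cs ^ 2 := by
  simp only [tang, snd, cs]
  linear_combination (G.k ^ 2 * G.qs ^ 2) * Real.sin_sq_add_cos_sq (G.phase α)

theorem vel_sq (α : ℝ) : G.velU α ^ 2 + G.velV α ^ 2 = G.tang α ^ 2 + G.snd α ^ 2 := by
  simp only [velU, velV]
  linear_combination (G.tang α ^ 2 + G.snd α ^ 2) * Real.sin_sq_add_cos_sq α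

theorem vel_tang (α : ℝ) : G.velU α * Real.cos α + G.velV α * Real.sin α = G.tang α := by
  simp only [velU, velV]
  linear_combination G.tang α * Real.sin_sq_add_cos_sq α

theorem vel_normal (α : ℝ) : G.velU α * Real.sin α - G.velV α * Real.cos α = G.snd α := by
  simp only [velU, velV]
  linear_combination G.snd α * Real.sin_sq_add_cos_sq α

theorem total (α : ℝ) : 2 * G.snd α ^ 2 / (G.γ - 1) + (G.velU α ^ 2 + G.velV α ^ 2) =
    G.qs ^ 2 := by
  have h := G.bernoulli α
  rw [cs, mul_pow, k_sq] at h
  rw [vel_sq]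
  have := G.γ_sub_pos.ne'; have := G.γ_add_pos.ne'
  field_simp at h ⊢
  linear_combination h

theorem snd_mach₀ : G.snd G.mach₀ = G.c := by
  rw [snd, phase_mach₀, sin_phase₀, mul_div_cancel₀ _ G.cs_pos.ne']

theorem tang_mach₀ : G.tang G.mach₀ = G.u * Real.cos G.mach₀ := by
  have h1 : 0 ≤ G.tang G.mach₀ := by
    rw [tang, phase_mach₀]
    exact mul_nonneg G.qs_pos.le (Real.cos_nonneg_of_mem_Icc
      ⟨by linarith [G.phase₀_pos, Real.pi_pos], G.phase₀_lt.le⟩)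
  have h2 : 0 ≤ G.u * Real.cos G.mach₀ := mul_nonneg G.u_pos.le (Real.cos_nonneg_of_mem_Icc
      ⟨by linarith [G.mach₀_pos, Real.pi_pos], G.mach₀_lt.le⟩)
  rw [← abs_of_nonneg h1, ← abs_of_nonneg h2, ← sq_eq_sq_iff_abs_eq_abs, mul_pow, Real.cos_sq',
    sin_mach₀]
  have h3 := G.bernoulli G.mach₀
  rw [snd_mach₀, cs_sq, k_sq] at h3
  have := G.γ_sub_pos.ne'; have := G.γ_add_pos.ne'; have := G.u_pos.ne'
  field_simp at h3 ⊢
  have h4 : (G.γ - 1) * (G.tang G.mach₀ ^ 2 - (G.u ^ 2 - G.c ^ 2)) = 0 := by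
    linear_combination h3
  have := (mul_eq_zero.1 h4).resolve_left G.γ_sub_pos.ne'
  linarith

theorem velU_mach₀ : G.velU G.mach₀ = G.u := by
  rw [velU, tang_mach₀, snd_mach₀]
  have h := G.sin_mach₀
  rw [eq_div_iff G.u_pos.ne'] at h
  rw [← h]
  linear_combination G.u * Real.sin_sq_add_cos_sq G.mach₀

theorem velV_mach₀ : G.velV G.mach₀ = 0 := by
  rw [velV, tang_mach₀, snd_mach₀, sin_mach₀]
  have := G.u_pos.ne'
  field_simp; ring

theorem rho_mach₀ : G.rho G.mach₀ = G.ρ := by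
  rw [rho, snd_mach₀, div_self G.c_pos.ne', Real.one_rpow, mul_one]

theorem prs_mach₀ : G.prs G.mach₀ = G.p := by
  rw [prs, rho_mach₀, snd_mach₀, c_sq]
  have := G.γ_pos.ne'; have := G.ρ_pos.ne'
  field_simp

theorem state_mach₀ : G.state G.mach₀ = G.state₀ := by
  rw [state, state₀, velU_mach₀, velV_mach₀, rho_mach₀, prs_mach₀]

theorem hasDerivAt_phase (α : ℝ) : HasDerivAt G.phase G.k α := by
  exact ((((hasDerivAt_id α).sub_const G.mach₀).const_mul G.k).add_const G.phase₀).congr_deriv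
    (mul_one _)

/-- Since `cs = k * qs`, the slope k of the phase makes this derivative cancel the effect of the
rotating frame. Hence the velocity varies only across the characteristic, which is the relation du =
-λ₅ dv. -/
theorem hasDerivAt_tang (α : ℝ) : HasDerivAt G.tang (-G.snd α) α := by
  have := ((G.hasDerivAt_phase α).cos).const_mul G.qs
  exact this.congr_deriv (by simp only [snd, cs]; ring)

theorem hasDerivAt_snd (α : ℝ) : HasDerivAt G.snd (G.k ^ 2 * G.tang α) α := by
  have := ((G.hasDerivAt_phase α).sin).const_mul G.cs
  exact this.congr_deriv (by simp only [tang, cs]; ring)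

theorem hasDerivAt_velU (α : ℝ) :
    HasDerivAt G.velU (-(1 - G.k ^ 2) * G.tang α * Real.sin α) α := by
  have := ((G.hasDerivAt_tang α).mul (Real.hasDerivAt_cos α)).add
    ((G.hasDerivAt_snd α).mul (Real.hasDerivAt_sin α))
  exact this.congr_deriv (by ring)

theorem hasDerivAt_velV (α : ℝ) :
    HasDerivAt G.velV ((1 - G.k ^ 2) * G.tang α * Real.cos α) α := by
  have := ((G.hasDerivAt_tang α).mul (Real.hasDerivAt_sin α)).sub
    ((G.hasDerivAt_snd α).mul (Real.hasDerivAt_cos α))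
  exact this.congr_deriv (by ring)

theorem hasDerivAt_rho {α : ℝ} (h : 0 < G.snd α) :
    HasDerivAt G.rho (G.rho α * (2 / (G.γ + 1)) * G.tang α / G.snd α) α := by
  have h1 : G.snd α / G.c ≠ 0 := (div_pos h G.c_pos).ne'
  have := (((G.hasDerivAt_snd α).div_const G.c).rpow_const (p := 2 / (G.γ - 1))
    (Or.inl h1)).const_mul G.ρ
  refine this.congr_deriv ?_
  rw [Real.rpow_sub_one h1, k_sq, rho]
  have := G.γ_sub_pos.ne'; have := G.γ_add_pos.ne'; have := G.c_pos.ne'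
  field_simp

theorem hasDerivAt_prs {α : ℝ} (h : 0 < G.snd α) :
    HasDerivAt G.prs (G.rho α * (2 / (G.γ + 1)) * G.tang α * G.snd α) α := by
  have := ((G.hasDerivAt_rho h).mul ((G.hasDerivAt_snd α).pow 2)).div_const G.γ
  refine this.congr_deriv ?_
  rw [k_sq]
  have := G.γ_pos.ne'; have := G.γ_add_pos.ne'
  simp only [Pi.pow_apply]
  field_simp
  ring

/-- The derivative of `state`. -/
def stateDeriv (α : ℝ) : State :=
  ![-(1 - G.k ^ 2) * G.tang α * Real.sin α, (1 - G.k ^ 2) * G.tang α * Real.cos α,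
    G.rho α * (2 / (G.γ + 1)) * G.tang α * G.snd α,
    G.rho α * (2 / (G.γ + 1)) * G.tang α / G.snd α]

theorem hasDerivAt_state {α : ℝ} (h : 0 < G.snd α) : HasDerivAt G.state (G.stateDeriv α) α := by
  rw [hasDerivAt_pi]
  intro i
  fin_cases i
  · exact G.hasDerivAt_velU α
  · exact G.hasDerivAt_velV α
  · exact G.hasDerivAt_prs h
  · exact G.hasDerivAt_rho h

theorem phase_le {α : ℝ} (h : α ≤ G.mach₀) : G.phase α ≤ G.phase₀ := by
  have := mul_nonneg G.k_pos.le (sub_nonneg.2 h)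
  simp only [phase]; linarith

section Arc

variable {G} {α : ℝ}

theorem tang_pos_of (h0 : 0 ≤ G.phase α) (h1 : α ≤ G.mach₀) : 0 < G.tang α :=
  mul_pos G.qs_pos (Real.cos_pos_of_mem_Ioo ⟨by linarith [Real.pi_pos],
    (G.phase_le h1).trans_lt G.phase₀_lt⟩)

theorem arc_tang_pos (h : α ∈ G.arc) : 0 < G.tang α := tang_pos_of h.2.2.1.le h.2.1

theorem arc_snd_pos (h : α ∈ G.arc) : 0 < G.snd α :=
  mul_pos G.cs_pos (Real.sin_pos_of_pos_of_lt_pi h.2.2.1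
    (by linarith [G.phase_le h.2.1, G.phase₀_lt, Real.pi_pos]))

theorem arc_cos_pos (h : α ∈ G.arc) : 0 < Real.cos α :=
  Real.cos_pos_of_mem_Ioo ⟨h.1, h.2.1.trans_lt G.mach₀_lt⟩

theorem arc_velU_pos (h : α ∈ G.arc) : 0 < G.velU α := G.cs_pos.trans h.2.2.2

theorem arc_snd_lt (h : α ∈ G.arc) : G.snd α < G.cs := by
  have h1 := G.bernoulli α
  have h2 := mul_pos (pow_pos G.k_pos 2) (pow_pos (arc_tang_pos h) 2)
  exact lt_of_pow_lt_pow_left₀ 2 G.cs_pos.le (by linarith)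

theorem arc_snd_lt_velU (h : α ∈ G.arc) : G.snd α < G.velU α := (arc_snd_lt h).trans h.2.2.2

theorem arc_rho_pos (h : α ∈ G.arc) : 0 < G.rho α :=
  mul_pos G.ρ_pos (Real.rpow_pos_of_pos (div_pos (arc_snd_pos h) G.c_pos) _)

theorem arc_prs_pos (h : α ∈ G.arc) : 0 < G.prs α :=
  div_pos (mul_pos (arc_rho_pos h) (pow_pos (arc_snd_pos h) 2)) G.γ_pos

theorem mach₀_mem_arc : G.mach₀ ∈ G.arc :=
  ⟨by linarith [G.mach₀_pos, Real.pi_pos], le_rfl, by rw [phase_mach₀]; exact G.phase₀_pos,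
    by rw [velU_mach₀]; exact G.cs_lt_u⟩

/-- The derivative of u has the sign of -sin α: u increases up to α = 0 and then decreases to its
upstream value, which exceeds c_*. So u > c_* persists from α up to the Mach angle. -/
theorem arc_upward {β : ℝ} (h : α ∈ G.arc) (h1 : α ≤ β) (h2 : β ≤ G.mach₀) : β ∈ G.arc := by
  have hph : ∀ x, α ≤ x → 0 < G.phase x := by
    intro x hx
    have := mul_nonneg G.k_pos.le (sub_nonneg.2 hx)
    have := h.2.2.1
    simp only [phase] at *; linarith
  refine ⟨h.1.trans_le h1, h2, hph β h1, ?_⟩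
  have h1k : 0 < 1 - G.k ^ 2 := by rw [one_sub_k_sq]; exact div_pos two_pos G.γ_add_pos
  rcases le_total 0 β with hβ | hβ
  · have hanti : AntitoneOn G.velU (Icc β G.mach₀) := by
      apply antitoneOn_of_deriv_nonpos (convex_Icc _ _)
      · exact fun x _ => (G.hasDerivAt_velU x).continuousAt.continuousWithinAt
      · exact fun x _ => (G.hasDerivAt_velU x).differentiableAt.differentiableWithinAt
      · intro x hx
        rw [interior_Icc] at hx
        rw [(G.hasDerivAt_velU x).deriv]
        have := tang_pos_of (hph x (h1.trans hx.1.le)).le hx.2.le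
        have := Real.sin_nonneg_of_nonneg_of_le_pi (hβ.trans hx.1.le)
          (by linarith [hx.2, G.mach₀_lt, Real.pi_pos])
        have : 0 ≤ (1 - G.k ^ 2) * G.tang x * Real.sin x := by positivity
        linarith
    have := hanti (left_mem_Icc.2 h2) (right_mem_Icc.2 h2) h2
    rw [velU_mach₀] at this
    exact G.cs_lt_u.trans_le this
  · have hmono : MonotoneOn G.velU (Icc α β) := by
      apply monotoneOn_of_deriv_nonneg (convex_Icc _ _)
      · exact fun x _ => (G.hasDerivAt_velU x).continuousAt.continuousWithinAt
      · exact fun x _ => (G.hasDerivAt_velU x).differentiableAt.differentiableWithinAt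
      · intro x hx
        rw [interior_Icc] at hx
        rw [(G.hasDerivAt_velU x).deriv]
        have := tang_pos_of (hph x hx.1.le).le (hx.2.le.trans h2)
        have := Real.sin_nonpos_of_nonpos_of_neg_pi_le (hx.2.le.trans hβ)
          (by linarith [hx.1, h.1, Real.pi_pos])
        have h3 : 0 < (1 - G.k ^ 2) * G.tang x := by positivity
        nlinarith
    exact h.2.2.2.trans_le (hmono (left_mem_Icc.2 h1) (right_mem_Icc.2 h1) h1)

theorem ordConnected_arc : OrdConnected G.arc :=
  ⟨fun _ hx _ hy _ hz => arc_upward hx hz.1 (hz.2.trans hy.2.1)⟩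

/-- The slope of the velocity. -/
def slope (G : Upstream) (α : ℝ) : ℝ := G.velV α / G.velU α

theorem slope_mach₀ : G.slope G.mach₀ = 0 := by rw [slope, velV_mach₀, zero_div]

theorem hasDerivAt_slope (h : α ∈ G.arc) :
    HasDerivAt G.slope ((1 - G.k ^ 2) * G.tang α ^ 2 / G.velU α ^ 2) α := by
  have := (G.hasDerivAt_velV α).div (G.hasDerivAt_velU α) (arc_velU_pos h).ne'
  refine this.congr_deriv ?_
  have h1 := G.vel_tang α
  congr 1
  linear_combination ((1 - G.k ^ 2) * G.tang α) * h1

theorem slope_strictMonoOn : StrictMonoOn G.slope G.arc := by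
  apply strictMonoOn_of_deriv_pos ordConnected_arc.convex
  · exact fun x hx => (hasDerivAt_slope hx).continuousAt.continuousWithinAt
  · intro x hx
    have hx := interior_subset hx
    rw [(hasDerivAt_slope hx).deriv]
    have h1k : 0 < 1 - G.k ^ 2 := by rw [one_sub_k_sq]; exact div_pos two_pos G.γ_add_pos
    have := arc_tang_pos hx
    have := arc_velU_pos hx
    positivity

theorem exists_slope_eq (h : α ∈ G.arc) {w : ℝ} (h1 : G.slope α ≤ w) (h2 : w ≤ 0) :
    ∃ β ∈ G.arc, G.slope β = w := by
  have hc : ContinuousOn G.slope (Icc α G.mach₀) := fun x hx =>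
    (hasDerivAt_slope (arc_upward h hx.1 hx.2)).continuousAt.continuousWithinAt
  obtain ⟨β, hβ, e⟩ := intermediate_value_Icc h.2.1 hc ⟨h1, by rw [slope_mach₀]; exact h2⟩
  exact ⟨β, arc_upward h hβ.1 hβ.2, e⟩

/-- The gap comes from the normal velocity component, the sound speed. It makes characteristics
steeper than streamlines and hence transversal to the wall. -/
theorem tan_sub_slope (h : α ∈ G.arc) :
    Real.tan α - G.slope α = G.snd α / (G.velU α * Real.cos α) := by
  rw [Real.tan_eq_sin_div_cos, slope, div_sub_div _ _ (arc_cos_pos h).ne' (arc_velU_pos h).ne']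
  congr 1
  · linear_combination G.vel_normal α
  · ring

theorem slope_lt_tan (h : α ∈ G.arc) : G.slope α < Real.tan α := by
  have := tan_sub_slope h
  have := div_pos (arc_snd_pos h) (mul_pos (arc_velU_pos h) (arc_cos_pos h))
  linarith

theorem sonic_state (h : α ∈ G.arc) : sonic G.γ (G.state α) = G.snd α := by
  have : G.γ * G.prs α / G.rho α = G.snd α ^ 2 := by
    rw [prs]
    have := G.γ_pos.ne'; have := (arc_rho_pos h).ne'
    field_simp
  show √(G.γ * G.prs α / G.rho α) = _
  rw [this, Real.sqrt_sq (arc_snd_pos h).le]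

theorem state_supersonic (h : α ∈ G.arc) : G.state α ∈ supersonicStates G.γ :=
  ⟨arc_prs_pos h, arc_rho_pos h, by rw [sonic_state h]; exact arc_snd_lt_velU h⟩

/-- The square root in λ₅ is the tangential velocity component, because u² + v² - c² = `tang`². -/
theorem lambda5_state (h : α ∈ G.arc) : lambda5 G.γ (G.state α) = Real.tan α := by
  have hs := sonic_state h
  rw [lambda5, hs]
  show (G.velU α * G.velV α + G.snd α * √(G.velU α ^ 2 + G.velV α ^ 2 - G.snd α ^ 2)) /
    (G.velU α ^ 2 - G.snd α ^ 2) = _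
  rw [vel_sq, add_sub_cancel_right, Real.sqrt_sq (arc_tang_pos h).le, Real.tan_eq_sin_div_cos]
  have h1 : 0 < G.velU α ^ 2 - G.snd α ^ 2 := by
    nlinarith [arc_snd_lt_velU h, arc_snd_pos h]
  rw [div_eq_div_iff h1.ne' (arc_cos_pos h).ne']
  simp only [velU, velV]
  have := Real.sin_sq_add_cos_sq α
  linear_combination (-(G.tang α * G.snd α * Real.cos α) - G.snd α ^ 2 * Real.sin α) * this

theorem region_state (h : α ∈ G.arc) :
    G.cs < velX (G.state α) ∧ speed (G.state α) < G.qs := by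
  refine ⟨h.2.2.2, ?_⟩
  show √(G.velU α ^ 2 + G.velV α ^ 2) < G.qs
  rw [Real.sqrt_lt' G.qs_pos]
  have h1 := G.total α
  have : 0 < 2 * G.snd α ^ 2 / (G.γ - 1) := by
    have := arc_snd_pos h; have := G.γ_sub_pos; positivity
  linarith

theorem rho_lt (h : α ∈ G.arc) (hlt : α < G.mach₀) : G.rho α < G.ρ := by
  have h1 : G.snd α < G.c := by
    rw [← snd_mach₀, snd, snd, phase_mach₀]
    apply mul_lt_mul_of_pos_left _ G.cs_pos
    apply Real.sin_lt_sin_of_lt_of_le_pi_div_two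
    · linarith [h.2.2.1, Real.pi_pos]
    · exact G.phase₀_lt.le
    · have := mul_pos G.k_pos (sub_pos.2 hlt)
      simp only [phase]; linarith
  have h2 : (G.snd α / G.c) ^ (2 / (G.γ - 1)) < 1 :=
    Real.rpow_lt_one (div_pos (arc_snd_pos h) G.c_pos).le ((div_lt_one G.c_pos).2 h1)
      (div_pos two_pos G.γ_sub_pos)
  rw [rho]
  nlinarith [G.ρ_pos]

/-- The connecting curve is the arc itself, with the angle running linearly from the Mach angle to
α. -/
theorem state_mem_rarefaction5 (h : α ∈ G.arc) (hlt : α < G.mach₀) :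
    G.state α ∈ rarefaction5 G.γ G.state₀ := by
  refine ⟨rho_lt h hlt, fun s => G.state (G.mach₀ + s * (α - G.mach₀)),
    fun s => (α - G.mach₀) • G.stateDeriv (G.mach₀ + s * (α - G.mach₀)), ?_, ?_, ?_⟩
  · simp [state_mach₀]
  · simp
  intro s hs
  obtain ⟨β, hβ⟩ : ∃ β, β = G.mach₀ + s * (α - G.mach₀) := ⟨_, rfl⟩
  have hβa : β ∈ G.arc := arc_upward h (by rw [hβ]; nlinarith [hs.1, hs.2])
    (by rw [hβ]; nlinarith [hs.1, hs.2])
  simp only [← hβ]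
  have hc := (arc_cos_pos hβa).ne'
  have hsn := (arc_snd_pos hβa).ne'
  refine ⟨state_supersonic hβa, ?_, ?_, ?_, ?_⟩
  · apply HasDerivAt.hasDerivWithinAt
    have h1 : HasDerivAt (fun s : ℝ => G.mach₀ + s * (α - G.mach₀)) (α - G.mach₀) s := by
      simpa using ((hasDerivAt_id s).mul_const (α - G.mach₀)).const_add G.mach₀
    have h2 := G.hasDerivAt_state (arc_snd_pos hβa)
    rw [hβ] at h2 ⊢
    exact h2.scomp s h1
  · rw [sonic_state hβa]
    show (α - G.mach₀) * (G.rho β * (2 / (G.γ + 1)) * G.tang β * G.snd β) = G.snd β ^ 2 *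
      ((α - G.mach₀) * (G.rho β * (2 / (G.γ + 1)) * G.tang β / G.snd β))
    field_simp
  · rw [lambda5_state hβa, Real.tan_eq_sin_div_cos]
    show (α - G.mach₀) * (-(1 - G.k ^ 2) * G.tang β * Real.sin β) = -(Real.sin β / Real.cos β) *
      ((α - G.mach₀) * ((1 - G.k ^ 2) * G.tang β * Real.cos β))
    field_simp
  · rw [lambda5_state hβa, Real.tan_eq_sin_div_cos]
    show G.rho β * (Real.sin β / Real.cos β * G.velU β - G.velV β) *
      ((α - G.mach₀) * ((1 - G.k ^ 2) * G.tang β * Real.cos β)) =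
      (α - G.mach₀) * (G.rho β * (2 / (G.γ + 1)) * G.tang β * G.snd β)
    rw [← G.vel_normal β, one_sub_k_sq]
    field_simp

end Arc

end Upstream

/-! ### Invariants of the fifth family, and the converse: rarefaction states lie on the arc -/

theorem eq_of_hasDerivWithinAt_zero {f : ℝ → ℝ}
    (h : ∀ s ∈ Icc (0 : ℝ) 1, HasDerivWithinAt f 0 (Icc 0 1) s) : f 1 = f 0 := by
  have := Convex.norm_image_sub_le_of_norm_hasDerivWithin_le (f' := fun _ => (0 : ℝ)) (C := 0) h
    (by simp) (convex_Icc 0 1) (left_mem_Icc.2 zero_le_one) (right_mem_Icc.2 zero_le_one)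
  rw [zero_mul, norm_le_zero_iff, sub_eq_zero] at this
  exact this

theorem sonic_sq {γ : ℝ} (hγ : 1 < γ) {U : State} (hU : U ∈ supersonicStates γ) :
    sonic γ U ^ 2 = γ * pres U / dens U ∧ 0 < sonic γ U := by
  have : 0 < γ * pres U / dens U := div_pos (mul_pos (by linarith) hU.1) hU.2.1
  exact ⟨Real.sq_sqrt this.le, Real.sqrt_pos.2 this⟩

set_option maxHeartbeats 1000000 in
/-- The quantities conserved along the integral curves of the fifth family. -/
theorem rarefaction5_invariants {γ : ℝ} (hγ : 1 < γ) {cs k : ℝ} (hk : 0 < k)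
    (hk2 : k ^ 2 = (γ - 1) / (γ + 1)) (hcs0 : 0 < cs) {U₀ U : State}
    (hU : U ∈ rarefaction5 γ U₀)
    (hcs : k ^ 2 * (velX U₀ ^ 2 + velY U₀ ^ 2 - sonic γ U₀ ^ 2) + sonic γ U₀ ^ 2 = cs ^ 2) :
    (U₀ ∈ supersonicStates γ ∧ U ∈ supersonicStates γ) ∧
    Real.log (pres U) - γ * Real.log (dens U) = Real.log (pres U₀) - γ * Real.log (dens U₀) ∧
    k ^ 2 * (velX U ^ 2 + velY U ^ 2 - sonic γ U ^ 2) + sonic γ U ^ 2 = cs ^ 2 ∧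
    Real.arctan (velY U / velX U) +
        Real.arctan (sonic γ U / √(velX U ^ 2 + velY U ^ 2 - sonic γ U ^ 2)) -
        Real.arcsin (sonic γ U / cs) / k =
      Real.arctan (velY U₀ / velX U₀) +
        Real.arctan (sonic γ U₀ / √(velX U₀ ^ 2 + velY U₀ ^ 2 - sonic γ U₀ ^ 2)) -
        Real.arcsin (sonic γ U₀ / cs) / k := by
  obtain ⟨-, Y, Y', rfl, rfl, hY⟩ := hU
  have h0 := hY 0 (left_mem_Icc.2 zero_le_one)
  have h1 := hY 1 (right_mem_Icc.2 zero_le_one)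
  refine ⟨⟨h0.1, h1.1⟩, ?_⟩
  have hγ1 : γ - 1 ≠ 0 := by linarith
  have hγ2 : γ + 1 ≠ 0 := by linarith
  have hγ0 : γ ≠ 0 := by linarith
  have hcomp : ∀ s ∈ Icc (0 : ℝ) 1,
      HasDerivWithinAt (fun s => velX (Y s)) (velX (Y' s)) (Icc 0 1) s ∧
      HasDerivWithinAt (fun s => velY (Y s)) (velY (Y' s)) (Icc 0 1) s ∧
      HasDerivWithinAt (fun s => pres (Y s)) (pres (Y' s)) (Icc 0 1) s ∧
      HasDerivWithinAt (fun s => dens (Y s)) (dens (Y' s)) (Icc 0 1) s := by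
    intro s hs
    have := hasDerivWithinAt_pi.1 (hY s hs).2.1
    exact ⟨this 0, this 1, this 2, this 3⟩
  have hcsq : ∀ s ∈ Icc (0 : ℝ) 1,
      HasDerivWithinAt (fun s => γ * pres (Y s) / dens (Y s))
        ((γ - 1) * (pres (Y' s) / dens (Y s))) (Icc 0 1) s := by
    intro s hs
    obtain ⟨-, -, hp, hr⟩ := hcomp s hs
    obtain ⟨hss, -, e1, -, -⟩ := hY s hs
    refine ((hp.const_mul γ).div hr hss.2.1.ne').congr_deriv ?_
    have h2 := (sonic_sq hγ hss).1
    rw [e1, h2]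
    have := hss.2.1.ne'
    field_simp
  have hvel : ∀ s ∈ Icc (0 : ℝ) 1,
      HasDerivWithinAt (fun s => velX (Y s) ^ 2 + velY (Y s) ^ 2)
        (-2 * (pres (Y' s) / dens (Y s))) (Icc 0 1) s := by
    intro s hs
    obtain ⟨hu, hv, -, -⟩ := hcomp s hs
    obtain ⟨hss, -, -, e2, e3⟩ := hY s hs
    refine ((hu.pow 2).add (hv.pow 2)).congr_deriv ?_
    rw [← e3, e2]
    have := hss.2.1.ne'
    field_simp
    ring
  have hinv1 : ∀ s ∈ Icc (0 : ℝ) 1, HasDerivWithinAt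
      (fun s => Real.log (pres (Y s)) - γ * Real.log (dens (Y s))) 0 (Icc 0 1) s := by
    intro s hs
    obtain ⟨-, -, hp, hr⟩ := hcomp s hs
    obtain ⟨hss, -, e1, -, -⟩ := hY s hs
    refine ((hp.log hss.1.ne').sub ((hr.log hss.2.1.ne').const_mul γ)).congr_deriv ?_
    have h2 := (sonic_sq hγ hss).1
    rw [e1, h2]
    have := hss.2.1.ne'; have := hss.1.ne'
    field_simp
    ring
  -- The ratio k² is the one that balances d(c²) = (γ - 1) dp/ρ against d(u² + v²) = -2 dp/ρ.
  have hB : ∀ s ∈ Icc (0 : ℝ) 1, k ^ 2 * (velX (Y s) ^ 2 + velY (Y s) ^ 2 - sonic γ (Y s) ^ 2) +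
      sonic γ (Y s) ^ 2 = cs ^ 2 := by
    intro s hs
    have hd : ∀ s ∈ Icc (0 : ℝ) 1, HasDerivWithinAt (fun s => k ^ 2 * (velX (Y s) ^ 2 +
        velY (Y s) ^ 2 - γ * pres (Y s) / dens (Y s)) + γ * pres (Y s) / dens (Y s)) 0
        (Icc 0 1) s := by
      intro s hs
      refine ((((hvel s hs).sub (hcsq s hs)).const_mul (k ^ 2)).add (hcsq s hs)).congr_deriv ?_
      rw [hk2]
      field_simp
      ring
    have := Convex.norm_image_sub_le_of_norm_hasDerivWithin_le (f' := fun _ => (0 : ℝ)) (C := 0) hd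
      (by simp) (convex_Icc 0 1) (left_mem_Icc.2 zero_le_one) hs
    rw [zero_mul, norm_le_zero_iff, sub_eq_zero, ← (sonic_sq hγ h0.1).1,
      ← (sonic_sq hγ (hY s hs).1).1, hcs] at this
    exact this
  refine ⟨eq_of_hasDerivWithinAt_zero hinv1, hB 1 (right_mem_Icc.2 zero_le_one), ?_⟩
  -- Flow angle plus Mach angle is the angle of the characteristic, and arcsin(c/c_*) is the phase.
  -- Constancy of this combination says that the phase is affine in the angle with slope k.
  apply eq_of_hasDerivWithinAt_zero (f := fun s => Real.arctan (velY (Y s) / velX (Y s)) +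
        Real.arctan (sonic γ (Y s) / √(velX (Y s) ^ 2 + velY (Y s) ^ 2 - sonic γ (Y s) ^ 2)) -
        Real.arcsin (sonic γ (Y s) / cs) / k)
  intro s hs
  obtain ⟨hu, hv, -, -⟩ := hcomp s hs
  obtain ⟨hss, -, -, e2, e3⟩ := hY s hs
  obtain ⟨hc2, hc0⟩ := sonic_sq hγ hss
  have hBs := hB s hs
  have hu0 : 0 < velX (Y s) := hc0.trans hss.2.2
  have hcd : HasDerivWithinAt (fun s => sonic γ (Y s))
      ((γ - 1) * (pres (Y' s) / dens (Y s)) / (2 * sonic γ (Y s))) (Icc 0 1) s :=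
    (hcsq s hs).sqrt (by rw [← hc2]; positivity)
  have hqc : 0 < velX (Y s) ^ 2 + velY (Y s) ^ 2 - sonic γ (Y s) ^ 2 := by
    have h1 := hss.2.2
    nlinarith [sq_nonneg (velY (Y s))]
  have hsd : HasDerivWithinAt (fun s => velX (Y s) ^ 2 + velY (Y s) ^ 2 - sonic γ (Y s) ^ 2)
      (-(γ + 1) * (pres (Y' s) / dens (Y s))) (Icc 0 1) s := by
    refine ((hvel s hs).sub (hcd.pow 2)).congr_deriv ?_
    field_simp
    ring
  have had := hsd.sqrt hqc.ne'
  obtain ⟨a, ha⟩ : ∃ a, a = √(velX (Y s) ^ 2 + velY (Y s) ^ 2 - sonic γ (Y s) ^ 2) := ⟨_, rfl⟩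
  have ha0 : 0 < a := by rw [ha]; exact Real.sqrt_pos.2 hqc
  have ha2 : a ^ 2 = velX (Y s) ^ 2 + velY (Y s) ^ 2 - sonic γ (Y s) ^ 2 := by
    rw [ha]; exact Real.sq_sqrt hqc.le
  have hccs : sonic γ (Y s) / cs < 1 := by
    rw [div_lt_one hcs0]
    apply lt_of_pow_lt_pow_left₀ 2 hcs0.le
    rw [← hBs]
    have := mul_pos (pow_pos hk 2) hqc
    linarith
  have hccs0 : 0 < sonic γ (Y s) / cs := div_pos hc0 hcs0
  have hd1 := (hv.div hu hu0.ne').arctan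
  have hd2 := (hcd.div had (by rw [← ha]; exact ha0.ne')).arctan
  have hd3 := ((Real.hasDerivAt_arcsin (by linarith) hccs.ne).comp_hasDerivWithinAt s
    (hcd.div_const cs)).div_const k
  refine ((hd1.add hd2).sub hd3).congr_deriv ?_
  have hsq : √(1 - (sonic γ (Y s) / cs) ^ 2) = k * a / cs := by
    rw [Real.sqrt_eq_iff_mul_self_eq (by nlinarith) (by positivity)]
    field_simp
    rw [← hBs, ha2]; ring
  rw [hsq, ← ha]
  obtain ⟨c, hc⟩ : ∃ c, c = sonic γ (Y s) := ⟨_, rfl⟩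
  obtain ⟨u, hu'⟩ : ∃ u, u = velX (Y s) := ⟨_, rfl⟩
  obtain ⟨v, hv'⟩ : ∃ v, v = velY (Y s) := ⟨_, rfl⟩
  obtain ⟨l, hl⟩ : ∃ l, l = lambda5 γ (Y s) := ⟨_, rfl⟩
  obtain ⟨v', hvd⟩ : ∃ v', v' = velY (Y' s) := ⟨_, rfl⟩
  have hle : l = (u * v + c * a) / (u ^ 2 - c ^ 2) := by rw [hl, hu', hv', hc, ha]; rfl
  have hpr : pres (Y' s) / dens (Y s) = (l * u - v) * v' := by
    rw [← e3, hl, hu', hv', hvd]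
    have := hss.2.1.ne'
    field_simp
  rw [hpr, e2]
  simp only [Pi.div_apply]
  rw [← ha, ← hc, ← hu', ← hv', ← hl, ← hvd]
  have hcu : c < u := by rw [hc, hu']; exact hss.2.2
  rw [← hc] at hc0 ha2
  rw [← hu'] at hu0 ha2
  rw [← hv'] at ha2
  have hne : u ^ 2 - c ^ 2 ≠ 0 := by
    rw [sq_sub_sq]; exact (mul_pos (add_pos hu0 hc0) (sub_pos.2 hcu)).ne'
  have hac : 0 < a ^ 2 + c ^ 2 := by positivity
  have e4 : l * u - v = c * (a * u + c * v) / (u ^ 2 - c ^ 2) := by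
    rw [hle]; field_simp; ring
  have e5 : u + l * v = a * (a * u + c * v) / (u ^ 2 - c ^ 2) := by
    rw [hle]; field_simp
    linear_combination (-u) * ha2
  have f1 : (1 / (1 + (v / u) ^ 2)) * ((v' * u - v * (-l * v')) / u ^ 2) =
      v' * (u + l * v) / (a ^ 2 + c ^ 2) := by
    have h6 : a ^ 2 + c ^ 2 = u ^ 2 + v ^ 2 := by linarith
    rw [h6]
    have : u ^ 2 + v ^ 2 ≠ 0 := by positivity
    field_simp
    ring
  obtain ⟨X, hX⟩ : ∃ X, X = (a * u + c * v) / (u ^ 2 - c ^ 2) := ⟨_, rfl⟩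
  rw [mul_div_assoc, ← hX] at e4 e5
  rw [f1, e5, e4]
  have f3 : 1 / (k * a / cs) * ((γ - 1) * (c * X * v') / (2 * c) / cs) / k =
      (γ + 1) * X * v' / (2 * a) := by
    have hk2' : (γ - 1) = k ^ 2 * (γ + 1) := by rw [hk2]; field_simp
    rw [hk2']
    field_simp
  rw [f3]
  have f2 : (1 : ℝ) / (1 + (c / a) ^ 2) = a ^ 2 / (a ^ 2 + c ^ 2) := by field_simp
  rw [f2]
  field_simp
  ring

namespace Upstream
variable {G : Upstream}

theorem sonic_state₀ : sonic G.γ G.state₀ = G.c := rfl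

theorem cStar_state₀ : cStar G.γ G.state₀ = G.cs := by
  rw [← Real.sqrt_sq G.cs_pos.le, cs_sq]
  show √((G.γ - 1) * G.u ^ 2 / (G.γ + 1) + 2 * G.c ^ 2 / (G.γ + 1)) = _
  rw [add_div]

theorem qStar_state₀ : qStar G.γ G.state₀ = G.qs := rfl

theorem region_state₀ : region G.γ G.state₀ = {U | G.cs < velX U ∧ speed U < G.qs} := by
  rw [region, cStar_state₀, qStar_state₀]

-- The invariants determine the state. With α the sum of the flow angle and the Mach angle, the
-- third one gives the phase at α and thus the sound speed; Bernoulli's law gives the tangential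
-- component, hence the velocity, and the entropy gives the density and the pressure. The condition
-- on the density means c < c_∞, that is, α lies below the upstream Mach angle.
set_option maxHeartbeats 1000000 in
theorem rarefaction5_eq_state {U : State} (hU : U ∈ rarefaction5 G.γ G.state₀)
    (hr : U ∈ region G.γ G.state₀) : ∃ α ∈ G.arc, U = G.state α := by
  have hlt := hU.1
  have hucs : G.cs < velX U := by rw [region_state₀] at hr; exact hr.1
  have h0B : G.k ^ 2 * (velX G.state₀ ^ 2 + velY G.state₀ ^ 2 - sonic G.γ G.state₀ ^ 2) +
      sonic G.γ G.state₀ ^ 2 = G.cs ^ 2 := by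
    rw [sonic_state₀, cs_sq, k_sq]
    show (G.γ - 1) / (G.γ + 1) * (G.u ^ 2 + 0 ^ 2 - G.c ^ 2) + G.c ^ 2 = _
    have := G.γ_add_pos.ne'
    field_simp; ring
  obtain ⟨⟨-, hss⟩, hs, hB, hθ⟩ := rarefaction5_invariants G.one_lt G.k_pos G.k_sq G.cs_pos hU h0B
  obtain ⟨hc2, hc0⟩ := sonic_sq G.one_lt hss
  obtain ⟨c, hc⟩ : ∃ c, c = sonic G.γ U := ⟨_, rfl⟩
  obtain ⟨u, hu⟩ : ∃ u, u = velX U := ⟨_, rfl⟩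
  obtain ⟨v, hv⟩ : ∃ v, v = velY U := ⟨_, rfl⟩
  have hcu : sonic G.γ U < velX U := hss.2.2
  rw [← hc, ← hu] at hcu
  rw [← hc] at hc2 hc0 hB hθ
  rw [← hu] at hucs
  rw [← hu, ← hv] at hB hθ
  have hqc : 0 < u ^ 2 + v ^ 2 - c ^ 2 := by nlinarith [sq_nonneg v]
  obtain ⟨a, ha⟩ : ∃ a, a = √(u ^ 2 + v ^ 2 - c ^ 2) := ⟨_, rfl⟩
  have ha0 : 0 < a := by rw [ha]; exact Real.sqrt_pos.2 hqc
  have ha2 : a ^ 2 = u ^ 2 + v ^ 2 - c ^ 2 := by rw [ha]; exact Real.sq_sqrt hqc.le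
  rw [← ha2] at hB
  rw [← ha] at hθ
  have hu0 : 0 < u := hc0.trans hcu
  obtain ⟨θ, hθd⟩ : ∃ θ, θ = Real.arctan (v / u) := ⟨_, rfl⟩
  obtain ⟨μ, hμd⟩ : ∃ μ, μ = Real.arctan (c / a) := ⟨_, rfl⟩
  obtain ⟨φ, hφd⟩ : ∃ φ, φ = Real.arcsin (c / G.cs) := ⟨_, rfl⟩
  have hccs : c < G.cs := by
    apply lt_of_pow_lt_pow_left₀ 2 G.cs_pos.le
    have := mul_pos (pow_pos G.k_pos 2) (pow_pos ha0 2)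
    linarith
  have hccs1 : c / G.cs < 1 := (div_lt_one G.cs_pos).2 hccs
  have hccs0 : 0 < c / G.cs := div_pos hc0 G.cs_pos
  rw [← hθd, ← hμd, ← hφd] at hθ
  have hμ0 : Real.arctan (sonic G.γ G.state₀ /
      √(velX G.state₀ ^ 2 + velY G.state₀ ^ 2 - sonic G.γ G.state₀ ^ 2)) = G.mach₀ := by
    rw [sonic_state₀, mach₀, Real.arcsin_eq_arctan]
    · show Real.arctan (G.c / √(G.u ^ 2 + 0 ^ 2 - G.c ^ 2)) = _
      have h1 : √(1 - (G.c / G.u) ^ 2) = √(G.u ^ 2 - G.c ^ 2) / G.u := by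
        rw [← Real.sqrt_sq G.u_pos.le, ← Real.sqrt_div' _ (sq_nonneg _), Real.sqrt_sq G.u_pos.le]
        congr 1
        have := G.u_pos.ne'
        field_simp
      rw [h1]
      have := G.u_pos.ne'
      congr 1
      rw [div_div_div_cancel_right₀ this]
      congr 2; ring
    · exact ⟨by linarith [div_pos G.c_pos G.u_pos], (div_lt_one G.u_pos).2 G.c_lt_u⟩
  have hθ0 : Real.arctan (velY G.state₀ / velX G.state₀) = 0 := by
    show Real.arctan (0 / G.u) = 0
    simp
  rw [hμ0, hθ0, sonic_state₀, zero_add] at hθ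
  have hph : G.phase (θ + μ) = φ := by
    have : G.k * (θ + μ - φ / G.k) = G.k * (G.mach₀ - G.phase₀ / G.k) := by rw [hθ]; rfl
    have hk := G.k_pos.ne'
    field_simp at this
    simp only [phase]; linarith
  have hsnd : G.snd (θ + μ) = c := by
    rw [snd, hph, hφd, Real.sin_arcsin (by linarith) hccs1.le, mul_div_cancel₀ _ G.cs_pos.ne']
  have htang : G.tang (θ + μ) = a := by
    have h1 := G.bernoulli (θ + μ)
    rw [hsnd, ← hB] at h1
    have h2 : G.tang (θ + μ) ^ 2 = a ^ 2 := by
      have := (pow_pos G.k_pos 2).ne'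
      have h3 : G.k ^ 2 * (G.tang (θ + μ) ^ 2 - a ^ 2) = 0 := by linarith
      have := (mul_eq_zero.1 h3).resolve_left this
      linarith
    have h3 : 0 ≤ G.tang (θ + μ) := by
      rw [tang, hph, hφd, Real.cos_arcsin]
      exact mul_nonneg G.qs_pos.le (Real.sqrt_nonneg _)
    exact (pow_left_inj₀ h3 ha0.le two_ne_zero).1 h2
  obtain ⟨q, hq⟩ : ∃ q, q = √(u ^ 2 + v ^ 2) := ⟨_, rfl⟩
  have hq0 : 0 < q := by rw [hq]; exact Real.sqrt_pos.2 (by positivity)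
  have hq2 : q ^ 2 = u ^ 2 + v ^ 2 := by rw [hq]; exact Real.sq_sqrt (by positivity)
  have hcosθ : q * Real.cos θ = u := by
    rw [hθd, Real.cos_arctan]
    have : √(1 + (v / u) ^ 2) = q / u := by
      rw [hq, ← Real.sqrt_sq hu0.le, ← Real.sqrt_div' _ (sq_nonneg _), Real.sqrt_sq hu0.le]
      congr 1; field_simp
    rw [this]; field_simp
  have hsinθ : q * Real.sin θ = v := by
    have h1 : Real.tan θ = v / u := by rw [hθd, Real.tan_arctan]
    have h2 : Real.cos θ ≠ 0 := by
      intro h; rw [h, mul_zero] at hcosθ; exact hu0.ne hcosθ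
    rw [Real.tan_eq_sin_div_cos, div_eq_div_iff h2 hu0.ne'] at h1
    have : u * (q * Real.sin θ - v) = 0 := by
      linear_combination q * h1 + v * hcosθ
    have := (mul_eq_zero.1 this).resolve_left hu0.ne'
    linarith
  have hcosμ : q * Real.cos μ = a := by
    rw [hμd, Real.cos_arctan]
    have : √(1 + (c / a) ^ 2) = q / a := by
      rw [hq, ← Real.sqrt_sq ha0.le, ← Real.sqrt_div' _ (sq_nonneg _), Real.sqrt_sq ha0.le]
      congr 1; field_simp; linarith
    rw [this]; field_simp
  have hsinμ : q * Real.sin μ = c := by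
    have h1 : Real.tan μ = c / a := by rw [hμd, Real.tan_arctan]
    have h2 : Real.cos μ ≠ 0 := by
      intro h; rw [h, mul_zero] at hcosμ; exact ha0.ne hcosμ
    rw [Real.tan_eq_sin_div_cos, div_eq_div_iff h2 ha0.ne'] at h1
    have : a * (q * Real.sin μ - c) = 0 := by
      linear_combination q * h1 + c * hcosμ
    have := (mul_eq_zero.1 this).resolve_left ha0.ne'
    linarith
  have hvU : G.velU (θ + μ) = u := by
    rw [velU, htang, hsnd, Real.cos_add, Real.sin_add, ← hcosθ]
    rw [← hcosμ, ← hsinμ]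
    linear_combination (q * Real.cos θ) * Real.sin_sq_add_cos_sq μ
  have hvV : G.velV (θ + μ) = v := by
    rw [velV, htang, hsnd, Real.cos_add, Real.sin_add, ← hsinθ]
    rw [← hcosμ, ← hsinμ]
    linear_combination (q * Real.sin θ) * Real.sin_sq_add_cos_sq μ
  -- the entropy determines the density
  have hp := hss.1
  have hr0 := hss.2.1
  have hlog : (G.γ - 1) * (Real.log (dens U) - Real.log G.ρ) = 2 * (Real.log c - Real.log G.c) := by
    have e1 : 2 * Real.log c = Real.log G.γ + Real.log (pres U) - Real.log (dens U) := by
      rw [← Real.log_mul G.γ_pos.ne' hp.ne', ← Real.log_div (mul_pos G.γ_pos hp).ne' hr0.ne',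
        ← hc2, Real.log_pow]; norm_num
    have e2 : 2 * Real.log G.c = Real.log G.γ + Real.log G.p - Real.log G.ρ := by
      rw [← Real.log_mul G.γ_pos.ne' G.p_pos.ne', ← Real.log_div
        (mul_pos G.γ_pos G.p_pos).ne' G.ρ_pos.ne', ← c_sq, Real.log_pow]; norm_num
    have e3 : Real.log (pres U) - G.γ * Real.log (dens U) =
      Real.log G.p - G.γ * Real.log G.ρ := hs
    linear_combination e2 - e1 - e3
  have hrho : G.rho (θ + μ) = dens U := by
    have h1 := div_pos hc0 G.c_pos
    rw [rho, hsnd]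
    apply Real.log_injOn_pos (mul_pos G.ρ_pos (Real.rpow_pos_of_pos h1 _)) hr0
    rw [Real.log_mul G.ρ_pos.ne' (Real.rpow_pos_of_pos h1 _).ne', Real.log_rpow h1,
      Real.log_div hc0.ne' G.c_pos.ne']
    have := G.γ_sub_pos.ne'
    field_simp
    linear_combination -hlog
  have hprs : G.prs (θ + μ) = pres U := by
    rw [prs, hrho, hsnd, hc2]
    have := G.γ_pos.ne'; have := hr0.ne'
    field_simp
  have hclt : c < G.c := by
    have h1 : Real.log (dens U) < Real.log G.ρ := Real.log_lt_log hr0 hlt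
    have h2 : Real.log c < Real.log G.c := by
      have := mul_pos G.γ_sub_pos (sub_pos.2 h1)
      linarith
    exact (Real.log_lt_log_iff hc0 G.c_pos).1 h2
  have hφlt : φ < G.phase₀ := by
    rw [hφd, phase₀]
    apply Real.arcsin_lt_arcsin (by linarith) _ ((div_le_one G.cs_pos).2 G.c_lt_cs.le)
    exact div_lt_div_of_pos_right hclt G.cs_pos
  refine ⟨θ + μ, ⟨?_, ?_, ?_, ?_⟩, ?_⟩
  · have h1 : -(Real.pi / 2) < θ := by rw [hθd]; exact Real.neg_pi_div_two_lt_arctan _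
    have h2 : 0 < μ := by rw [hμd]; exact Real.arctan_pos.2 (div_pos hc0 ha0)
    linarith
  · by_contra hcon
    push Not at hcon
    have := mul_pos G.k_pos (sub_pos.2 hcon)
    simp only [phase] at hph
    linarith
  · rw [hph, hφd]; exact Real.arcsin_pos.2 hccs0
  · rw [hvU]; exact hucs
  · rw [state, hvU, hvV, hrho, hprs, hu, hv]
    ext i; fin_cases i <;> rfl

/-- Every wall slope between the critical slope and zero is attained on the arc. -/
theorem exists_turn {w : ℝ} (hw : Real.arctan w ∈ Ioo (thetaCrit G.γ G.state₀) 0) :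
    ∃ α ∈ G.arc, G.slope α = w := by
  have hw0 : w < 0 := by
    rw [← Real.arctan_zero] at hw; exact Real.arctan_strictMono.lt_iff_lt.1 hw.2
  -- The infimum of the empty set is 0 by convention, which would leave no angle between it and 0.
  have hne : (angle '' (rarefaction5 G.γ G.state₀ ∩ region G.γ G.state₀)).Nonempty := by
    by_contra h
    rw [not_nonempty_iff_eq_empty] at h
    have h1 := hw.1
    rw [thetaCrit, h, Real.sInf_empty] at h1
    linarith [hw.2]
  obtain ⟨_, ⟨U, ⟨hU1, hU2⟩, rfl⟩, hlt⟩ := exists_lt_of_csInf_lt hne hw.1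
  obtain ⟨α, hα, rfl⟩ := rarefaction5_eq_state hU1 hU2
  exact exists_slope_eq hα (Real.arctan_strictMono.lt_iff_lt.1 hlt).le hw0.le

end Upstream

/-! ### Entropy pairs obtained from supporting affine functions -/

theorem IsLocalMin.deriv_deriv_nonneg {f : ℝ → ℝ} {x : ℝ} (h : IsLocalMin f x)
    (hc : ContinuousAt f x) : 0 ≤ deriv (deriv f) x := by
  by_contra! hneg
  -- A negative second derivative would make the point a local maximum as well, so f would be
  -- locally constant.
  have hmax := isLocalMax_of_deriv_deriv_neg hneg h.deriv_eq_zero hc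
  have hconst : f =ᶠ[𝓝 x] fun _ => f x := by
    filter_upwards [h, hmax] with y h1 h2 using le_antisymm h2 h1
  have : deriv (deriv f) x = 0 := by
    rw [hconst.deriv.deriv_eq]; simp
  linarith

/-- A function that is supported from below by an affine function has that affine function as its
first order expansion, and nonnegative Hessian. -/
theorem fderiv_eq_and_hessian_nonneg {E : Type*} [NormedAddCommGroup E] [NormedSpace ℝ E]
    {η : E → ℝ} {L : E →L[ℝ] ℝ} {x : E} (hη : ContDiffAt ℝ 2 η x)
    (h : ∀ᶠ y in 𝓝 x, η x + L (y - x) ≤ η y) :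
    fderiv ℝ η x = L ∧ ∀ w, 0 ≤ iteratedFDeriv ℝ 2 η x ![w, w] := by
  have hmin : IsLocalMin (fun y => η y - L y) x := by
    filter_upwards [h] with y hy
    rw [map_sub] at hy; linarith
  constructor
  · have h1 := hmin.fderiv_eq_zero
    rw [fderiv_fun_sub (hη.differentiableAt (by norm_num)) L.differentiableAt,
      ContinuousLinearMap.fderiv, sub_eq_zero] at h1
    exact h1
  · intro w
    rw [iteratedFDeriv_two_apply]
    have hline : ∀ t : ℝ, HasDerivAt (fun t : ℝ => x + t • w) w t := by
      intro t
      simpa using ((hasDerivAt_id t).smul_const w).const_add x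
    have hcont : Tendsto (fun t : ℝ => x + t • w) (𝓝 0) (𝓝 x) := by
      simpa using (hline 0).continuousAt.tendsto
    have hmin' : IsLocalMin (fun t : ℝ => η (x + t • w) - L (x + t • w)) 0 := by
      filter_upwards [hcont.eventually hmin] with t ht
      simpa using ht
    have hd : ∀ᶠ t : ℝ in 𝓝 0, HasDerivAt (fun t : ℝ => η (x + t • w) - L (x + t • w))
        (fderiv ℝ η (x + t • w) w - L w) t := by
      filter_upwards [hcont.eventually (hη.eventually (by simp))] with t ht
      exact ((ht.differentiableAt (by norm_num)).hasFDerivAt.comp_hasDerivAt t (hline t)).sub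
        (L.hasFDerivAt.comp_hasDerivAt t (hline t))
    have h2 : deriv (fun t : ℝ => η (x + t • w) - L (x + t • w)) =ᶠ[𝓝 0]
        fun t => fderiv ℝ η (x + t • w) w - L w := hd.mono fun t ht => ht.deriv
    have h3 : HasDerivAt (fun t : ℝ => fderiv ℝ η (x + t • w) w - L w)
        (fderiv ℝ (fderiv ℝ η) x w w) 0 := by
      have h4 : HasFDerivAt (fderiv ℝ η) (fderiv ℝ (fderiv ℝ η) x) (x + (0 : ℝ) • w) := by
        have := (hη.fderiv_right (m := 1) (by norm_num)).differentiableAt (by norm_num)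
        simpa using this.hasFDerivAt
      have h5 : HasDerivAt (fun t : ℝ => fderiv ℝ η (x + t • w)) (fderiv ℝ (fderiv ℝ η) x w) 0 :=
        HasFDerivAt.comp_hasDerivAt (l := fderiv ℝ η) (l' := fderiv ℝ (fderiv ℝ η) x) (0 : ℝ)
          h4 (hline 0)
      have h6 : HasFDerivAt (fun T : E →L[ℝ] ℝ => T w) (ContinuousLinearMap.apply ℝ ℝ w)
        (fderiv ℝ η (x + (0 : ℝ) • w)) := (ContinuousLinearMap.apply ℝ ℝ w).hasFDerivAt
      exact (HasFDerivAt.comp_hasDerivAt (l := fun T : E →L[ℝ] ℝ => T w)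
        (l' := ContinuousLinearMap.apply ℝ ℝ w) (0 : ℝ) h6 h5).sub_const (L w)
    have := IsLocalMin.deriv_deriv_nonneg hmin' hd.self_of_nhds.continuousAt
    rwa [h2.deriv_eq, h3.deriv] at this

/-- Recovers the supersonic state from its horizontal fluxes. -/
def fluxInv (γ : ℝ) (w : Fin 4 → ℝ) : State :=
  let u := (γ * (w 1 / w 0) +
    √(γ ^ 2 * (w 1 / w 0) ^ 2 - 2 * (γ ^ 2 - 1) * (w 3 / w 0 - (w 2 / w 0) ^ 2 / 2))) / (γ + 1)
  ![u, w 2 / w 0, w 1 - w 0 * u, w 0 / u]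

/-- Eliminating v, p and ρ leaves the quadratic (γ + 1)u² - 2γ(w₁/w₀)u + 2(γ - 1)(w₃/w₀ -
(w₂/w₀)²/2) = 0. A quarter of its discriminant is the square of u - c²/u. For u > c this is
positive, so u is the larger root and depends smoothly on the fluxes. -/
theorem discrim_fluxX {γ : ℝ} (hγ : 1 < γ) {U : State} (hU : U ∈ supersonicStates γ) :
    let w := fluxX γ U
    γ ^ 2 * (w 1 / w 0) ^ 2 - 2 * (γ ^ 2 - 1) * (w 3 / w 0 - (w 2 / w 0) ^ 2 / 2) =
      ((velX U ^ 2 - sonic γ U ^ 2) / velX U) ^ 2 ∧ 0 < (velX U ^ 2 - sonic γ U ^ 2) / velX U := by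
  obtain ⟨hc2, hc0⟩ := sonic_sq hγ hU
  have hr := hU.2.1
  have hu : 0 < velX U := hc0.trans hU.2.2
  have h1 : γ - 1 ≠ 0 := by linarith
  constructor
  · simp only [fluxX, totalEnthalpy, Matrix.cons_val]
    rw [hc2]
    field_simp
    ring
  · apply div_pos _ hu
    rw [sq_sub_sq]; exact mul_pos (add_pos hu hc0) (sub_pos.2 hU.2.2)

theorem fluxInv_fluxX {γ : ℝ} (hγ : 1 < γ) {U : State} (hU : U ∈ supersonicStates γ) :
    fluxInv γ (fluxX γ U) = U := by
  obtain ⟨hc2, hc0⟩ := sonic_sq hγ hU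
  obtain ⟨h1, h2⟩ := discrim_fluxX hγ hU
  have hr := hU.2.1
  have hu : 0 < velX U := hc0.trans hU.2.2
  have hux : (γ * (fluxX γ U 1 / fluxX γ U 0) + √(γ ^ 2 * (fluxX γ U 1 / fluxX γ U 0) ^ 2 -
      2 * (γ ^ 2 - 1) * (fluxX γ U 3 / fluxX γ U 0 - (fluxX γ U 2 / fluxX γ U 0) ^ 2 / 2))) /
      (γ + 1) = velX U := by
    rw [h1, Real.sqrt_sq h2.le, hc2]
    simp only [fluxX, Matrix.cons_val]
    have : γ + 1 ≠ 0 := by linarith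
    field_simp
    ring
  simp only [fluxInv, hux]
  simp only [fluxX, Matrix.cons_val]
  ext i
  fin_cases i
  · rfl
  · show dens U * velX U * velY U / (dens U * velX U) = velY U
    field_simp
  · show dens U * velX U ^ 2 + pres U - dens U * velX U * velX U = pres U
    ring
  · show dens U * velX U / velX U = dens U
    field_simp

theorem contDiffAt_fluxInv {γ : ℝ} (hγ : 1 < γ) {U : State} (hU : U ∈ supersonicStates γ)
    {n : WithTop ℕ∞} : ContDiffAt ℝ n (fluxInv γ) (fluxX γ U) := by
  obtain ⟨hc2, hc0⟩ := sonic_sq hγ hU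
  obtain ⟨h1, h2⟩ := discrim_fluxX hγ hU
  have hinv := fluxInv_fluxX hγ hU
  have hu : 0 < velX U := hc0.trans hU.2.2
  have hw0 : fluxX γ U 0 ≠ 0 := (mul_pos hU.2.1 hu).ne'
  have hc : ∀ i, ContDiffAt ℝ n (fun w : Fin 4 → ℝ => w i) (fluxX γ U) := fun i =>
    contDiffAt_apply ℝ ℝ i _
  have hq : ∀ i, ContDiffAt ℝ n (fun w : Fin 4 → ℝ => w i / w 0) (fluxX γ U) := fun i =>
    (hc i).div (hc 0) hw0
  have hux : ContDiffAt ℝ n (fun w : Fin 4 → ℝ => (γ * (w 1 / w 0) +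
      √(γ ^ 2 * (w 1 / w 0) ^ 2 - 2 * (γ ^ 2 - 1) * (w 3 / w 0 - (w 2 / w 0) ^ 2 / 2))) /
      (γ + 1)) (fluxX γ U) := by
    refine ((contDiffAt_const.mul (hq 1)).add (ContDiffAt.sqrt ?_ ?_)).div_const _
    · exact (contDiffAt_const.mul ((hq 1).pow 2)).sub
        (contDiffAt_const.mul ((hq 3).sub (((hq 2).pow 2).div_const 2)))
    · rw [h1]; exact (pow_pos h2 2).ne'
  have hu0 : fluxInv γ (fluxX γ U) 0 ≠ 0 := by rw [hinv]; exact hu.ne'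
  rw [contDiffAt_pi]
  intro i
  fin_cases i
  · exact hux
  · exact hq 2
  · exact (hc 1).sub ((hc 0).mul hux)
  · exact (hc 0).div hux hu0

theorem eventually_fluxX_fluxInv {γ : ℝ} (hγ : 1 < γ) {U : State}
    (hU : U ∈ supersonicStates γ) : ∀ᶠ w in 𝓝 (fluxX γ U), fluxX γ (fluxInv γ w) = w := by
  obtain ⟨hc2, hc0⟩ := sonic_sq hγ hU
  obtain ⟨h1, h2⟩ := discrim_fluxX hγ hU
  have hinv := fluxInv_fluxX hγ hU
  have hu : 0 < velX U := hc0.trans hU.2.2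
  have hw0 : fluxX γ U 0 ≠ 0 := (mul_pos hU.2.1 hu).ne'
  have hc : ∀ i, ContinuousAt (fun w : Fin 4 → ℝ => w i) (fluxX γ U) := fun i =>
    (continuous_apply i).continuousAt
  have hq : ∀ i, ContinuousAt (fun w : Fin 4 → ℝ => w i / w 0) (fluxX γ U) := fun i =>
    (hc i).div (hc 0) hw0
  have hD : ContinuousAt (fun w : Fin 4 → ℝ => γ ^ 2 * (w 1 / w 0) ^ 2 -
      2 * (γ ^ 2 - 1) * (w 3 / w 0 - (w 2 / w 0) ^ 2 / 2)) (fluxX γ U) :=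
    (continuousAt_const.mul ((hq 1).pow 2)).sub
        (continuousAt_const.mul ((hq 3).sub (((hq 2).pow 2).div_const 2)))
  have hDpos := hD.eventually_ne (y := 0) (by rw [h1]; exact (pow_pos h2 2).ne')
  have hDpos' := hD.tendsto.eventually_const_lt (u := 0) (by rw [h1]; exact pow_pos h2 2)
  have hI : ContinuousAt (fun w => fluxInv γ w 0) (fluxX γ U) :=
    (continuous_apply 0).continuousAt.comp
      (contDiffAt_fluxInv (n := 0) hγ hU).continuousAt
  filter_upwards [hDpos', (hc 0).eventually_ne hw0,
    hI.eventually_ne (y := 0) (by rw [hinv]; exact hu.ne')] with w hw1 hw2 hw3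
  obtain ⟨a, ha⟩ : ∃ a, a = fluxInv γ w 0 := ⟨_, rfl⟩
  have hval : fluxInv γ w = ![a, w 2 / w 0, w 1 - w 0 * a, w 0 / a] := by rw [ha]; rfl
  have haq : (γ + 1) * a - γ * (w 1 / w 0) = √(γ ^ 2 * (w 1 / w 0) ^ 2 -
      2 * (γ ^ 2 - 1) * (w 3 / w 0 - (w 2 / w 0) ^ 2 / 2)) := by
    have h3 : γ + 1 ≠ 0 := by linarith
    rw [ha]
    simp only [fluxInv, Matrix.cons_val]
    field_simp
    ring
  have hsq := Real.sq_sqrt hw1.le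
  rw [← haq] at hsq
  rw [← ha] at hw3
  rw [hval]
  have h4 : γ - 1 ≠ 0 := by linarith
  have h5 : γ + 1 ≠ 0 := by linarith
  ext i
  fin_cases i
  · show w 0 / a * a = w 0
    field_simp
  · show w 0 / a * a ^ 2 + (w 1 - w 0 * a) = w 1
    field_simp; ring
  · show w 0 / a * a * (w 2 / w 0) = w 2
    field_simp
  · show w 0 / a * a * (γ * (w 1 - w 0 * a) / ((γ - 1) * (w 0 / a)) +
      (a ^ 2 + (w 2 / w 0) ^ 2) / 2) = w 3
    have h6 : (γ + 1) * a ^ 2 - 2 * γ * (w 1 / w 0) * a +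
        2 * (γ - 1) * (w 3 / w 0 - (w 2 / w 0) ^ 2 / 2) = 0 := by
      have h7 : (γ + 1) * ((γ + 1) * a ^ 2 - 2 * γ * (w 1 / w 0) * a +
        2 * (γ - 1) * (w 3 / w 0 - (w 2 / w 0) ^ 2 / 2)) = 0 := by linear_combination hsq
      exact (mul_eq_zero.1 h7).resolve_left h5
    field_simp
    field_simp at h6
    linear_combination (-1) * h6

theorem isOpen_supersonicStates {γ : ℝ} : ∀ U ∈ supersonicStates γ, supersonicStates γ ∈ 𝓝 U := by
  intro U hU
  have h1 : ContinuousAt pres U := (continuous_apply 2).continuousAt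
  have h2 : ContinuousAt dens U := (continuous_apply 3).continuousAt
  have h3 : ContinuousAt velX U := (continuous_apply 0).continuousAt
  have h4 : ContinuousAt (sonic γ) U :=
    ((continuousAt_const.mul h1).div h2 hU.2.1.ne').sqrt
  filter_upwards [h1.eventually_const_lt hU.1, h2.eventually_const_lt hU.2.1,
    h4.eventually_lt h3 hU.2.2] with V a b c using ⟨a, b, c⟩

theorem contDiffAt_components {n : WithTop ℕ∞} (U : State) : ContDiffAt ℝ n velX U ∧
    ContDiffAt ℝ n velY U ∧ ContDiffAt ℝ n pres U ∧ ContDiffAt ℝ n dens U :=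
  ⟨contDiffAt_apply ℝ ℝ 0 _, contDiffAt_apply ℝ ℝ 1 _, contDiffAt_apply ℝ ℝ 2 _,
    contDiffAt_apply ℝ ℝ 3 _⟩

theorem contDiffAt_totalEnthalpy {γ : ℝ} (hγ : 1 < γ) {n : WithTop ℕ∞} {U : State}
    (hU : 0 < dens U) : ContDiffAt ℝ n (totalEnthalpy γ) U := by
  obtain ⟨hu, hv, hp, hr⟩ := contDiffAt_components (n := n) U
  exact ((contDiffAt_const.mul hp).div (contDiffAt_const.mul hr)
    (mul_pos (sub_pos.2 hγ) hU).ne').add (((hu.pow 2).add (hv.pow 2)).div_const 2)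

theorem contDiffAt_fluxX {γ : ℝ} (hγ : 1 < γ) {n : WithTop ℕ∞} {U : State}
    (hU : 0 < dens U) : ContDiffAt ℝ n (fluxX γ) U := by
  obtain ⟨hu, hv, hp, hr⟩ := contDiffAt_components (n := n) U
  rw [contDiffAt_pi]
  intro i
  fin_cases i
  · exact hr.mul hu
  · exact (hr.mul (hu.pow 2)).add hp
  · exact (hr.mul hu).mul hv
  · exact (hr.mul hu).mul (contDiffAt_totalEnthalpy hγ hU)

theorem contDiffAt_fluxY {γ : ℝ} (hγ : 1 < γ) {n : WithTop ℕ∞} {U : State}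
    (hU : 0 < dens U) : ContDiffAt ℝ n (fluxY γ) U := by
  obtain ⟨hu, hv, hp, hr⟩ := contDiffAt_components (n := n) U
  rw [contDiffAt_pi]
  intro i
  fin_cases i
  · exact hr.mul hv
  · exact (hr.mul hu).mul hv
  · exact (hr.mul (hv.pow 2)).add hp
  · exact (hr.mul hv).mul (contDiffAt_totalEnthalpy hγ hU)

/-- An entropy pair in terms of the state, supported from below by affine functions of the
fluxes. -/
theorem isConvexEntropyPair_of_support {γ : ℝ} (hγ : 1 < γ) {E Q : State → ℝ}
    (hE : ∀ U ∈ supersonicStates γ, ContDiffAt ℝ 2 E U)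
    (hQ : ∀ U ∈ supersonicStates γ, ContDiffAt ℝ 1 Q U)
    (h : ∀ U ∈ supersonicStates γ, ∃ L : (Fin 4 → ℝ) →L[ℝ] ℝ,
      (∀ᶠ V in 𝓝 U, E U + L (fluxX γ V - fluxX γ U) ≤ E V) ∧
      HasFDerivAt Q (L.comp (fderiv ℝ (fluxY γ) U)) U) :
    IsConvexEntropyPair γ (E ∘ fluxInv γ) (Q ∘ fluxInv γ) := by
  have hsm : ∀ U ∈ supersonicStates γ, ContDiffAt ℝ 2 (E ∘ fluxInv γ) (fluxX γ U) :=
    fun U hU => ContDiffAt.comp _ (by rw [fluxInv_fluxX hγ hU]; exact hE U hU)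
      (contDiffAt_fluxInv hγ hU)
  have hsmQ : ∀ U ∈ supersonicStates γ, ContDiffAt ℝ 1 (Q ∘ fluxInv γ) (fluxX γ U) :=
    fun U hU => ContDiffAt.comp _ (by rw [fluxInv_fluxX hγ hU]; exact hQ U hU)
      (contDiffAt_fluxInv hγ hU)
  have key : ∀ U ∈ supersonicStates γ, ∃ L : (Fin 4 → ℝ) →L[ℝ] ℝ,
      (∀ᶠ w in 𝓝 (fluxX γ U), (E ∘ fluxInv γ) (fluxX γ U) + L (w - fluxX γ U) ≤
        (E ∘ fluxInv γ) w) ∧ HasFDerivAt Q (L.comp (fderiv ℝ (fluxY γ) U)) U := by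
    intro U hU
    obtain ⟨L, h1, h2⟩ := h U hU
    refine ⟨L, ?_, h2⟩
    have hc := (contDiffAt_fluxInv (n := 0) hγ hU).continuousAt.tendsto
    rw [fluxInv_fluxX hγ hU] at hc
    filter_upwards [hc.eventually h1, eventually_fluxX_fluxInv hγ hU] with w hw1 hw2
    rw [hw2] at hw1
    simpa [fluxInv_fluxX hγ hU] using hw1
  refine ⟨hsm, hsmQ, fun U hU w => ?_, fun U hU => ?_⟩
  · obtain ⟨L, h1, h2⟩ := key U hU
    exact (fderiv_eq_and_hessian_nonneg (hsm U hU) h1).2 w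
  · obtain ⟨L, h1, h2⟩ := key U hU
    rw [(fderiv_eq_and_hessian_nonneg (hsm U hU) h1).1, ← h2.fderiv]
    rw [← fderiv_comp U ((hsmQ U hU).differentiableAt (by norm_num))
      ((contDiffAt_fluxX (n := 1) hγ hU.2.1).differentiableAt (by norm_num))]
    apply Filter.EventuallyEq.fderiv_eq
    filter_upwards [isOpen_supersonicStates U hU] with V hV
    simp [fluxInv_fluxX hγ hV]

theorem isConvexEntropyPair_linear {γ : ℝ} (hγ : 1 < γ) (s : ℝ) (i : Fin 4) :
    IsConvexEntropyPair γ ((fun U => s * fluxX γ U i) ∘ fluxInv γ)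
      ((fun U => s * fluxY γ U i) ∘ fluxInv γ) := by
  have happ : ∀ (n : WithTop ℕ∞) (x : Fin 4 → ℝ), ContDiffAt ℝ n (fun w : Fin 4 → ℝ => w i) x :=
    fun n x => contDiffAt_apply ℝ ℝ i _
  apply isConvexEntropyPair_of_support hγ
  · exact fun U hU => contDiffAt_const.mul
      ((happ 2 _).comp U (contDiffAt_fluxX hγ hU.2.1))
  · exact fun U hU => contDiffAt_const.mul
      ((happ 1 _).comp U (contDiffAt_fluxY hγ hU.2.1))
  · intro U hU
    refine ⟨s • ContinuousLinearMap.proj (R := ℝ) (φ := fun _ : Fin 4 => ℝ) i,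
      Eventually.of_forall fun V => ?_, ?_⟩
    · have : (s • ContinuousLinearMap.proj (R := ℝ) (φ := fun _ : Fin 4 => ℝ) i)
          (fluxX γ V - fluxX γ U) = s * (fluxX γ V i - fluxX γ U i) := rfl
      rw [this]
      linarith
    · have := ((contDiffAt_fluxY (n := 1) hγ hU.2.1).differentiableAt (by norm_num)).hasFDerivAt
      exact (s • ContinuousLinearMap.proj (R := ℝ) (φ := fun _ : Fin 4 => ℝ) i).hasFDerivAt.comp
        U this

/-- A convex function of a transported quantity gives an entropy pair. -/
theorem isConvexEntropyPair_transport {γ : ℝ} (hγ : 1 < γ) {ξ : State → ℝ} {f : ℝ → ℝ}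
    (hξ : ∀ U ∈ supersonicStates γ, ContDiffAt ℝ 2 ξ U) (hf : ContDiff ℝ 2 f)
    (hconv : ∀ s t, f s + deriv f s * (t - s) ≤ f t)
    (h : ∀ U ∈ supersonicStates γ, ∃ M : (Fin 4 → ℝ) →L[ℝ] ℝ,
      (∀ᶠ V in 𝓝 U, deriv f (ξ U) * M (fluxX γ V - fluxX γ U) ≤
        deriv f (ξ U) * (fluxX γ V 0 * (ξ V - ξ U))) ∧
      fluxY γ U 0 • fderiv ℝ ξ U = M.comp (fderiv ℝ (fluxY γ) U)) :
    IsConvexEntropyPair γ ((fun U => fluxX γ U 0 * f (ξ U)) ∘ fluxInv γ)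
      ((fun U => fluxY γ U 0 * f (ξ U)) ∘ fluxInv γ) := by
  have happ : ∀ (n : WithTop ℕ∞) (x : Fin 4 → ℝ), ContDiffAt ℝ n (fun w : Fin 4 → ℝ => w 0) x :=
    fun n x => contDiffAt_apply ℝ ℝ 0 _
  apply isConvexEntropyPair_of_support hγ
  · exact fun U hU => ((happ 2 _).comp U (contDiffAt_fluxX hγ hU.2.1)).mul
      (hf.contDiffAt.comp U (hξ U hU))
  · exact fun U hU => ((happ 1 _).comp U (contDiffAt_fluxY hγ hU.2.1)).mul
      ((hf.of_le (by norm_num)).contDiffAt.comp U ((hξ U hU).of_le (by norm_num)))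
  · intro U hU
    obtain ⟨M, h1, h2⟩ := h U hU
    let p0 := ContinuousLinearMap.proj (R := ℝ) (φ := fun _ : Fin 4 => ℝ) 0
    refine ⟨f (ξ U) • p0 + deriv f (ξ U) • M, ?_, ?_⟩
    · have hpos : ∀ᶠ V in 𝓝 U, 0 < fluxX γ V 0 := by
        filter_upwards [isOpen_supersonicStates U hU] with V hV
        exact mul_pos hV.2.1 ((sonic_sq hγ hV).2.trans hV.2.2)
      filter_upwards [h1, hpos] with V hV hV0
      have h3 : (f (ξ U) • p0 + deriv f (ξ U) • M) (fluxX γ V - fluxX γ U) =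
        f (ξ U) * (fluxX γ V 0 - fluxX γ U 0) + deriv f (ξ U) * M (fluxX γ V - fluxX γ U) := rfl
      rw [h3]
      have := mul_le_mul_of_nonneg_left (hconv (ξ U) (ξ V)) hV0.le
      linarith
    · have hY := ((contDiffAt_fluxY (n := 1) hγ hU.2.1).differentiableAt
        (by norm_num)).hasFDerivAt
      have hY0 : HasFDerivAt (fun V => fluxY γ V 0) (p0.comp (fderiv ℝ (fluxY γ) U)) U :=
        p0.hasFDerivAt.comp U hY
      have hfd : HasDerivAt f (deriv f (ξ U)) (ξ U) :=
        (hf.differentiable (by norm_num)).differentiableAt.hasDerivAt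
      have hξd := ((hξ U hU).differentiableAt (by norm_num)).hasFDerivAt
      refine (hY0.mul (hfd.comp_hasFDerivAt U hξd)).congr_fderiv ?_
      rw [ContinuousLinearMap.add_comp, ContinuousLinearMap.smul_comp,
        ContinuousLinearMap.smul_comp, ← h2, smul_comm, add_comm]
      rfl

/-- The total enthalpy B is the quotient of the energy flux by the mass flux in both directions. So
the functional w₃ - B(U) w₀ reproduces ρu(B(V) - B(U)) exactly, and the supporting inequality needs
no monotonicity of f. -/
theorem isConvexEntropyPair_enthalpy {γ : ℝ} (hγ : 1 < γ) (b : ℝ) :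
    IsConvexEntropyPair γ ((fun U => fluxX γ U 0 * (totalEnthalpy γ U - b) ^ 2) ∘ fluxInv γ)
      ((fun U => fluxY γ U 0 * (totalEnthalpy γ U - b) ^ 2) ∘ fluxInv γ) := by
  have hd : ∀ s, HasDerivAt (fun s : ℝ => (s - b) ^ 2) (2 * (s - b)) s := fun s => by
    simpa using HasDerivAt.comp_sub_const s b (hasDerivAt_pow 2 (s - b))
  refine isConvexEntropyPair_transport hγ (f := fun s => (s - b) ^ 2)
    (fun U hU => contDiffAt_totalEnthalpy hγ hU.2.1)
    ((contDiff_id.sub contDiff_const).pow 2) (fun s t => ?_) fun U hU => ?_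
  · rw [(hd s).deriv]; nlinarith [sq_nonneg (t - s)]
  · let p (i : Fin 4) := ContinuousLinearMap.proj (R := ℝ) (φ := fun _ : Fin 4 => ℝ) i
    refine ⟨p 3 - totalEnthalpy γ U • p 0, Eventually.of_forall fun V => ?_, ?_⟩
    · apply le_of_eq
      congr 1
      show (fluxX γ V 3 - fluxX γ U 3) - totalEnthalpy γ U * (fluxX γ V 0 - fluxX γ U 0) = _
      show (dens V * velX V * totalEnthalpy γ V - dens U * velX U * totalEnthalpy γ U) -
        totalEnthalpy γ U * (dens V * velX V - dens U * velX U) = dens V * velX V * _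
      ring
    · have hY := ((contDiffAt_fluxY (n := 1) hγ hU.2.1).differentiableAt
        (by norm_num)).hasFDerivAt
      have hY0 : HasFDerivAt (fun V => fluxY γ V 0) ((p 0).comp (fderiv ℝ (fluxY γ) U)) U :=
        (p 0).hasFDerivAt.comp U hY
      have hY3 : HasFDerivAt (fun V => fluxY γ V 3) ((p 3).comp (fderiv ℝ (fluxY γ) U)) U :=
        (p 3).hasFDerivAt.comp U hY
      have hB := ((contDiffAt_totalEnthalpy (n := 1) hγ hU.2.1).differentiableAt
        (by norm_num)).hasFDerivAt
      have h3 : HasFDerivAt (fun V => fluxY γ V 3) _ U := hY0.mul hB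
      rw [ContinuousLinearMap.sub_comp, ContinuousLinearMap.smul_comp, hY3.unique h3]
      abel

theorem hasDerivAt_max_pow (n : ℕ) (x : ℝ) :
    HasDerivAt (fun x : ℝ => max x 0 ^ (n + 2)) ((n + 2 : ℕ) * max x 0 ^ (n + 1)) x := by
  rcases lt_trichotomy x 0 with h | rfl | h
  · have : (fun x : ℝ => max x 0 ^ (n + 2)) =ᶠ[𝓝 x] fun _ => 0 := by
      filter_upwards [gt_mem_nhds h] with y hy
      rw [max_eq_right hy.le]; simp
    rw [max_eq_right h.le]
    simpa using (hasDerivAt_const x (0 : ℝ)).congr_of_eventuallyEq this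
  · rw [hasDerivAt_iff_isLittleO_nhds_zero]
    simp only [zero_add, max_self]
    have h1 : (fun h : ℝ => max h 0 ^ (n + 2)) =O[𝓝 0] fun h : ℝ => h ^ (n + 2) := by
      apply Asymptotics.isBigO_of_le
      intro h
      simp only [norm_pow]
      gcongr
      rw [Real.norm_eq_abs, Real.norm_eq_abs, abs_of_nonneg (le_max_right h 0)]
      exact max_le (le_abs_self h) (abs_nonneg h)
    have h2 : (fun h : ℝ => h ^ (n + 2)) =o[𝓝 0] fun h : ℝ => h := by
      simpa using Asymptotics.isLittleO_pow_pow (𝕜 := ℝ) (m := 1) (n := n + 2) (by omega)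
    simpa using h1.trans_isLittleO h2
  · have : (fun x : ℝ => max x 0 ^ (n + 2)) =ᶠ[𝓝 x] fun x => x ^ (n + 2) := by
      filter_upwards [lt_mem_nhds h] with y hy
      rw [max_eq_left hy.le]
    rw [max_eq_left h.le]
    exact (hasDerivAt_pow (n + 2) x).congr_of_eventuallyEq this

theorem contDiff_max_cube : ContDiff ℝ 2 fun x : ℝ => max x 0 ^ 3 := by
  have h3 : deriv (fun x : ℝ => max x 0 ^ 3) = fun x => 3 * max x 0 ^ 2 := by
    ext x; simpa using (hasDerivAt_max_pow 1 x).deriv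
  have h2 : deriv (fun x : ℝ => max x 0 ^ 2) = fun x => 2 * max x 0 := by
    ext x; simpa using (hasDerivAt_max_pow 0 x).deriv
  rw [show (2 : WithTop ℕ∞) = 1 + 1 by norm_num, contDiff_succ_iff_deriv]
  refine ⟨fun x => (hasDerivAt_max_pow 1 x).differentiableAt, by simp, ?_⟩
  rw [h3]
  apply contDiff_const.mul
  rw [show (1 : WithTop ℕ∞) = 0 + 1 by norm_num, contDiff_succ_iff_deriv]
  refine ⟨fun x => (hasDerivAt_max_pow 0 x).differentiableAt, by simp, ?_⟩
  rw [h2, contDiff_zero]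
  fun_prop

/-- The negative of the physical entropy, up to scaling. -/
def negEntropy (γ : ℝ) (U : State) : ℝ := γ * Real.log (dens U) - Real.log (pres U)

/-- Both sides vanish to first order at x = 1, and the second derivatives there are γ(γ - 1) < (γ -
1)m. In the application x is a ratio of horizontal velocities and m = u²ρ/p, so that γ < m says u >
c. -/
theorem eventually_log_le {γ m : ℝ} (hγ : 1 < γ) (hm : γ < m) :
    ∀ᶠ x in 𝓝 (1 : ℝ), γ * Real.log x - Real.log (1 + γ * (x - 1)) ≤
      (γ - 1) * m * (x - 1) ^ 2 / 2 := by
  let h : ℝ → ℝ := fun x => (γ - 1) * m * (x - 1) ^ 2 / 2 -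
    (γ * Real.log x - Real.log (1 + γ * (x - 1)))
  have hcont : ContinuousAt (fun x : ℝ => x * (1 + γ * (x - 1))) 1 := by fun_prop
  have hcont2 : ContinuousAt (fun x : ℝ => (1 + γ * (x - 1))) 1 := by fun_prop
  have hev : ∀ᶠ x in 𝓝 (1 : ℝ), 0 < x ∧ 0 < 1 + γ * (x - 1) ∧
      γ / m < x * (1 + γ * (x - 1)) := by
    filter_upwards [lt_mem_nhds zero_lt_one,
      hcont2.tendsto.eventually_const_lt (u := 0) (by norm_num),
      hcont.tendsto.eventually_const_lt (u := γ / m) (by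
        rw [div_lt_iff₀ (by linarith)]; norm_num; exact hm)] with x a b c using ⟨a, b, c⟩
  have hd : ∀ᶠ x in 𝓝 (1 : ℝ), HasDerivAt h
      ((γ - 1) * (x - 1) * (m - γ / (x * (1 + γ * (x - 1))))) x := by
    filter_upwards [hev] with x hx
    have e1 : HasDerivAt (fun x : ℝ => (γ - 1) * m * (x - 1) ^ 2 / 2)
        ((γ - 1) * m * (2 * (x - 1)) / 2) x := by
      have : HasDerivAt (fun x : ℝ => (x - 1) ^ 2) (2 * (x - 1)) x := by
        simpa using HasDerivAt.comp_sub_const x 1 (hasDerivAt_pow 2 (x - 1))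
      exact (this.const_mul _).div_const 2
    have e2 : HasDerivAt (fun x : ℝ => 1 + γ * (x - 1)) γ x := by
      simpa using (((hasDerivAt_id x).sub_const 1).const_mul γ).const_add 1
    have e3 := (Real.hasDerivAt_log hx.1.ne').const_mul γ
    refine (e1.sub (e3.sub (e2.log hx.2.1.ne'))).congr_deriv ?_
    have := hx.1.ne'; have := hx.2.1.ne'
    field_simp
    ring
  have hmpos : ∀ᶠ x in 𝓝 (1 : ℝ), 0 < m - γ / (x * (1 + γ * (x - 1))) := by
    filter_upwards [hev] with x hx
    have h1 := hx.2.2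
    rw [div_lt_iff₀ (by linarith)] at h1
    rw [sub_pos, div_lt_iff₀ (mul_pos hx.1 hx.2.1)]
    linarith
  have hmin : IsLocalMin h 1 := by
    refine isLocalMin_of_deriv hd.self_of_nhds.continuousAt
      (eventually_nhdsWithin_of_eventually_nhds (hd.mono fun x hx => hx.differentiableAt)) ?_ ?_
    · filter_upwards [eventually_nhdsWithin_of_eventually_nhds hd,
        eventually_nhdsWithin_of_eventually_nhds hmpos, self_mem_nhdsWithin] with x h1 h2 h3
      rw [h1.deriv]
      have h3 : x - 1 < 0 := sub_neg.2 h3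
      exact mul_nonpos_of_nonpos_of_nonneg
        (mul_nonpos_of_nonneg_of_nonpos (by linarith) h3.le) h2.le
    · filter_upwards [eventually_nhdsWithin_of_eventually_nhds hd,
        eventually_nhdsWithin_of_eventually_nhds hmpos, self_mem_nhdsWithin] with x h1 h2 h3
      rw [h1.deriv]
      have h3 : 0 < x - 1 := sub_pos.2 h3
      exact mul_nonneg (mul_nonneg (by linarith) h3.le) h2.le
  filter_upwards [hmin] with x hx
  simp only [h] at hx
  norm_num at hx
  linarith

/-- Here x and y are the ratios of horizontal velocities and temperatures of V to U, s is the ratio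
of mass fluxes of U to V, and d is a scaled transverse kinetic energy. The logarithms of s and of `b
* y` are bounded by their tangents at 1; what is left depends on x alone and is `h`. -/
theorem negEntropy_support_scalar {γ m x y s d : ℝ} (hγ : 1 < γ) (hx : 0 < x)
    (hb : 0 < 1 + γ * (x - 1)) (hy : 0 < y) (hs : 0 < s) (hd : 0 ≤ d)
    (h : γ * Real.log x - Real.log (1 + γ * (x - 1)) ≤ (γ - 1) * m * (x - 1) ^ 2 / 2) :
    (γ - 1) * (y / x - γ / (γ - 1) * (y - 1) - m * (x - 1) ^ 2 / 2 - d - s) ≤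
      -Real.log y - (γ - 1) * Real.log s - (γ - 1) * Real.log x := by
  have h1 : 0 < γ - 1 := by linarith
  obtain ⟨b, hbd⟩ : ∃ b, b = (1 + γ * (x - 1)) / x := ⟨_, rfl⟩
  have hb0 : 0 < b := by rw [hbd]; exact div_pos hb hx
  have h2 : Real.log s ≤ s - 1 := Real.log_le_sub_one_of_pos hs
  have h3 : Real.log (b * y) ≤ b * y - 1 := Real.log_le_sub_one_of_pos (mul_pos hb0 hy)
  rw [Real.log_mul hb0.ne' hy.ne'] at h3
  have h4 : Real.log b = Real.log (1 + γ * (x - 1)) - Real.log x := by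
    rw [hbd, Real.log_div hb.ne' hx.ne']
  have h5 : (γ - 1) * (y / x - γ / (γ - 1) * (y - 1) - m * (x - 1) ^ 2 / 2 - d - s) =
      -(b * y) + γ - (γ - 1) * m * (x - 1) ^ 2 / 2 - (γ - 1) * d - (γ - 1) * s := by
    rw [hbd]; field_simp; ring
  rw [h5]
  have := mul_le_mul_of_nonneg_left h2 h1.le
  have := mul_nonneg h1.le hd
  linarith

/-- The functional that turns variations of the fluxes into variations of the entropy. -/
def entropyCovector (γ : ℝ) (U : State) : (Fin 4 → ℝ) →L[ℝ] ℝ :=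
  let p (i : Fin 4) := ContinuousLinearMap.proj (R := ℝ) (φ := fun _ : Fin 4 => ℝ) i
  ((γ - 1) * (dens U / pres U)) • (velX U • p 1 + velY U • p 2 - p 3 -
    (velX U ^ 2 + velY U ^ 2 - totalEnthalpy γ U) • p 0)

theorem entropyCovector_apply (γ : ℝ) (U : State) (w : Fin 4 → ℝ) :
    entropyCovector γ U w = (γ - 1) * (dens U / pres U) * (velX U * w 1 + velY U * w 2 - w 3 -
      (velX U ^ 2 + velY U ^ 2 - totalEnthalpy γ U) * w 0) := rfl

/-- This is convexity of ρuS, with S the negative entropy, as a function of W near W(U), written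
with its supporting functional. The supersonicity of U enters through `eventually_log_le`, in the
direction of the horizontal velocity. -/
theorem entropyCovector_le {γ : ℝ} (hγ : 1 < γ) {U : State} (hU : U ∈ supersonicStates γ) :
    ∀ᶠ V in 𝓝 U, entropyCovector γ U (fluxX γ V - fluxX γ U) ≤
      fluxX γ V 0 * (negEntropy γ V - negEntropy γ U) := by
  obtain ⟨hc2, hc0⟩ := sonic_sq hγ hU
  have hr := hU.2.1
  have hp := hU.1
  have hu : 0 < velX U := hc0.trans hU.2.2
  have hm : γ < velX U ^ 2 * (dens U / pres U) := by
    have h1 : sonic γ U ^ 2 < velX U ^ 2 := pow_lt_pow_left₀ hU.2.2 hc0.le two_ne_zero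
    rw [hc2, div_lt_iff₀ hr] at h1
    rw [← mul_div_assoc, lt_div_iff₀ hp]
    exact h1
  have hx : ContinuousAt (fun V : State => velX V / velX U) U :=
    (continuous_apply 0).continuousAt.div_const _
  have hxt : Tendsto (fun V : State => velX V / velX U) (𝓝 U) (𝓝 1) := by
    have := hx.tendsto
    rwa [div_self hu.ne'] at this
  have hb : ∀ᶠ x in 𝓝 (1 : ℝ), 0 < 1 + γ * (x - 1) := by
    have hcont2 : ContinuousAt (fun x : ℝ => (1 + γ * (x - 1))) 1 := by fun_prop
    exact hcont2.tendsto.eventually_const_lt (u := 0) (by norm_num)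
  filter_upwards [isOpen_supersonicStates U hU, hxt.eventually hb,
    hxt.eventually (eventually_log_le hγ hm)] with V hV hb' hlog
  have hr' := hV.2.1
  have hp' := hV.1
  have hu' : 0 < velX V := (sonic_sq hγ hV).2.trans hV.2.2
  have key := negEntropy_support_scalar hγ (div_pos hu' hu) hb'
    (div_pos (div_pos hp' hr') (div_pos hp hr))
    (div_pos (mul_pos hr hu) (mul_pos hr' hu'))
    (div_nonneg (sq_nonneg (velY V - velY U)) (by positivity : 0 ≤ 2 * (pres U / dens U))) hlog
  have hlogs : negEntropy γ V - negEntropy γ U = -Real.log (pres V / dens V / (pres U / dens U)) -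
      (γ - 1) * Real.log (dens U * velX U / (dens V * velX V)) -
      (γ - 1) * Real.log (velX V / velX U) := by
    rw [Real.log_div (div_pos hp' hr').ne' (div_pos hp hr).ne', Real.log_div hp'.ne' hr'.ne',
      Real.log_div hp.ne' hr.ne', Real.log_div (mul_pos hr hu).ne' (mul_pos hr' hu').ne',
      Real.log_mul hr.ne' hu.ne', Real.log_mul hr'.ne' hu'.ne', Real.log_div hu'.ne' hu.ne']
    simp only [negEntropy]
    ring
  rw [← hlogs] at key
  have hf : 0 < fluxX γ V 0 := mul_pos hr' hu'
  refine le_trans (le_of_eq ?_) (mul_le_mul_of_nonneg_left key hf.le)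
  rw [entropyCovector_apply]
  simp only [fluxX, totalEnthalpy, Matrix.cons_val, Pi.sub_apply]
  have h1 : γ - 1 ≠ 0 := by linarith
  field_simp
  ring

/-- The combination of the y-fluxes given by the covector is ρv dS, which expresses transport of the
entropy by smooth flows. Both sides are compared on each direction `e` by differentiating along U +
t e. -/
theorem entropyCovector_fluxY {γ : ℝ} (hγ : 1 < γ) {U : State} (hU : U ∈ supersonicStates γ) :
    fluxY γ U 0 • fderiv ℝ (negEntropy γ) U =
      (entropyCovector γ U).comp (fderiv ℝ (fluxY γ) U) := by
  have hr := hU.2.1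
  have hp := hU.1
  have h1 : γ - 1 ≠ 0 := by linarith
  obtain ⟨hcu, hcv, hcp, hcr⟩ := contDiffAt_components (n := 1) U
  have hds : DifferentiableAt ℝ (negEntropy γ) U :=
    ((contDiffAt_const.mul (hcr.log hr.ne')).sub (hcp.log hp.ne')).differentiableAt (by norm_num)
  have hdY := (contDiffAt_fluxY (n := 1) hγ hU.2.1).differentiableAt (by norm_num)
  ext e
  have hl : ∀ i, HasDerivAt (fun t : ℝ => (U + t • e) i) (e i) 0 := fun i => by
    simpa using ((hasDerivAt_id (0 : ℝ)).mul_const (e i)).const_add (U i)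
  have hu : HasDerivAt (fun t : ℝ => velX (U + t • e)) (e 0) 0 := hl 0
  have hv : HasDerivAt (fun t : ℝ => velY (U + t • e)) (e 1) 0 := hl 1
  have hpr : HasDerivAt (fun t : ℝ => pres (U + t • e)) (e 2) 0 := hl 2
  have hrh : HasDerivAt (fun t : ℝ => dens (U + t • e)) (e 3) 0 := hl 3
  have h0 : U + (0 : ℝ) • e = U := by simp
  have hs : HasDerivAt (fun t : ℝ => negEntropy γ (U + t • e))
      (γ * (e 3 / dens U) - e 2 / pres U) 0 := by
    have := ((hrh.log (by rw [h0]; exact hr.ne')).const_mul γ).sub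
      (hpr.log (by rw [h0]; exact hp.ne'))
    rw [h0] at this
    exact this
  have hB : HasDerivAt (fun t : ℝ => totalEnthalpy γ (U + t • e))
      (γ / (γ - 1) * (e 2 / dens U - pres U * e 3 / dens U ^ 2) +
        (velX U * e 0 + velY U * e 1)) 0 := by
    have := ((hpr.const_mul γ).div (hrh.const_mul (γ - 1))
      (by rw [h0]; exact mul_ne_zero h1 hr.ne')).add (((hu.pow 2).add (hv.pow 2)).div_const 2)
    rw [h0] at this
    refine this.congr_deriv ?_
    field_simp
    ring
  have hY : HasDerivAt (fun t : ℝ => fluxY γ (U + t • e))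
      ![e 3 * velY U + dens U * e 1,
        (e 3 * velX U + dens U * e 0) * velY U + dens U * velX U * e 1,
        e 3 * velY U ^ 2 + dens U * (2 * velY U * e 1) + e 2,
        (e 3 * velY U + dens U * e 1) * totalEnthalpy γ U + dens U * velY U *
        (γ / (γ - 1) * (e 2 / dens U - pres U * e 3 / dens U ^ 2) +
        (velX U * e 0 + velY U * e 1))] 0 := by
    rw [hasDerivAt_pi]
    intro i
    fin_cases i
    · have := hrh.mul hv
      rw [h0] at this
      exact this
    · have := (hrh.mul hu).mul hv
      simp only [Pi.mul_apply] at this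
      rw [h0] at this
      exact this
    · have := (hrh.mul (hv.pow 2)).add hpr
      simp only [Pi.pow_apply] at this
      rw [h0] at this
      refine this.congr_deriv ?_
      simp
    · have := (hrh.mul hv).mul hB
      simp only [Pi.mul_apply] at this
      rw [h0] at this
      exact this
  have e1 : fderiv ℝ (negEntropy γ) U e = γ * (e 3 / dens U) - e 2 / pres U := by
    rw [← hds.lineDeriv_eq_fderiv]; exact hs.deriv
  have e3 : fderiv ℝ (fluxY γ) U e = deriv (fun t : ℝ => fluxY γ (U + t • e)) 0 :=
    hdY.lineDeriv_eq_fderiv.symm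
  rw [hY.deriv] at e3
  show fluxY γ U 0 * fderiv ℝ (negEntropy γ) U e =
    entropyCovector γ U (fderiv ℝ (fluxY γ) U e)
  rw [e1, e3, entropyCovector_apply]
  simp only [Matrix.cons_val, fluxY, totalEnthalpy]
  field_simp
  ring

/-- The positive part detects an entropy below the reference value, and the cube makes it twice
continuously differentiable. The function must be nondecreasing, because `entropyCovector_le` is
one-sided. -/
theorem isConvexEntropyPair_negEntropy {γ : ℝ} (hγ : 1 < γ) (b : ℝ) :
    IsConvexEntropyPair γ
      ((fun U => fluxX γ U 0 * max (negEntropy γ U - b) 0 ^ 3) ∘ fluxInv γ)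
      ((fun U => fluxY γ U 0 * max (negEntropy γ U - b) 0 ^ 3) ∘ fluxInv γ) := by
  have hd : ∀ s, HasDerivAt (fun s : ℝ => max (s - b) 0 ^ 3) (3 * max (s - b) 0 ^ 2) s := by
    intro s
    have h1 := hasDerivAt_max_pow 1 (s - b)
    norm_num at h1
    simpa using HasDerivAt.comp_sub_const s b h1
  refine isConvexEntropyPair_transport hγ (f := fun s => max (s - b) 0 ^ 3)
    (fun U hU => ?_) (contDiff_max_cube.comp (contDiff_id.sub contDiff_const))
    (fun s t => ?_) fun U hU => ⟨entropyCovector γ U, ?_, entropyCovector_fluxY hγ hU⟩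
  · obtain ⟨-, -, hcp, hcr⟩ := contDiffAt_components (n := 2) U
    exact (contDiffAt_const.mul (hcr.log hU.2.1.ne')).sub (hcp.log hU.1.ne')
  · rw [(hd s).deriv]
    rcases le_total (s - b) 0 with h | h
    · rw [max_eq_right h]; simp
    · rw [max_eq_left h]
      have h1 : t - b ≤ max (t - b) 0 := le_max_left _ _
      have h2 : 0 ≤ max (t - b) 0 := le_max_right _ _
      have h3 := mul_le_mul_of_nonneg_left h1 (sq_nonneg (s - b))
      have h4 := mul_nonneg (sq_nonneg (max (t - b) 0 - (s - b))) (by linarith :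
        0 ≤ max (t - b) 0 + 2 * (s - b))
      linarith
  · filter_upwards [entropyCovector_le hγ hU] with V hV
    apply mul_le_mul_of_nonneg_left hV
    rw [(hd _).deriv]
    positivity

/-! ### The rarefaction wave attached to the wall -/

/-- A concave Lipschitz wall, flat upstream, that turns the flow by less than the critical angle. -/
structure Wall (G : Upstream) (g : ℝ → ℝ) (K : NNReal) : Prop where
  lip : LipschitzWith K g
  flat : ∀ x ≤ 0, g x = 0
  diff : ∀ x > 0, DifferentiableWithinAt ℝ g (Ioi x) x
  anti : AntitoneOn (wallSlope g) (Ioi 0)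
  angle : ∀ x > 0, Real.arctan (wallSlope g x) ∈ Ioo (thetaCrit G.γ G.state₀) 0

/-- The slope of the wall, set to zero upstream. -/
def wallW (g : ℝ → ℝ) (t : ℝ) : ℝ := if 0 < t then wallSlope g t else 0

theorem wallW_of_pos {g : ℝ → ℝ} {t : ℝ} (h : 0 < t) : wallW g t = wallSlope g t := if_pos h

theorem wallW_of_nonpos {g : ℝ → ℝ} {t : ℝ} (h : t ≤ 0) : wallW g t = 0 := if_neg h.not_gt

open Classical in
/-- The angle of the characteristic issuing from the wall at `t`. -/
def turn (G : Upstream) (g : ℝ → ℝ) (t : ℝ) : ℝ :=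
  if h : ∃ α ∈ G.arc, G.slope α = wallW g t then h.choose else G.mach₀

/-- The slope of the characteristic issuing from the wall at `t`. -/
def wallSpeed (G : Upstream) (g : ℝ → ℝ) (t : ℝ) : ℝ := Real.tan (turn G g t)

namespace Wall

variable {G : Upstream} {g : ℝ → ℝ} {K : NNReal}

theorem slope_neg (W : Wall G g K) {t : ℝ} (ht : 0 < t) : wallW g t < 0 := by
  have := (W.angle t ht).2
  rw [← Real.arctan_zero] at this
  rw [wallW_of_pos ht]
  exact Real.arctan_strictMono.lt_iff_lt.1 this

theorem slope_nonpos (W : Wall G g K) (t : ℝ) : wallW g t ≤ 0 := by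
  rcases le_or_gt t 0 with h | h
  · exact (wallW_of_nonpos h).le
  · exact (W.slope_neg h).le

theorem slope_antitone (W : Wall G g K) : Antitone (wallW g) := by
  intro a b hab
  rcases le_or_gt a 0 with h | h
  · rw [wallW_of_nonpos h]; exact W.slope_nonpos b
  · rw [wallW_of_pos h, wallW_of_pos (h.trans_le hab)]
    exact W.anti h (h.trans_le hab) hab

theorem measurable_slope (W : Wall G g K) : Measurable (wallW g) := W.slope_antitone.measurable

/-- The default value in `turn` is never used: for t ≤ 0 the Mach angle itself solves the equation,
and for t > 0 the angle condition of the wall provides a solution. -/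
theorem turn_spec (W : Wall G g K) (t : ℝ) :
    turn G g t ∈ G.arc ∧ G.slope (turn G g t) = wallW g t := by
  have h : ∃ α ∈ G.arc, G.slope α = wallW g t := by
    rcases le_or_gt t 0 with h | h
    · exact ⟨G.mach₀, G.mach₀_mem_arc, by rw [wallW_of_nonpos h, G.slope_mach₀]⟩
    · rw [wallW_of_pos h]; exact Upstream.exists_turn (W.angle t h)
  rw [turn, dif_pos h]
  exact h.choose_spec

theorem turn_le_iff (W : Wall G g K) {t α : ℝ} (hα : α ∈ G.arc) :
    turn G g t ≤ α ↔ wallW g t ≤ G.slope α := by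
  rw [← (W.turn_spec t).2]
  exact (Upstream.slope_strictMonoOn.le_iff_le (W.turn_spec t).1 hα).symm

theorem le_turn_iff (W : Wall G g K) {t α : ℝ} (hα : α ∈ G.arc) :
    α ≤ turn G g t ↔ G.slope α ≤ wallW g t := by
  rw [← (W.turn_spec t).2]
  exact (Upstream.slope_strictMonoOn.le_iff_le hα (W.turn_spec t).1).symm

theorem turn_antitone (W : Wall G g K) : Antitone (turn G g) := fun a b hab => by
  rw [W.turn_le_iff (W.turn_spec a).1, (W.turn_spec a).2]
  exact W.slope_antitone hab

theorem turn_of_nonpos (W : Wall G g K) {t : ℝ} (ht : t ≤ 0) : turn G g t = G.mach₀ :=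
  le_antisymm (W.turn_spec t).1.2.1 <| by
    rw [W.le_turn_iff G.mach₀_mem_arc, wallW_of_nonpos ht, G.slope_mach₀]

theorem turn_of_pos (W : Wall G g K) {t : ℝ} (ht : 0 < t) : turn G g t < G.mach₀ := by
  by_contra! h
  rw [W.le_turn_iff G.mach₀_mem_arc, G.slope_mach₀] at h
  linarith [W.slope_neg ht]

theorem arc_subset : G.arc ⊆ Ioo (-(Real.pi / 2)) (Real.pi / 2) := fun _ h =>
  ⟨h.1, h.2.1.trans_lt G.mach₀_lt⟩

/-- Comparison of `g` with the lines of slopes w(b) and w(a), through the mean value inequality for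
right derivatives. -/
theorem concave_of_pos (W : Wall G g K) {a b : ℝ} (ha : 0 < a) (hab : a < b) :
    wallW g b * (b - a) ≤ g b - g a ∧ g b - g a ≤ wallW g a * (b - a) := by
  have hd : ∀ x ∈ Ico a b, HasDerivWithinAt g (wallW g x) (Ici x) x := by
    intro x hx
    have hx0 : 0 < x := ha.trans_le hx.1
    rw [wallW_of_pos hx0, ← hasDerivWithinAt_Ioi_iff_Ici]
    exact (W.diff x hx0).hasDerivWithinAt
  have hlin : ∀ m x : ℝ, HasDerivWithinAt (fun x => g a + m * (x - a)) m (Ici x) x := by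
    intro m x
    simpa using (((hasDerivAt_id x).sub_const a).const_mul m).const_add (g a) |>.hasDerivWithinAt
  have hc : ∀ m : ℝ, Continuous fun x => g a + m * (x - a) := fun m => by fun_prop
  have hb : b ∈ Icc a b := right_mem_Icc.2 hab.le
  constructor
  · have := image_le_of_deriv_right_le_deriv_boundary (hc (wallW g b)).continuousOn
      (fun x _ => hlin (wallW g b) x) (by simp) W.lip.continuous.continuousOn hd
      (fun x hx => W.slope_antitone hx.2.le) hb
    linarith
  · have := image_le_of_deriv_right_le_deriv_boundary W.lip.continuous.continuousOn hd
      (by simp) (hc (wallW g a)).continuousOn (fun x _ => hlin (wallW g a) x)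
      (fun x hx => W.slope_antitone hx.1) hb
    linarith

theorem concave (W : Wall G g K) (a b : ℝ) (hab : a < b) :
    wallW g b * (b - a) ≤ g b - g a ∧ g b - g a ≤ wallW g a * (b - a) := by
  rcases le_or_gt b 0 with hb | hb
  · simp [wallW_of_nonpos hb, wallW_of_nonpos (hab.le.trans hb), W.flat b hb,
      W.flat a (hab.le.trans hb)]
  rcases lt_or_ge 0 a with ha | ha
  · exact W.concave_of_pos ha hab
  have hg := W.lip.continuous
  have h0 : g 0 = 0 := W.flat 0 le_rfl
  have hev : Ioo (0 : ℝ) b ∈ 𝓝[>] 0 := Ioo_mem_nhdsGT hb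
  have ht1 : Tendsto (fun s => g b - g s) (𝓝[>] 0) (𝓝 (g b - g 0)) :=
    (continuous_const.sub hg).continuousAt.tendsto.mono_left nhdsWithin_le_nhds
  have ht2 : Tendsto (fun s => wallW g b * (b - s)) (𝓝[>] 0) (𝓝 (wallW g b * (b - 0))) :=
    (continuous_const.mul (continuous_const.sub continuous_id)).continuousAt.tendsto.mono_left
      nhdsWithin_le_nhds
  rw [wallW_of_nonpos ha, W.flat a ha]
  constructor
  · have h1 : wallW g b * (b - 0) ≤ g b - g 0 := by
      refine le_of_tendsto_of_tendsto ht2 ht1 ?_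
      filter_upwards [hev] with s hs using (W.concave_of_pos hs.1 hs.2).1
    have := mul_nonneg_of_nonpos_of_nonpos (W.slope_nonpos b) ha
    rw [h0] at h1
    linarith
  · have h1 : g b - g 0 ≤ 0 := by
      refine le_of_tendsto ht1 ?_
      filter_upwards [hev] with s hs
      exact (W.concave_of_pos hs.1 hs.2).2.trans
        (mul_nonpos_of_nonpos_of_nonneg (W.slope_nonpos s) (by linarith [hs.2]))
    rw [h0] at h1
    linarith

theorem fanData (W : Wall G g K) :
    FanData g (wallW g) (wallSpeed G g) (Real.tan G.mach₀) K where
  lip := W.lip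
  concave := W.concave
  flat := W.flat
  anti := fun a b hab => by
    exact Real.strictMonoOn_tan.monotoneOn (arc_subset (W.turn_spec b).1)
      (arc_subset (W.turn_spec a).1) (W.turn_antitone hab)
  slope_lt := fun t => by
    rw [← (W.turn_spec t).2]
    exact Upstream.slope_lt_tan (W.turn_spec t).1
  speed_flat := fun t ht => by rw [wallSpeed, W.turn_of_nonpos ht]
  speed_lt := fun t ht => Real.strictMonoOn_tan (arc_subset (W.turn_spec t).1)
    (arc_subset G.mach₀_mem_arc) (W.turn_of_pos ht)
  pos := Real.tan_pos_of_pos_of_lt_pi_div_two G.mach₀_pos G.mach₀_lt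

theorem ae_hasDerivAt (W : Wall G g K) : ∀ᵐ x, HasDerivAt g (wallW g x) x := by
  have h0 : ∀ᵐ x : ℝ, x ≠ 0 := by simp [ae_iff, measure_singleton]
  filter_upwards [W.lip.ae_differentiableAt, h0] with x hx hx0
  rcases lt_or_gt_of_ne hx0 with h | h
  · rw [wallW_of_nonpos h.le]
    refine (hasDerivAt_const x (0 : ℝ)).congr_of_eventuallyEq ?_
    filter_upwards [gt_mem_nhds h] with y hy using W.flat y hy.le
  · rw [wallW_of_pos h, wallSlope, hx.hasDerivAt.hasDerivWithinAt.derivWithin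
      (uniqueDiffWithinAt_Ioi x)]
    exact hx.hasDerivAt

end Wall

/-- The angle of the characteristic through `z`. -/
def fanAngle (G : Upstream) (g : ℝ → ℝ) (z : ℝ × ℝ) : ℝ :=
  Real.arctan (fanSpeed g (wallSpeed G g) z)

/-- The rarefaction wave that issues from the wall. -/
def fanState (G : Upstream) (g : ℝ → ℝ) (z : ℝ × ℝ) : State := G.state (fanAngle G g z)

theorem flowDomain_eq (g : ℝ → ℝ) : flowDomain g = {z | 0 < z.1} ∩ above g := rfl

theorem flowDomain_subset (g : ℝ → ℝ) : flowDomain g ⊆ above g := inter_subset_right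

theorem isOpen_flowDomain {g : ℝ → ℝ} (hg : Continuous g) : IsOpen (flowDomain g) :=
  (isOpen_lt continuous_const continuous_fst).inter (isOpen_above hg)

namespace Wall

variable {G : Upstream} {g : ℝ → ℝ} {K : NNReal}

theorem arctan_speed (W : Wall G g K) (t : ℝ) : Real.arctan (wallSpeed G g t) = turn G g t :=
  Real.arctan_tan (arc_subset (W.turn_spec t).1).1 (arc_subset (W.turn_spec t).1).2

theorem arctan_tan_mach₀ : Real.arctan (Real.tan G.mach₀) = G.mach₀ :=
  Real.arctan_tan (arc_subset G.mach₀_mem_arc).1 (arc_subset G.mach₀_mem_arc).2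

theorem arctan_mem_arc (W : Wall G g K) {t l : ℝ} (h1 : wallSpeed G g t ≤ l)
    (h2 : l ≤ Real.tan G.mach₀) : turn G g t ≤ Real.arctan l ∧ Real.arctan l ≤ G.mach₀ ∧
      Real.arctan l ∈ G.arc := by
  have h3 : turn G g t ≤ Real.arctan l := by
    rw [← W.arctan_speed]; exact Real.arctan_strictMono.monotone h1
  have h4 : Real.arctan l ≤ G.mach₀ := by
    rw [← arctan_tan_mach₀]; exact Real.arctan_strictMono.monotone h2
  exact ⟨h3, h4, Upstream.arc_upward (W.turn_spec t).1 h3 h4⟩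

theorem fanAngle_mem (W : Wall G g K) {z : ℝ × ℝ} (hz : z ∈ above g) :
    turn G g z.1 ≤ fanAngle G g z ∧ fanAngle G g z ≤ G.mach₀ ∧ fanAngle G g z ∈ G.arc :=
  W.arctan_mem_arc (W.fanData.le_fanSpeed hz) (W.fanData.fanSpeed_le hz)

theorem fanState_of_nonpos (W : Wall G g K) {z : ℝ × ℝ} (hz : z ∈ above g) (h : z.1 ≤ 0) :
    fanState G g z = G.state₀ := by
  have h1 : g z.1 < z.2 := hz
  rw [W.flat _ h] at h1
  have : fanSpeed g (wallSpeed G g) z = Real.tan G.mach₀ := by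
    apply W.fanData.fanSpeed_upstream hz
    have := mul_nonneg W.fanData.pos.le (neg_nonneg.2 h)
    linarith
  rw [fanState, fanAngle, this, arctan_tan_mach₀, G.state_mach₀]

/-- Near a compact subset of the domain the speed coincides with a Lipschitz function. -/
theorem exists_lipschitz_speed (W : Wall G g K) {S : Set (ℝ × ℝ)} (hS : IsCompact S)
    (hSg : S ⊆ above g) : ∃ (C : NNReal) (l : ℝ × ℝ → ℝ) (O : Set (ℝ × ℝ)) (X : ℝ),
      LipschitzWith C l ∧ IsOpen O ∧ S ⊆ O ∧ O ⊆ above g ∧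
      EqOn l (fanSpeed g (wallSpeed G g)) O ∧
      ∀ z, wallSpeed G g X ≤ l z ∧ l z ≤ Real.tan G.mach₀ := by
  have hg := W.lip.continuous
  obtain ⟨X, hX⟩ : ∃ X, ∀ z ∈ S, z.1 < X := by
    obtain ⟨X, hX⟩ := (hS.image continuous_fst).bddAbove
    exact ⟨X + 1, fun z hz => (hX (mem_image_of_mem _ hz)).trans_lt (by linarith)⟩
  obtain ⟨δ, hδ, hSδ⟩ : ∃ δ > 0, ∀ z ∈ S, g z.1 + δ < z.2 := by
    rcases S.eq_empty_or_nonempty with rfl | hne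
    · exact ⟨1, one_pos, by simp⟩
    · obtain ⟨z₀, hz₀, hmin⟩ := hS.exists_isMinOn hne
        (f := fun z : ℝ × ℝ => z.2 - g z.1) (by fun_prop)
      have h1 : g z₀.1 < z₀.2 := hSg hz₀
      refine ⟨(z₀.2 - g z₀.1) / 2, by linarith, fun z hz => ?_⟩
      have : z₀.2 - g z₀.1 ≤ z.2 - g z.1 := hmin hz
      linarith
  obtain ⟨C, hC⟩ := W.fanData.fanSpeed_lipschitzOn X hδ
  obtain ⟨l, hl, heq⟩ := hC.extend_real
  have hsub : {z : ℝ × ℝ | z.1 < X ∧ g z.1 + δ < z.2} ⊆ above g := fun z hz => by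
    have : g z.1 + δ < z.2 := hz.2
    show g z.1 < z.2
    linarith
  -- Truncating the Lipschitz extension keeps the angles in a compact part of the arc everywhere,
  -- also outside the open set where it agrees with the speed.
  refine ⟨C, fun z => max (wallSpeed G g X) (min (Real.tan G.mach₀) (l z)),
    {z | z.1 < X ∧ g z.1 + δ < z.2}, X, ?_, ?_, fun z hz => ⟨hX z hz, hSδ z hz⟩, hsub, ?_, ?_⟩
  · simpa using (hl.const_min _).const_max _
  · exact (isOpen_lt continuous_fst continuous_const).inter
      (isOpen_lt (by fun_prop) continuous_snd)
  · intro z hz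
    have h1 : fanSpeed g (wallSpeed G g) z = l z := heq ⟨hz.1.le, hz.2.le⟩
    have h2 := W.fanData.fanSpeed_le (hsub hz)
    have h3 := (W.fanData.anti hz.1.le).trans (W.fanData.le_fanSpeed (hsub hz))
    rw [h1] at h2 h3
    simp only
    rw [min_eq_right h2, max_eq_right h3, h1]
  · intro z
    exact ⟨le_max_left _ _, max_le (W.fanData.le_speed X) (min_le_left _ _)⟩

theorem continuousOn_fanSpeed (W : Wall G g K) :
    ContinuousOn (fanSpeed g (wallSpeed G g)) (above g) := by
  intro z hz
  obtain ⟨C, l, O, X, hl, hO, hSO, -, heq, -⟩ :=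
    W.exists_lipschitz_speed (isCompact_singleton (x := z)) (by simpa using hz)
  have hzO : O ∈ 𝓝 z := hO.mem_nhds (hSO rfl)
  exact ((hl.continuous.continuousAt).congr (heq.eventuallyEq_of_mem hzO)).continuousWithinAt

theorem continuousOn_state : ContinuousOn G.state G.arc := fun _ h =>
  (G.hasDerivAt_state (Upstream.arc_snd_pos h)).continuousAt.continuousWithinAt

theorem continuousOn_fanState (W : Wall G g K) : ContinuousOn (fanState G g) (above g) :=
  continuousOn_state.comp
    (Real.continuous_arctan.comp_continuousOn W.continuousOn_fanSpeed)
    fun _ hz => (W.fanAngle_mem hz).2.2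

theorem measurableSet_above (W : Wall G g K) : MeasurableSet (above g) :=
  (isOpen_above W.lip.continuous).measurableSet

theorem aestronglyMeasurable_fanState (W : Wall G g K) :
    AEStronglyMeasurable (fanState G g) (volume.restrict (above g)) :=
  W.continuousOn_fanState.aestronglyMeasurable W.measurableSet_above

theorem compact_range_fanState (W : Wall G g K) (R : ℝ) :
    ∃ S ⊆ supersonicStates G.γ, IsCompact S ∧
      ∀ z ∈ above g, z.1 ≤ R → fanState G g z ∈ S := by
  have hsub : Icc (turn G g R) G.mach₀ ⊆ G.arc := fun α hα =>
    Upstream.arc_upward (W.turn_spec R).1 hα.1 hα.2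
  refine ⟨G.state '' Icc (turn G g R) G.mach₀, ?_,
    isCompact_Icc.image_of_continuousOn (continuousOn_state.mono hsub), fun z hz hzR => ?_⟩
  · rintro _ ⟨α, hα, rfl⟩
    exact Upstream.state_supersonic (hsub hα)
  · have := W.fanAngle_mem hz
    exact mem_image_of_mem _ ⟨(W.turn_antitone hzR).trans this.1, this.2.1⟩

theorem lambda5_state₀ : lambda5 G.γ G.state₀ = Real.tan G.mach₀ := by
  rw [← G.state_mach₀, Upstream.lambda5_state G.mach₀_mem_arc]

theorem region_fanState (W : Wall G g K) {z : ℝ × ℝ} (hz : z ∈ above g) :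
    fanState G g z ∈ region G.γ G.state₀ := by
  rw [Upstream.region_state₀]
  exact Upstream.region_state (W.fanAngle_mem hz).2.2

theorem lambda5_fanState (W : Wall G g K) {z : ℝ × ℝ} (hz : z ∈ above g) :
    lambda5 G.γ (fanState G g z) = fanSpeed g (wallSpeed G g) z := by
  rw [fanState, Upstream.lambda5_state (W.fanAngle_mem hz).2.2, fanAngle, Real.tan_arctan]

theorem connects (W : Wall G g K) : ConnectsByRarefaction G.γ g G.state₀ (fanState G g) where
  continuousOn := W.continuousOn_fanState.mono (flowDomain_subset g)
  upstream := fun z hz hle => by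
    rw [lambda5_state₀] at hle
    rw [fanState, fanAngle, W.fanData.fanSpeed_upstream hz.2 hle, arctan_tan_mach₀, G.state_mach₀]
  wave := fun z hz hlt => by
    have hza : z ∈ above g := hz.2
    rw [lambda5_state₀] at hlt
    obtain ⟨t, ht⟩ := W.fanData.exists_ray hza
    obtain ⟨ht0, hl⟩ := W.fanData.fanSpeed_wave ht hlt
    refine ⟨Upstream.state_mem_rarefaction5 (W.fanAngle_mem hza).2.2 ?_, t, ⟨ht0, ht.1⟩, ?_, ?_⟩
    · rw [← arctan_tan_mach₀]
      exact Real.arctan_strictMono hl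
    · rw [W.lambda5_fanState hza]; exact ht.2.1
    · intro x hx
      rw [W.lambda5_fanState hza]
      have h1 := FanData.onRay_forward ht hx
      refine ⟨⟨ht0.trans_lt hx, W.fanData.ray_mem h1⟩, ?_⟩
      rw [fanState, fanState, fanAngle, fanAngle, W.fanData.fanSpeed_eq h1]

end Wall

/-! ### Integration by parts and the contribution of the upstream half plane -/

/-- Integration by parts for Lipschitz functions. -/
theorem integral_mul_fderiv {f χ : ℝ × ℝ → ℝ} {C D : NNReal} (hf : LipschitzWith C f)
    (hχ : LipschitzWith D χ) (hc : HasCompactSupport χ) (v : ℝ × ℝ) :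
    ∫ z, f z * fderiv ℝ χ z v = -∫ z, fderiv ℝ f z v * χ z := by
  have h := LipschitzWith.integral_lineDeriv_mul_eq (μ := volume) hf hχ hc v
  have e1 : ∫ z, lineDeriv ℝ f z v * χ z = ∫ z, fderiv ℝ f z v * χ z := by
    apply integral_congr_ae
    filter_upwards [hf.ae_differentiableAt (μ := volume)] with z hz
    rw [hz.lineDeriv_eq_fderiv]
  have e2 : ∫ z, lineDeriv ℝ χ z (-v) * f z = -∫ z, f z * fderiv ℝ χ z v := by
    rw [← integral_neg]
    apply integral_congr_ae
    filter_upwards [hχ.ae_differentiableAt (μ := volume)] with z hz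
    rw [hz.lineDeriv_eq_fderiv, map_neg]
    ring
  rw [e1, e2] at h
  linarith

theorem lipschitz_of_smooth {ψ : ℝ × ℝ → ℝ} (h : ContDiff ℝ ∞ ψ) (hc : HasCompactSupport ψ) :
    ∃ C, LipschitzWith C ψ :=
  (h.of_le (by norm_cast) : ContDiff ℝ 1 ψ).lipschitzWith_of_hasCompactSupport hc
    one_ne_zero

theorem integral_fderiv_snd_eq_zero {ψ : ℝ × ℝ → ℝ} (h : ContDiff ℝ ∞ ψ)
    (hc : HasCompactSupport ψ) (x : ℝ) : ∫ y, fderiv ℝ ψ (x, y) (0, 1) = 0 := by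
  have hd : ∀ y, HasDerivAt (fun y => ψ (x, y)) (fderiv ℝ ψ (x, y) (0, 1)) y := fun y =>
    ((h.differentiable (by simp)) (x, y)).hasFDerivAt.comp_hasDerivAt y
      ((hasDerivAt_const y x).prodMk (hasDerivAt_id y))
  have hsm : ContDiff ℝ 1 fun y => ψ (x, y) :=
    (h.of_le (by norm_cast) : ContDiff ℝ 1 ψ).comp (contDiff_prodMk_right x)
  have hcs : HasCompactSupport fun y => ψ (x, y) :=
    hc.comp_isClosedEmbedding ⟨isEmbedding_prodMkRight x, by
      have : range (Prod.mk x : ℝ → ℝ × ℝ) = {z | z.1 = x} := by ext ⟨a, b⟩; simp [eq_comm]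
      rw [this]
      exact isClosed_eq continuous_fst continuous_const⟩
  have h1 := hcs.integral_Iic_deriv_eq hsm 0
  have h2 := hcs.integral_Ioi_deriv_eq hsm 0
  have h3 : Integrable (deriv fun y => ψ (x, y)) :=
    (hsm.continuous_deriv le_rfl).integrable_of_hasCompactSupport hcs.deriv
  have h4 := setIntegral_union (Iic_disjoint_Ioi (le_refl (0 : ℝ))) measurableSet_Ioi
    h3.integrableOn h3.integrableOn
  rw [Iic_union_Ioi, setIntegral_univ, h1, h2] at h4
  rw [show (fun y => fderiv ℝ ψ (x, y) (0, 1)) = deriv fun y => ψ (x, y) from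
    funext fun y => (hd y).deriv.symm, h4]
  ring

theorem integral_fderiv_fst_Iic {ψ : ℝ × ℝ → ℝ} (h : ContDiff ℝ ∞ ψ)
    (hc : HasCompactSupport ψ) (y : ℝ) : ∫ x in Iic 0, fderiv ℝ ψ (x, y) (1, 0) = ψ (0, y) := by
  have hd : ∀ x, HasDerivAt (fun x => ψ (x, y)) (fderiv ℝ ψ (x, y) (1, 0)) x := fun x =>
    ((h.differentiable (by simp)) (x, y)).hasFDerivAt.comp_hasDerivAt x
      ((hasDerivAt_id x).prodMk (hasDerivAt_const x y))
  have hsm : ContDiff ℝ 1 fun x => ψ (x, y) :=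
    (h.of_le (by norm_cast) : ContDiff ℝ 1 ψ).comp (contDiff_prodMk_left y)
  have hcs : HasCompactSupport fun x => ψ (x, y) :=
    hc.comp_isClosedEmbedding ⟨isEmbedding_prodMkLeft y, by
      have : range (fun x : ℝ => (x, y)) = {z | z.2 = y} := by ext ⟨a, b⟩; simp [eq_comm]
      rw [this]
      exact isClosed_eq continuous_snd continuous_const⟩
  rw [show (fun x => fderiv ℝ ψ (x, y) (1, 0)) = deriv fun x => ψ (x, y) from
    funext fun x => (hd x).deriv.symm]
  exact hcs.integral_Iic_deriv_eq hsm 0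

theorem integrable_fderiv {ψ : ℝ × ℝ → ℝ} (h : ContDiff ℝ ∞ ψ)
    (hc : HasCompactSupport ψ) (v : ℝ × ℝ) : Integrable fun z => fderiv ℝ ψ z v := by
  have hcont : Continuous fun z => fderiv ℝ ψ z v :=
    (h.continuous_fderiv (by simp)).clm_apply continuous_const
  exact hcont.integrable_of_hasCompactSupport
    (hc.fderiv_apply (𝕜 := ℝ) v)

/-- The contribution of the upstream half plane, where the state is constant. -/
theorem integral_halfPlane {ψ : ℝ × ℝ → ℝ} (h : ContDiff ℝ ∞ ψ) (hc : HasCompactSupport ψ)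
    (a b : ℝ) : ∫ z in {z : ℝ × ℝ | z.1 ≤ 0},
      (a * fderiv ℝ ψ z (1, 0) + b * fderiv ℝ ψ z (0, 1)) = a * ∫ y, ψ (0, y) := by
  have hset : {z : ℝ × ℝ | z.1 ≤ 0} = Iic 0 ×ˢ univ := by ext z; simp
  have i1 := integrable_fderiv h hc (1, 0)
  have i2 := integrable_fderiv h hc (0, 1)
  rw [integral_add (i1.const_mul a).integrableOn (i2.const_mul b).integrableOn,
    integral_const_mul, integral_const_mul, hset]
  have e2 : ∫ z in Iic (0 : ℝ) ×ˢ (univ : Set ℝ), fderiv ℝ ψ z (0, 1) = 0 := by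
    rw [Measure.volume_eq_prod, setIntegral_prod _ (by
      rw [← Measure.volume_eq_prod]; exact i2.integrableOn)]
    simp [integral_fderiv_snd_eq_zero h hc]
  have e1 : ∫ z in Iic (0 : ℝ) ×ˢ (univ : Set ℝ), fderiv ℝ ψ z (1, 0) = ∫ y, ψ (0, y) := by
    rw [Measure.volume_eq_prod, ← Measure.prod_restrict, integral_prod_symm _ (by
      rw [Measure.prod_restrict, ← Measure.volume_eq_prod]; exact i1.integrableOn)]
    simp [integral_fderiv_fst_Iic h hc]
  rw [e1, e2]
  ring

/-- Extending by the upstream state turns the initial condition into a weak form on the whole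
region above the wall. -/
theorem integral_above_eq {g : ℝ → ℝ} (hg : Continuous g) (hg0 : ∀ x ≤ 0, g x = 0)
    {ψ : ℝ × ℝ → ℝ} (h : ContDiff ℝ ∞ ψ) (hc : HasCompactSupport ψ)
    (hs : tsupport ψ ⊆ above g) {a b : ℝ} {E F : ℝ × ℝ → ℝ}
    (hE : ∀ z ∈ above g, z.1 ≤ 0 → E z = a ∧ F z = b)
    (hint : IntegrableOn (fun z => E z * fderiv ℝ ψ z (1, 0) + F z * fderiv ℝ ψ z (0, 1))
      (above g)) :
    ∫ z in above g, (E z * fderiv ℝ ψ z (1, 0) + F z * fderiv ℝ ψ z (0, 1)) =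
      (∫ z in flowDomain g, (E z * fderiv ℝ ψ z (1, 0) + F z * fderiv ℝ ψ z (0, 1))) +
        ∫ y in Ioi (0 : ℝ), a * ψ (0, y) := by
  have hm : MeasurableSet {z : ℝ × ℝ | 0 < z.1} :=
    (isOpen_lt continuous_const continuous_fst).measurableSet
  rw [← integral_inter_add_sdiff hm hint]
  congr 1
  · rw [flowDomain_eq, inter_comm]
  · have e1 : ∫ z in above g \ {z : ℝ × ℝ | 0 < z.1},
        (E z * fderiv ℝ ψ z (1, 0) + F z * fderiv ℝ ψ z (0, 1)) =
        ∫ z in above g \ {z : ℝ × ℝ | 0 < z.1},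
        (a * fderiv ℝ ψ z (1, 0) + b * fderiv ℝ ψ z (0, 1)) := by
      apply setIntegral_congr_fun ((isOpen_above hg).measurableSet.diff hm)
      intro z hz
      have := hE z hz.1 (not_lt.1 hz.2)
      simp only [this.1, this.2]
    have hm' : MeasurableSet {z : ℝ × ℝ | z.1 ≤ 0} :=
      (isClosed_le continuous_fst continuous_const).measurableSet
    -- With constant coefficients the integrand vanishes off the support of ψ, so the integral may
    -- be taken over the whole half plane.
    rw [e1, ← setIntegral_eq_of_subset_of_forall_sdiff_eq_zero hm'
      (fun z (hz : z ∈ above g \ {z : ℝ × ℝ | 0 < z.1}) => by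
        have := hz.2
        simpa using this)
      (fun z hz => ?_), integral_halfPlane h hc]
    · rw [integral_const_mul]
      congr 1
      symm
      apply setIntegral_eq_integral_of_forall_compl_eq_zero
      intro y hy
      by_contra hne
      have h1 : g 0 < y := hs (subset_tsupport _ hne : (0, y) ∈ tsupport ψ)
      rw [hg0 0 le_rfl] at h1
      exact hy h1
    · have h1 : z ∉ tsupport ψ := fun hz1 => hz.2 ⟨hs hz1, fun h0 =>
        absurd (show (0 : ℝ) < z.1 from h0) (not_lt.2 hz.1)⟩
      simp [fderiv_eq_zero_of_notMem_tsupport h1]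

/-! ### The wave satisfies every conservation law -/

namespace Upstream
variable {G : Upstream} {α : ℝ}

theorem contDiffAt_state (h : α ∈ G.arc) {n : WithTop ℕ∞} : ContDiffAt ℝ n G.state α := by
  have hs := arc_snd_pos h
  have hph : ContDiffAt ℝ n G.phase α := by
    unfold phase; fun_prop
  have hsnd : ContDiffAt ℝ n G.snd α := contDiffAt_const.mul hph.sin
  have htan : ContDiffAt ℝ n G.tang α := contDiffAt_const.mul hph.cos
  have hrho : ContDiffAt ℝ n G.rho α := contDiffAt_const.mul
    ((hsnd.div_const _).rpow_const_of_ne (div_pos hs G.c_pos).ne')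
  rw [contDiffAt_pi]
  intro i
  fin_cases i
  · exact (htan.mul Real.contDiff_cos.contDiffAt).add (hsnd.mul Real.contDiff_sin.contDiffAt)
  · exact (htan.mul Real.contDiff_sin.contDiffAt).sub (hsnd.mul Real.contDiff_cos.contDiffAt)
  · exact (hrho.mul (hsnd.pow 2)).div_const _
  · exact hrho

theorem totalEnthalpy_state (h : α ∈ G.arc) : totalEnthalpy G.γ (G.state α) = G.qs ^ 2 / 2 := by
  show G.γ * G.prs α / ((G.γ - 1) * G.rho α) + (G.velU α ^ 2 + G.velV α ^ 2) / 2 = _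
  rw [← G.total α, prs]
  have := (arc_rho_pos h).ne'; have := G.γ_pos.ne'; have := G.γ_sub_pos.ne'
  field_simp

/-- Along the curve the variations of the two fluxes are parallel. -/
theorem exists_flux_deriv (h : α ∈ G.arc) : ∃ D : Fin 4 → ℝ,
    HasDerivAt (fun α => fluxX G.γ (G.state α)) (Real.cos α • D) α ∧
    HasDerivAt (fun α => fluxY G.γ (G.state α)) (Real.sin α • D) α := by
  have hs := arc_snd_pos h
  have hk : 2 / (G.γ + 1) = 1 - G.k ^ 2 := G.one_sub_k_sq.symm
  have hU := G.hasDerivAt_velU α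
  have hV := G.hasDerivAt_velV α
  have hR := hasDerivAt_rho (G := G) hs
  have hP := hasDerivAt_prs (G := G) hs
  rw [hk] at hR hP
  have hB : HasDerivAt (fun α => totalEnthalpy G.γ (G.state α)) 0 α := by
    refine (hasDerivAt_const α (G.qs ^ 2 / 2)).congr_of_eventuallyEq ?_
    have e : (fun α => totalEnthalpy G.γ (G.state α)) =ᶠ[𝓝 α] fun _ => G.qs ^ 2 / 2 := by
      have hsnd : ∀ᶠ β in 𝓝 α, 0 < G.snd β :=
        (G.hasDerivAt_snd α).continuousAt.eventually_const_lt hs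
      filter_upwards [hsnd] with β hβ
      have hr : 0 < G.rho β := mul_pos G.ρ_pos (Real.rpow_pos_of_pos (div_pos hβ G.c_pos) _)
      show G.γ * G.prs β / ((G.γ - 1) * G.rho β) + (G.velU β ^ 2 + G.velV β ^ 2) / 2 = _
      rw [← G.total β, prs]
      have := hr.ne'; have := G.γ_pos.ne'; have := G.γ_sub_pos.ne'
      field_simp
    exact e
  have hu := G.vel_normal α
  have ht := G.vel_tang α
  have hcs := Real.sin_sq_add_cos_sq α
  have e1 : G.velU α - G.snd α * Real.sin α = G.tang α * Real.cos α := by rw [velU]; ring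
  have e2 : G.velV α + G.snd α * Real.cos α = G.tang α * Real.sin α := by rw [velV]; ring
  have e3 : G.snd α - G.velU α * Real.sin α = -(G.velV α * Real.cos α) := by linarith
  obtain ⟨a, ha⟩ : ∃ a, a = G.tang α := ⟨_, rfl⟩
  obtain ⟨c, hc⟩ : ∃ c, c = G.snd α := ⟨_, rfl⟩
  obtain ⟨u, hu'⟩ : ∃ u, u = G.velU α := ⟨_, rfl⟩
  obtain ⟨v, hv'⟩ : ∃ v, v = G.velV α := ⟨_, rfl⟩
  obtain ⟨r, hr'⟩ : ∃ r, r = G.rho α := ⟨_, rfl⟩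
  rw [← ha] at hU hV; rw [← ha, ← hc, ← hr'] at hR hP
  rw [← hc, ← hu'] at hu e1 e3; rw [← hv'] at hu e3; rw [← ha] at e1
  rw [← hc, ← hv', ← ha] at e2
  rw [← hc] at hs
  have hs' := hs.ne'
  have hρu := hR.mul hU
  have hρv := hR.mul hV
  -- The last entry is the first one times the total enthalpy, which is constant along the curve.
  refine ⟨![r * (1 - G.k ^ 2) * a ^ 2 / c, u * (r * (1 - G.k ^ 2) * a ^ 2 / c) -
    r * (1 - G.k ^ 2) * a * v, v * (r * (1 - G.k ^ 2) * a ^ 2 / c) + r * (1 - G.k ^ 2) * a * u,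
    G.qs ^ 2 / 2 * (r * (1 - G.k ^ 2) * a ^ 2 / c)], ?_, ?_⟩
  · rw [hasDerivAt_pi]
    intro i
    fin_cases i
    · refine hρu.congr_deriv ?_
      show _ = Real.cos α * (r * (1 - G.k ^ 2) * a ^ 2 / c)
      rw [← hu', ← hr']
      field_simp
      linear_combination (r * (1 - G.k ^ 2) * a) * e1
    · refine ((hR.mul (hU.pow 2)).add hP).congr_deriv ?_
      show _ = Real.cos α * (u * (r * (1 - G.k ^ 2) * a ^ 2 / c) - r * (1 - G.k ^ 2) * a * v)
      simp only [Pi.pow_apply]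
      rw [← hu', ← hr']
      field_simp
      linear_combination (r * (1 - G.k ^ 2) * a) * (u * e1 + c * e3)
    · refine (hρu.mul hV).congr_deriv ?_
      show _ = Real.cos α * (v * (r * (1 - G.k ^ 2) * a ^ 2 / c) + r * (1 - G.k ^ 2) * a * u)
      simp only [Pi.mul_apply]
      rw [← hu', ← hr', ← hv']
      field_simp
      linear_combination (r * (1 - G.k ^ 2) * a) * (v * e1)
    · refine (hρu.mul hB).congr_deriv ?_
      show _ = Real.cos α * (G.qs ^ 2 / 2 * (r * (1 - G.k ^ 2) * a ^ 2 / c))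
      simp only [Pi.mul_apply]
      rw [← hu', ← hr', totalEnthalpy_state h]
      field_simp
      linear_combination (r * (1 - G.k ^ 2) * a) * G.qs ^ 2 * e1
  · rw [hasDerivAt_pi]
    intro i
    fin_cases i
    · refine hρv.congr_deriv ?_
      show _ = Real.sin α * (r * (1 - G.k ^ 2) * a ^ 2 / c)
      rw [← hv', ← hr']
      field_simp
      linear_combination (r * (1 - G.k ^ 2) * a) * e2
    · refine (hρu.mul hV).congr_deriv ?_
      show _ = Real.sin α * (u * (r * (1 - G.k ^ 2) * a ^ 2 / c) - r * (1 - G.k ^ 2) * a * v)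
      simp only [Pi.mul_apply]
      rw [← hu', ← hr', ← hv']
      field_simp
      linear_combination (r * (1 - G.k ^ 2) * a) * (u * e2)
    · refine ((hR.mul (hV.pow 2)).add hP).congr_deriv ?_
      show _ = Real.sin α * (v * (r * (1 - G.k ^ 2) * a ^ 2 / c) + r * (1 - G.k ^ 2) * a * u)
      simp only [Pi.pow_apply]
      rw [← hv', ← hr']
      field_simp
      linear_combination (r * (1 - G.k ^ 2) * a) * (v * e2 - c * hu)
    · refine (hρv.mul hB).congr_deriv ?_
      show _ = Real.sin α * (G.qs ^ 2 / 2 * (r * (1 - G.k ^ 2) * a ^ 2 / c))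
      simp only [Pi.mul_apply]
      rw [← hv', ← hr', totalEnthalpy_state h]
      field_simp
      linear_combination (r * (1 - G.k ^ 2) * a) * G.qs ^ 2 * e2

end Upstream

theorem integrable_fderiv_mul {f χ : ℝ × ℝ → ℝ} {C : NNReal} (hf : LipschitzWith C f)
    (hχ : Continuous χ) (hc : HasCompactSupport χ) (v : ℝ × ℝ) :
    Integrable fun z => fderiv ℝ f z v * χ z := by
  have h := (hχ.integrable_of_hasCompactSupport hc (μ := volume)).mul_bdd
    (g := fun z => fderiv ℝ f z v) (c := C * ‖v‖)
    (measurable_fderiv_apply_const ℝ f v).aestronglyMeasurable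
    (Eventually.of_forall fun z => (ContinuousLinearMap.le_opNorm _ _).trans
      (mul_le_mul_of_nonneg_right (norm_fderiv_le_of_lipschitz ℝ hf) (norm_nonneg _)))
  simpa only [mul_comm] using h

namespace Wall

variable {G : Upstream} {g : ℝ → ℝ} {K : NNReal}

/-- Near a compact subset of the domain the angle of the characteristics coincides with a Lipschitz
function, which is constant along the characteristics and increases upwards. -/
theorem exists_lipschitz_angle (W : Wall G g K) {S : Set (ℝ × ℝ)} (hS : IsCompact S)
    (hSg : S ⊆ above g) : ∃ (C : NNReal) (a : ℝ × ℝ → ℝ) (O : Set (ℝ × ℝ)) (β : ℝ),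
      LipschitzWith C a ∧ IsOpen O ∧ S ⊆ O ∧ O ⊆ above g ∧ EqOn a (fanAngle G g) O ∧
      (∀ z, a z ∈ Icc β G.mach₀) ∧ Icc β G.mach₀ ⊆ G.arc ∧
      ∀ᵐ z, DifferentiableAt ℝ a z ∧ (z ∈ O →
        Real.cos (a z) * fderiv ℝ a z (1, 0) + Real.sin (a z) * fderiv ℝ a z (0, 1) = 0 ∧
        0 ≤ fderiv ℝ a z (0, 1)) := by
  obtain ⟨C, l, O, X, hl, hO, hSO, hOg, heq, hX⟩ := W.exists_lipschitz_speed hS hSg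
  have hlip : LipschitzWith (1 * C) fun z => Real.arctan (l z) := by
    refine LipschitzWith.comp (f := Real.arctan) (lipschitzWith_of_nnnorm_deriv_le
      Real.differentiable_arctan fun x => ?_) hl
    rw [← NNReal.coe_le_coe, coe_nnnorm, Real.deriv_arctan, Real.norm_eq_abs, abs_of_pos (by positivity)]
    rw [NNReal.coe_one, div_le_one (by positivity)]
    nlinarith [sq_nonneg x]
  have hmem : ∀ z, turn G g X ≤ Real.arctan (l z) ∧ Real.arctan (l z) ≤ G.mach₀ ∧
      Real.arctan (l z) ∈ G.arc := fun z => W.arctan_mem_arc (hX z).1 (hX z).2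
  refine ⟨1 * C, fun z => Real.arctan (l z), O, turn G g X, hlip, hO, hSO, hOg,
    fun z hz => by simp only [fanAngle, heq hz], fun z => ⟨(hmem z).1, (hmem z).2.1⟩,
    fun α hα => Upstream.arc_upward (W.turn_spec X).1 hα.1 hα.2, ?_⟩
  filter_upwards [hl.ae_differentiableAt (μ := volume)] with z hz
  have hz' : HasFDerivAt (fun z => Real.arctan (l z)) ((1 / (1 + l z ^ 2)) • fderiv ℝ l z) z :=
    hz.hasFDerivAt.arctan
  refine ⟨hz'.differentiableAt, fun hzO => ?_⟩
  rw [hz'.fderiv]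
  have hev : fanSpeed g (wallSpeed G g) =ᶠ[𝓝 z] l :=
    (heq.eventuallyEq_of_mem (hO.mem_nhds hzO)).symm
  obtain ⟨h1, h2⟩ := W.fanData.fanSpeed_transport (hOg hzO)
    (hz.hasFDerivAt.congr_of_eventuallyEq hev)
  rw [← heq hzO] at h1
  have hp : 0 < 1 / (1 + l z ^ 2) := by positivity
  have h3 : Real.sin (Real.arctan (l z)) = l z * Real.cos (Real.arctan (l z)) := by
    rw [Real.sin_arctan, Real.cos_arctan]; ring
  have e : ∀ v, ((1 / (1 + l z ^ 2)) • fderiv ℝ l z) v = 1 / (1 + l z ^ 2) * fderiv ℝ l z v :=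
    fun v => rfl
  rw [e, e, h3]
  refine ⟨?_, mul_nonneg hp.le h2⟩
  linear_combination Real.cos (Real.arctan (l z)) * (1 / (1 + l z ^ 2)) * h1

theorem lipschitz_comp_angle {a : ℝ × ℝ → ℝ} {C : NNReal} {β : ℝ} (ha : LipschitzWith C a)
    (hmem : ∀ z, a z ∈ Icc β G.mach₀) (hsub : Icc β G.mach₀ ⊆ G.arc) {f : ℝ → ℝ}
    (hf : ∀ α ∈ G.arc, ContDiffAt ℝ 1 f α) : ∃ D, LipschitzWith D fun z => f (a z) := by
  obtain ⟨D, hD⟩ := ContDiffOn.exists_lipschitzOnWith (n := 1) (s := Icc β G.mach₀) (f := f)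
    (fun α hα => (hf α (hsub hα)).contDiffWithinAt) one_ne_zero (convex_Icc _ _) isCompact_Icc
  refine ⟨D * C, fun z z' => ?_⟩
  refine (hD (hmem z) (hmem z')).trans ?_
  rw [ENNReal.coe_mul, mul_assoc]
  gcongr
  exact ha z z'

theorem fderiv_comp_angle {a : ℝ × ℝ → ℝ} {z : ℝ × ℝ} (ha : DifferentiableAt ℝ a z)
    {f : ℝ → ℝ} {f' : ℝ} (hf : HasDerivAt f f' (a z)) (v : ℝ × ℝ) :
    fderiv ℝ (fun z => f (a z)) z v = f' * fderiv ℝ a z v := by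
  have h : HasFDerivAt (fun z => f (a z)) (f' • fderiv ℝ a z) z :=
    hf.comp_hasFDerivAt z ha.hasFDerivAt
  rw [h.fderiv]
  rfl

theorem contDiffAt_state_apply {α : ℝ} (h : α ∈ G.arc) (i : Fin 4) :
    ContDiffAt ℝ 1 (fun α => G.state α i) α :=
  contDiffAt_pi.1 (Upstream.contDiffAt_state h) i

/-- On a compact subset of the domain the wave agrees with a Lipschitz function, so integration by
parts bounds the pairing by the Lipschitz constant times the area. -/
theorem locBV_fanState (W : Wall G g K) (i : Fin 4) :
    IsLocBV (flowDomain g) fun z => fanState G g z i := by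
  have hO := isOpen_flowDomain W.lip.continuous
  have hcont : ContinuousOn (fun z => fanState G g z i) (flowDomain g) :=
    (continuous_apply i).comp_continuousOn (W.continuousOn_fanState.mono (flowDomain_subset g))
  refine ⟨hcont.locallyIntegrableOn hO.measurableSet, fun S hS hSc e he => ?_⟩
  obtain ⟨C, a, O, β, ha, -, hSO, -, heq, hmem, hsub, -⟩ :=
    W.exists_lipschitz_angle hSc (hS.trans (flowDomain_subset g))
  obtain ⟨D, hD⟩ := lipschitz_comp_angle ha hmem hsub
    (fun α hα => contDiffAt_state_apply (G := G) hα i)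
  refine ⟨D * ‖e‖ * volume.real S, fun φ hφ hφS M hM => ?_⟩
  have hφc : HasCompactSupport φ := hSc.of_isClosed_subset (isClosed_tsupport φ) hφS
  obtain ⟨C', hφl⟩ := lipschitz_of_smooth hφ hφc
  have e1 : ∫ z in flowDomain g, fanState G g z i * fderiv ℝ φ z e =
      ∫ z, G.state (a z) i * fderiv ℝ φ z e := by
    refine (setIntegral_congr_fun hO.measurableSet fun z _ => ?_).trans
      (setIntegral_eq_integral_of_forall_compl_eq_zero fun z hz => ?_)
    · show _ = _
      by_cases hz : z ∈ tsupport φ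
      · simp only [fanState, heq (hSO (hφS hz))]
      · simp [fderiv_eq_zero_of_notMem_tsupport hz]
    · rw [fderiv_eq_zero_of_notMem_tsupport fun h => hz (hS (hφS h))]
      simp
  have e2 : ∫ z, fderiv ℝ (fun z => G.state (a z) i) z e * φ z =
      ∫ z in S, fderiv ℝ (fun z => G.state (a z) i) z e * φ z := by
    symm
    apply setIntegral_eq_integral_of_forall_compl_eq_zero
    intro z hz
    have : φ z = 0 := by
      by_contra h
      exact hz (hφS (subset_tsupport _ h))
    simp [this]
  rw [e1, integral_mul_fderiv hD hφl hφc, abs_neg, e2, ← Real.norm_eq_abs]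
  have hb : ∀ z ∈ S, ‖fderiv ℝ (fun z => G.state (a z) i) z e * φ z‖ ≤ D * ‖e‖ * M := by
    intro z _
    rw [norm_mul]
    have h1 := ((fderiv ℝ (fun z => G.state (a z) i) z).le_opNorm e).trans
      (mul_le_mul_of_nonneg_right (norm_fderiv_le_of_lipschitz ℝ hD) (norm_nonneg e))
    exact mul_le_mul h1 (hM z) (norm_nonneg _) (by positivity)
  have := norm_setIntegral_le_of_norm_le_const (hSc.measure_lt_top (μ := volume)) hb
  refine this.trans (le_of_eq ?_)
  ring

/-- The wave satisfies every conservation law in the weak sense. -/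
theorem fanState_conservation (W : Wall G g K) {η Q : (Fin 4 → ℝ) → ℝ}
    (hηQ : IsConvexEntropyPair G.γ η Q) {ψ : ℝ × ℝ → ℝ} {C : NNReal} (hψ : LipschitzWith C ψ)
    (hc : HasCompactSupport ψ) (hs : tsupport ψ ⊆ above g) :
    ∫ z in above g, (η (fluxX G.γ (fanState G g z)) * fderiv ℝ ψ z (1, 0) +
      Q (fluxX G.γ (fanState G g z)) * fderiv ℝ ψ z (0, 1)) = 0 := by
  obtain ⟨C, a, O, β, ha, hO, hSO, hOg, heq, hmem, hsub, hae⟩ := W.exists_lipschitz_angle hc hs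
  let E : ℝ → ℝ := fun α => η (fluxX G.γ (G.state α))
  let F : ℝ → ℝ := fun α => Q (fluxX G.γ (G.state α))
  have hW : ∀ α ∈ G.arc, ContDiffAt ℝ 1 (fun α => fluxX G.γ (G.state α)) α := fun α hα =>
    (contDiffAt_fluxX G.one_lt (Upstream.state_supersonic hα).2.1).comp α (Upstream.contDiffAt_state hα)
  have hE : ∀ α ∈ G.arc, ContDiffAt ℝ 1 E α := fun α hα =>
    ((hηQ.smooth_entropy _ (Upstream.state_supersonic hα)).of_le (by norm_num)).comp α (hW α hα)
  have hF : ∀ α ∈ G.arc, ContDiffAt ℝ 1 F α := fun α hα =>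
    (hηQ.smooth_flux _ (Upstream.state_supersonic hα)).comp α (hW α hα)
  -- Compatibility of the pair turns the parallel flux derivatives into derivatives cos α · D and
  -- sin α · D of η and Q. After integration by parts the integrand then contains the factor cos a ·
  -- a_x + sin a · a_y = 0.
  have hEF : ∀ α ∈ G.arc, ∃ D, HasDerivAt E (Real.cos α * D) α ∧
      HasDerivAt F (Real.sin α * D) α := by
    intro α hα
    have hss := Upstream.state_supersonic hα
    obtain ⟨D, h1, h2⟩ := Upstream.exists_flux_deriv hα
    have hst := ((Upstream.contDiffAt_state (n := 1) hα).differentiableAt one_ne_zero).hasDerivAt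
    have hX := ((contDiffAt_fluxX (n := 1) G.one_lt hss.2.1).differentiableAt
      one_ne_zero).hasFDerivAt
    have hY := ((contDiffAt_fluxY (n := 1) G.one_lt hss.2.1).differentiableAt
      one_ne_zero).hasFDerivAt
    have hη := ((hηQ.smooth_entropy _ hss).differentiableAt (by norm_num)).hasFDerivAt
    have hQ := ((hηQ.smooth_flux _ hss).differentiableAt one_ne_zero).hasFDerivAt
    have e1 := (hX.comp_hasDerivAt α hst).unique h1
    have e2 := (hY.comp_hasDerivAt α hst).unique h2
    refine ⟨fderiv ℝ η (fluxX G.γ (G.state α)) D, ?_, ?_⟩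
    · refine (hη.comp_hasDerivAt α h1).congr_deriv ?_
      rw [map_smul, smul_eq_mul]
    · refine (hQ.comp_hasDerivAt α h1).congr_deriv ?_
      rw [← e1]
      have h3 := congrArg (fun L : State →L[ℝ] ℝ => L (deriv G.state α))
        (hηQ.compatible _ hss)
      simp only [ContinuousLinearMap.comp_apply] at h3
      rw [h3, e2, map_smul, smul_eq_mul]
  obtain ⟨C₁, hE'⟩ := lipschitz_comp_angle ha hmem hsub hE
  obtain ⟨C₂, hF'⟩ := lipschitz_comp_angle ha hmem hsub hF
  have i1 : Integrable fun z => E (a z) * fderiv ℝ ψ z (1, 0) := by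
    simpa using Dissipative.integrable (O := univ) (G := fun _ => 0)
      (hE'.continuous.locallyIntegrable.locallyIntegrableOn univ)
      (locallyIntegrable_zero.locallyIntegrableOn univ) hψ hc (subset_univ _)
  have i2 : Integrable fun z => F (a z) * fderiv ℝ ψ z (0, 1) := by
    simpa using Dissipative.integrable (O := univ) (F := fun _ => 0)
      (locallyIntegrable_zero.locallyIntegrableOn univ)
      (hF'.continuous.locallyIntegrable.locallyIntegrableOn univ) hψ hc (subset_univ _)
  have e1 : ∫ z in above g, (η (fluxX G.γ (fanState G g z)) * fderiv ℝ ψ z (1, 0) +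
      Q (fluxX G.γ (fanState G g z)) * fderiv ℝ ψ z (0, 1)) =
      ∫ z, (E (a z) * fderiv ℝ ψ z (1, 0) + F (a z) * fderiv ℝ ψ z (0, 1)) := by
    refine (setIntegral_congr_fun W.measurableSet_above fun z _ => ?_).trans
      (setIntegral_eq_integral_of_forall_compl_eq_zero fun z hz => ?_)
    · show _ = _
      by_cases hz : z ∈ tsupport ψ
      · simp only [fanState, E, F, heq (hSO hz)]
      · simp [fderiv_eq_zero_of_notMem_tsupport hz]
    · rw [fderiv_eq_zero_of_notMem_tsupport fun h => hz (hs h)]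
      simp
  rw [e1, integral_add i1 i2, integral_mul_fderiv hE' hψ hc,
    integral_mul_fderiv hF' hψ hc, ← neg_add, neg_eq_zero,
    ← integral_add (integrable_fderiv_mul hE' hψ.continuous hc _)
      (integrable_fderiv_mul hF' hψ.continuous hc _)]
  refine integral_eq_zero_of_ae ?_
  filter_upwards [hae] with z hz
  by_cases hzs : z ∈ tsupport ψ
  · obtain ⟨D, hD1, hD2⟩ := hEF (a z) (hsub (hmem z))
    rw [fderiv_comp_angle hz.1 hD1, fderiv_comp_angle hz.1 hD2]
    have := (hz.2 (hSO hzs)).1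
    show _ = (0 : ℝ)
    linear_combination D * ψ z * this
  · simp [image_eq_zero_of_notMem_tsupport hzs]

end Wall

/-! ### The trace of the wave on the wall -/

theorem isBounded_layer {g : ℝ → ℝ} {K : NNReal} (hg : LipschitzWith K g) (R ε : ℝ) :
    Bornology.IsBounded (layer g R ε) := by
  have hcont : ContinuousOn (fun x => |g x|) (Icc 0 R) := by
    have := hg.continuous; fun_prop
  obtain ⟨M, hM⟩ := (isCompact_Icc.image_of_continuousOn hcont).bddAbove
  have hb : Bornology.IsBounded (Icc (0 : ℝ) R ×ˢ Icc (-M) (M + ε)) :=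
    (isCompact_Icc.prod isCompact_Icc).isBounded
  refine hb.subset fun z hz => ?_
  have hz1 : z.1 ∈ Icc (0 : ℝ) R := ⟨hz.1.le, hz.2.1.le⟩
  have h1 : |g z.1| ≤ M := hM (mem_image_of_mem _ hz1)
  have h2 := abs_le.1 h1
  exact ⟨hz1, by linarith [hz.2.2.1], by linarith [hz.2.2.2]⟩

theorem integral_layer_fst {g : ℝ → ℝ} {K : NNReal} (hg : LipschitzWith K g) {R ε : ℝ}
    (hε : 0 < ε) {h : ℝ → ℝ} (hh : Measurable h) {M : ℝ}
    (hM : ∀ x ∈ Ioo 0 R, |h x| ≤ M) :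
    IntegrableOn (fun z : ℝ × ℝ => h z.1) (layer g R ε) ∧
    ∫ z in layer g R ε, h z.1 = ε * ∫ x in Ioo 0 R, h x := by
  have hm := measurableSet_layer hg.continuous R ε
  have hint : IntegrableOn (fun z : ℝ × ℝ => h z.1) (layer g R ε) := by
    refine Measure.integrableOn_of_bounded (M := M) (isBounded_layer hg R ε).measure_lt_top.ne
      (hh.comp measurable_fst).aestronglyMeasurable ?_
    exact (ae_restrict_iff' hm).2 (Eventually.of_forall fun z hz => hM _ ⟨hz.1, hz.2.1⟩)
  refine ⟨hint, ?_⟩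
  rw [← integral_indicator hm, Measure.volume_eq_prod, integral_prod _ (by
    rw [← Measure.volume_eq_prod]; exact hint.integrable_indicator hm), ← integral_const_mul,
    ← integral_indicator measurableSet_Ioo]
  congr 1
  ext x
  by_cases hx : x ∈ Ioo 0 R
  · rw [indicator_of_mem hx]
    have : (fun y => (layer g R ε).indicator (fun z : ℝ × ℝ => h z.1) (x, y)) =
        (Ioo (g x) (g x + ε)).indicator fun _ => h x := by
      ext y
      by_cases hy : y ∈ Ioo (g x) (g x + ε)
      · rw [indicator_of_mem hy, indicator_of_mem (show (x, y) ∈ layer g R ε from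
          ⟨hx.1, hx.2, hy.1, hy.2⟩)]
      · rw [indicator_of_notMem hy, indicator_of_notMem fun h => hy ⟨h.2.2.1, h.2.2.2⟩]
    rw [this, integral_indicator measurableSet_Ioo, setIntegral_const]
    simp [Measure.real, hε.le]
  · rw [indicator_of_notMem hx]
    have : (fun y => (layer g R ε).indicator (fun z : ℝ × ℝ => h z.1) (x, y)) = fun _ => 0 := by
      ext y
      exact indicator_of_notMem (fun h => hx ⟨h.1, h.2.1⟩) _
    rw [this, integral_zero]

namespace Wall

variable {G : Upstream} {g : ℝ → ℝ} {K : NNReal}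

/-- By compactness the difference between characteristic and flow slopes is bounded below as long as
the wall point has abscissa at most R. This limits how far upstream the foot of a ray ending near
the wall can be. -/
theorem exists_gap (W : Wall G g K) (R : ℝ) : ∃ d > 0, ∀ α ∈ Icc (turn G g R) G.mach₀,
    d ≤ Real.tan α - G.slope α := by
  have hsub : Icc (turn G g R) G.mach₀ ⊆ G.arc := fun α hα =>
    Upstream.arc_upward (W.turn_spec R).1 hα.1 hα.2
  have hne : (Icc (turn G g R) G.mach₀).Nonempty := ⟨G.mach₀, (W.turn_spec R).1.2.1, le_rfl⟩
  have hcont : ContinuousOn (fun α => Real.tan α - G.slope α) (Icc (turn G g R) G.mach₀) :=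
    fun α hα => ((Real.continuousAt_tan.2 (Upstream.arc_cos_pos (hsub hα)).ne').sub
      (Upstream.hasDerivAt_slope (hsub hα)).continuousAt).continuousWithinAt
  obtain ⟨α₀, hα₀, hmin⟩ := isCompact_Icc.exists_isMinOn hne hcont
  exact ⟨_, sub_pos.2 (Upstream.slope_lt_tan (hsub hα₀)), fun α hα => hmin hα⟩

theorem velU_lt_qs {α : ℝ} (h : α ∈ G.arc) : G.velU α < G.qs := by
  refine lt_of_le_of_lt ?_ (Upstream.region_state h).2
  exact Real.le_sqrt_of_sq_le (by
    show G.velU α ^ 2 ≤ G.velU α ^ 2 + G.velV α ^ 2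
    linarith [sq_nonneg (G.velV α)])

/-- Near the wall the flow direction differs little from that of the wall. -/
theorem wall_defect (W : Wall G g K) {R d : ℝ} (hd : 0 < d)
    (hgap : ∀ α ∈ Icc (turn G g R) G.mach₀, d ≤ Real.tan α - G.slope α) {ε : ℝ} {z : ℝ × ℝ}
    (hz : z ∈ layer g R ε) :
    |velX (fanState G g z) * wallW g z.1 - velY (fanState G g z)| ≤
      G.qs * (wallW g (z.1 - ε / d) - wallW g z.1) := by
  have hza : z ∈ above g := hz.2.2.1
  obtain ⟨h1, h2, hA⟩ := W.fanAngle_mem hza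
  obtain ⟨t, ht⟩ := W.fanData.exists_ray hza
  have htan : Real.tan (fanAngle G g z) = fanSpeed g (wallSpeed G g) z := Real.tan_arctan _
  have harc : ∀ s, wallSpeed G g s ≤ fanSpeed g (wallSpeed G g) z → turn G g s ≤ fanAngle G g z :=
    fun s hs => by rw [← W.arctan_speed]; exact Real.arctan_strictMono.monotone hs
  have harc' : ∀ s, fanSpeed g (wallSpeed G g) z ≤ wallSpeed G g s → fanAngle G g z ≤ turn G g s :=
    fun s hs => by rw [← W.arctan_speed]; exact Real.arctan_strictMono.monotone hs
  have hchord := W.fanData.chord_le (t := t) (x := z.1) (σ := G.slope (fanAngle G g z))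
    (fun s hs => (W.turn_le_iff hA).1 (harc s (ht.2.2.2 s hs))) ht.1
  have hg1 := hgap _ ⟨(W.turn_antitone hz.2.1.le).trans h1, h2⟩
  rw [htan] at hg1
  have hy := ht.2.1
  -- A ray ending at height less than ε has its foot within horizontal distance ε/d. So the flow
  -- slope at z lies between the wall slopes at z.1 and at z.1 - ε/d.
  have hlt : z.1 - ε / d < t := by
    have h3 := mul_le_mul_of_nonneg_right hg1 (sub_pos.2 ht.1).le
    have h4 : d * (z.1 - t) < ε := by linarith [hz.2.2.2]
    rw [mul_comm, ← lt_div_iff₀ hd] at h4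
    linarith
  have hup : G.slope (fanAngle G g z) ≤ wallW g (z.1 - ε / d) :=
    (W.le_turn_iff hA).1 (harc' _ (ht.2.2.1 _ hlt))
  have hlow : wallW g z.1 ≤ G.slope (fanAngle G g z) := (W.turn_le_iff hA).1 h1
  have hu := Upstream.arc_velU_pos hA
  have e : velX (fanState G g z) * wallW g z.1 - velY (fanState G g z) =
      -(G.velU (fanAngle G g z) * (G.slope (fanAngle G g z) - wallW g z.1)) := by
    show G.velU (fanAngle G g z) * wallW g z.1 - G.velV (fanAngle G g z) = _
    rw [Upstream.slope]
    field_simp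
    ring
  rw [e, abs_neg, abs_of_nonneg (mul_nonneg hu.le (by linarith))]
  exact mul_le_mul (velU_lt_qs hA).le (by linarith) (by linarith) G.qs_pos.le

/-- A shift changes the integral only by boundary terms: the integral over (-δ, 0), which is
nonpositive, and the one over (R - δ, R), which is at least δ w(R). The bound is O(δ) without any
continuity of the slope, so corners are allowed. -/
theorem integral_shift_le (W : Wall G g K) {R δ : ℝ} (hR : 0 < R) (hδ : 0 ≤ δ) :
    ∫ x in Ioo 0 R, (wallW g (x - δ) - wallW g x) ≤ δ * -wallW g R := by
  have hi : ∀ a b, IntervalIntegrable (wallW g) volume a b := fun a b =>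
    (W.slope_antitone.antitoneOn _).intervalIntegrable
  rw [← integral_Ioc_eq_integral_Ioo, ← intervalIntegral.integral_of_le hR.le,
    intervalIntegral.integral_sub ((hi (0 - δ) (R - δ)).comp_sub_right δ |> fun h => by simpa using h) (hi _ _),
    intervalIntegral.integral_comp_sub_right (fun x => wallW g x) δ,
    intervalIntegral.integral_interval_sub_interval_comm (hi _ _) (hi _ _) (hi _ _)]
  have h1 : ∫ x in (0 - δ)..0, wallW g x ≤ 0 := by
    have := intervalIntegral.integral_nonneg (a := 0 - δ) (b := 0) (f := fun x => -wallW g x)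
      (μ := volume) (by linarith) fun x _ => neg_nonneg.2 (W.slope_nonpos x)
    rw [intervalIntegral.integral_neg] at this
    linarith
  have h2 : δ * wallW g R ≤ ∫ x in (R - δ)..R, wallW g x := by
    have := intervalIntegral.integral_mono_on (a := R - δ) (b := R) (μ := volume)
      (f := fun _ => wallW g R) (g := wallW g) (by linarith) (by simp) (hi _ _)
      fun x hx => W.slope_antitone hx.2
    simpa using this
  linarith

theorem slip_fanState (W : Wall G g K) (R : ℝ) : Tendsto (fun ε : ℝ => ε⁻¹ * ∫ z in layer g R ε,
    |velX (fanState G g z) * wallW g z.1 - velY (fanState G g z)|) (𝓝[>] 0) (𝓝 0) := by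
  rcases le_or_gt R 0 with hR | hR
  · have : ∀ ε, layer g R ε = ∅ := fun ε => by
      ext z; simp only [mem_empty_iff_false, iff_false]
      exact fun h => absurd (h.1.trans h.2.1) hR.not_gt
    simp [this]
  obtain ⟨d, hd, hgap⟩ := W.exists_gap R
  have hlim : Tendsto (fun ε : ℝ => G.qs * (ε / d * -wallW g R)) (𝓝[>] 0) (𝓝 0) := by
    have : Tendsto (fun ε : ℝ => G.qs * (ε / d * -wallW g R)) (𝓝 0)
        (𝓝 (G.qs * (0 / d * -wallW g R))) :=
      (((continuous_id.div_const d).mul_const _).const_mul _).tendsto 0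
    simp only [zero_div, zero_mul, mul_zero] at this
    exact this.mono_left nhdsWithin_le_nhds
  refine squeeze_zero' ?_ ?_ hlim
  · filter_upwards [self_mem_nhdsWithin] with ε hε
    exact mul_nonneg (inv_nonneg.2 (le_of_lt hε)) (integral_nonneg fun z => abs_nonneg _)
  · filter_upwards [self_mem_nhdsWithin] with ε hε
    have hε : 0 < ε := hε
    have hδ : 0 ≤ ε / d := by positivity
    have hm : Measurable fun x => G.qs * (wallW g (x - ε / d) - wallW g x) :=
      ((W.measurable_slope.comp (measurable_id.sub_const _)).sub W.measurable_slope).const_mul _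
    obtain ⟨i1, i2⟩ := integral_layer_fst W.lip (R := R) hε hm (M := G.qs * -wallW g R)
      fun x hx => by
        rw [abs_of_nonneg (mul_nonneg G.qs_pos.le
          (sub_nonneg.2 (W.slope_antitone (by linarith))))]
        have h1 := W.slope_antitone hx.2.le
        have h2 := W.slope_nonpos (x - ε / d)
        exact mul_le_mul_of_nonneg_left (by linarith) G.qs_pos.le
    have h3 : ∫ z in layer g R ε, |velX (fanState G g z) * wallW g z.1 - velY (fanState G g z)| ≤
        ∫ z in layer g R ε, G.qs * (wallW g (z.1 - ε / d) - wallW g z.1) := by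
      refine integral_mono_of_nonneg (Eventually.of_forall fun z => abs_nonneg _) i1 ?_
      exact (ae_restrict_iff' (measurableSet_layer W.lip.continuous R ε)).2
        (Eventually.of_forall fun z hz => W.wall_defect hd hgap hz)
    rw [i2, integral_const_mul] at h3
    have h4 := mul_le_mul_of_nonneg_left (W.integral_shift_le hR hδ) G.qs_pos.le
    rw [inv_mul_le_iff₀ hε]
    exact h3.trans (mul_le_mul_of_nonneg_left h4 hε.le)

theorem supersonic_fanState (W : Wall G g K) {z : ℝ × ℝ} (hz : z ∈ above g) :
    fanState G g z ∈ supersonicStates G.γ := Upstream.state_supersonic (W.fanAngle_mem hz).2.2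

/-- The wave is an entropy solution. -/
theorem isEntropySolution_fanState (W : Wall G g K) :
    IsEntropySolution G.γ g G.state₀ (fanState G g) where
  measurable := W.aestronglyMeasurable_fanState.mono_measure
    (Measure.restrict_mono (flowDomain_subset g) le_rfl)
  compact_range := fun R => by
    obtain ⟨S, hS, hSc, hmem⟩ := W.compact_range_fanState R
    refine ⟨S, hS, hSc, ?_⟩
    refine (ae_restrict_iff' ((isOpen_flowDomain W.lip.continuous).inter
      Metric.isOpen_ball).measurableSet).2 (Eventually.of_forall fun z hz => hmem z hz.1.2 ?_)
    have h1 := hz.2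
    rw [mem_ball_zero_iff] at h1
    exact (le_abs_self z.1).trans ((norm_fst_le z).trans h1.le)
  locBV := W.locBV_fanState
  entropy := fun η Q hηQ ψ hψ hc hs h0 => by
    obtain ⟨C, hC⟩ := lipschitz_of_smooth hψ hc
    have hX : ContinuousOn (fun z => fluxX G.γ (fanState G g z)) (above g) := fun z hz =>
      ((contDiffAt_fluxX (n := 0) G.one_lt
        (W.supersonic_fanState hz).2.1).continuousAt).comp_continuousWithinAt
        (W.continuousOn_fanState z hz)
    have h1 : ContinuousOn (fun z => η (fluxX G.γ (fanState G g z))) (above g) := fun z hz =>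
      ContinuousAt.comp_continuousWithinAt (f := fun z => fluxX G.γ (fanState G g z))
        (hηQ.smooth_entropy _ (W.supersonic_fanState hz)).continuousAt (hX z hz)
    have h2 : ContinuousOn (fun z => Q (fluxX G.γ (fanState G g z))) (above g) := fun z hz =>
      ContinuousAt.comp_continuousWithinAt (f := fun z => fluxX G.γ (fanState G g z))
        (hηQ.smooth_flux _ (W.supersonic_fanState hz)).continuousAt (hX z hz)
    have hint := Dissipative.integrable (h1.locallyIntegrableOn W.measurableSet_above)
      (h2.locallyIntegrableOn W.measurableSet_above) hC hc hs
    have h3 := integral_above_eq W.lip.continuous W.flat hψ hc hs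
      (a := η (fluxX G.γ G.state₀)) (b := Q (fluxX G.γ G.state₀))
      (fun z hz hz0 => by rw [W.fanState_of_nonpos hz hz0]; exact ⟨rfl, rfl⟩) hint
    rw [W.fanState_conservation hηQ hC hc hs] at h3
    exact h3.le
  slip := fun R => by
    refine squeeze_zero' ?_ ?_ (W.slip_fanState R)
    · filter_upwards [self_mem_nhdsWithin] with ε hε
      exact mul_nonneg (inv_nonneg.2 (le_of_lt hε)) (integral_nonneg fun z => abs_nonneg _)
    · filter_upwards [self_mem_nhdsWithin] with ε hε
      refine mul_le_mul_of_nonneg_left ?_ (inv_nonneg.2 (le_of_lt hε))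
      have hm := measurableSet_layer W.lip.continuous R ε
      have hsubl : layer g R ε ⊆ above g := fun z hz => hz.2.2.1
      refine integral_mono_of_nonneg (Eventually.of_forall fun z => abs_nonneg _) ?_ ?_
      · obtain ⟨d, hd, hgap⟩ := W.exists_gap R
        have hfm : AEStronglyMeasurable (fun z => |velX (fanState G g z) * wallW g z.1 -
            velY (fanState G g z)|) (volume.restrict (layer g R ε)) := by
          have h1 : AEStronglyMeasurable (fanState G g) (volume.restrict (layer g R ε)) :=
            W.aestronglyMeasurable_fanState.mono_measure (Measure.restrict_mono hsubl le_rfl)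
          have h2 : ∀ i, AEStronglyMeasurable (fun z => fanState G g z i)
              (volume.restrict (layer g R ε)) := fun i =>
            (continuous_apply i).comp_aestronglyMeasurable h1
          exact (((h2 0).mul ((W.measurable_slope.comp
            measurable_fst).aestronglyMeasurable)).sub (h2 1)).norm
        have : IsFiniteMeasure (volume.restrict {z : ℝ × ℝ | 0 < z.1 ∧ z.1 < R ∧ g z.1 < z.2 ∧
            z.2 < g z.1 + ε}) :=
          isFiniteMeasure_restrict.2 (isBounded_layer W.lip R ε).measure_lt_top.ne
        refine Integrable.of_bound hfm (G.qs * -wallW g R) ?_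
        refine (ae_restrict_iff' hm).2 (Eventually.of_forall fun z hz => ?_)
        rw [Real.norm_eq_abs, abs_abs]
        refine (W.wall_defect hd hgap hz).trans (mul_le_mul_of_nonneg_left ?_ G.qs_pos.le)
        have h1 := W.slope_antitone hz.2.1.le
        have h2 := W.slope_nonpos (z.1 - ε / d)
        linarith
      · refine (ae_restrict_iff' hm).2 (Eventually.of_forall fun z hz => ?_)
        dsimp only
        rw [wallW_of_pos hz.1, abs_div]
        refine div_le_self (abs_nonneg _) ?_
        rw [abs_of_nonneg (Real.sqrt_nonneg _)]
        exact Real.one_le_sqrt.2 (by linarith [sq_nonneg (wallSlope g z.1)])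

end Wall

/-! ### The relative energy and its positivity -/

theorem energy_scalar {n T ρ u v a b r y : ℝ} (hn : 1 < n) (hT : 0 < T) (hρ : 0 < ρ)
    (hu : 0 < u) (hU : n * T < (n - 1) * u ^ 2) (hy : 0 ≤ y) (ha : 0 < a)
    (hV : n * (y * T) ≤ (n - 1) * a ^ 2)
    (hB : n * T * (y - 1) = ((u ^ 2 + v ^ 2) - (a ^ 2 + b ^ 2)) / 2) (hne : a ≠ u ∨ b ≠ v)
    (hr : 0 < r) (hle : r ≤ ρ * y ^ (n - 1)) :
    0 < ρ * T * u - r * (a * (u * (a - u) + v * (b - v)) + y * T * u) := by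
  have key := rpow_mul_lt_one hn hT hu hU hy ha hV hB hne
  have hpu : 0 < ρ * T * u := by positivity
  -- For a nonpositive bracket the claim is immediate; otherwise the worst case is the largest
  -- density allowed by `hle`, which is the scalar inequality.
  rcases le_or_gt (a * (u * (a - u) + v * (b - v)) + y * T * u) 0 with h | h
  · have := mul_nonneg hr.le (neg_nonneg.2 h)
    linarith
  · have h1 := mul_le_mul_of_nonneg_right hle h.le
    have h2 := mul_lt_mul_of_pos_left key hpu
    have h3 : ρ * T * u * (y ^ (n - 1) * (y + a * (u * (a - u) + v * (b - v)) / (u * T))) =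
        ρ * y ^ (n - 1) * (a * (u * (a - u) + v * (b - v)) + y * T * u) := by
      field_simp
      ring
    linarith

/-- The relative energy of `V` with respect to `U`, transported in the direction `x`. -/
def relEnergy (γ : ℝ) (U V : State) : ℝ :=
  (velX U ^ 2 + velY U ^ 2) * fluxX γ V 0 - velX U * fluxX γ V 1 - velY U * fluxX γ V 2 +
    pres U * velX U

/-- The flux of the relative energy in the direction `y`. -/
def relFlux (γ : ℝ) (U V : State) : ℝ :=
  (velX U ^ 2 + velY U ^ 2) * fluxY γ V 0 - velX U * fluxY γ V 1 - velY U * fluxY γ V 2 +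
    pres U * velY U

/-- The flux of relative energy through the wall is linear in the slip defects of the two flows,
with locally bounded coefficients in the application. So it has zero trace as soon as both flows
slip. -/
theorem relFlux_sub (γ : ℝ) (U V : State) (w : ℝ) : relFlux γ U V - w * relEnergy γ U V =
    dens V * (velX U ^ 2 + velY U ^ 2 - (velX U * velX V + velY U * velY V)) *
      (velY V - w * velX V) - (pres V - pres U) * (velY U - w * velX U) := by
  simp only [relFlux, relEnergy, fluxX, fluxY, Matrix.cons_val]
  ring

namespace Upstream

variable {G : Upstream}

/-- Supersonic states with the enthalpy of the upstream state and at least its entropy. -/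
structure Compatible (G : Upstream) (V : State) : Prop where
  supersonic : V ∈ supersonicStates G.γ
  enthalpy : totalEnthalpy G.γ V = G.qs ^ 2 / 2
  entropy : negEntropy G.γ V ≤ negEntropy G.γ G.state₀

theorem negEntropy_state {α : ℝ} (h : α ∈ G.arc) :
    negEntropy G.γ (G.state α) = negEntropy G.γ G.state₀ := by
  show G.γ * Real.log (G.rho α) - Real.log (G.prs α) = G.γ * Real.log G.ρ - Real.log G.p
  have hr := arc_rho_pos h
  have hs := arc_snd_pos h
  have hγ := G.γ_pos
  have hγ1 := G.γ_sub_pos.ne'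
  have hc := div_pos hs G.c_pos
  have e1 : Real.log (G.prs α) = Real.log (G.rho α) + 2 * Real.log (G.snd α) - Real.log G.γ := by
    rw [prs, Real.log_div (mul_pos hr (pow_pos hs 2)).ne' hγ.ne', Real.log_mul hr.ne'
      (pow_pos hs 2).ne', Real.log_pow]
    norm_num
  have e2 : 2 * Real.log G.c = Real.log G.γ + Real.log G.p - Real.log G.ρ := by
    rw [← Real.log_mul hγ.ne' G.p_pos.ne', ← Real.log_div
      (mul_pos hγ G.p_pos).ne' G.ρ_pos.ne', ← c_sq, Real.log_pow]; norm_num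
  have e3 : (G.γ - 1) * Real.log (G.rho α) =
      (G.γ - 1) * Real.log G.ρ + 2 * (Real.log (G.snd α) - Real.log G.c) := by
    rw [rho, Real.log_mul G.ρ_pos.ne' (Real.rpow_pos_of_pos hc _).ne', Real.log_rpow hc,
      Real.log_div hs.ne' G.c_pos.ne']
    field_simp
  rw [e1]
  linear_combination e3 - e2

/-- An entropy at least that of U bounds the density by the isentropic value at the temperature of
V. -/
theorem dens_le {U V : State} (hU : U ∈ supersonicStates G.γ) (hV : V ∈ supersonicStates G.γ)
    (h : negEntropy G.γ V ≤ negEntropy G.γ U) :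
    dens V ≤ dens U * (pres V / dens V / (pres U / dens U)) ^ (1 / (G.γ - 1)) := by
  have hy : 0 < pres V / dens V / (pres U / dens U) :=
    div_pos (div_pos hV.1 hV.2.1) (div_pos hU.1 hU.2.1)
  have hγ1 := G.γ_sub_pos
  rw [← Real.log_le_log_iff hV.2.1 (mul_pos hU.2.1 (Real.rpow_pos_of_pos hy _)),
    Real.log_mul hU.2.1.ne' (Real.rpow_pos_of_pos hy _).ne', Real.log_rpow hy,
    Real.log_div (div_pos hV.1 hV.2.1).ne' (div_pos hU.1 hU.2.1).ne',
    Real.log_div hV.1.ne' hV.2.1.ne', Real.log_div hU.1.ne' hU.2.1.ne']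
  simp only [negEntropy] at h
  rw [← sub_le_iff_le_add', div_mul_eq_mul_div, one_mul, le_div_iff₀ hγ1]
  linarith

/-- The gas law is convex. -/
theorem pres_sub_ge {U V : State} (hU : U ∈ supersonicStates G.γ) (hV : V ∈ supersonicStates G.γ)
    (h : negEntropy G.γ V ≤ negEntropy G.γ U) :
    0 ≤ pres V - pres U - sonic G.γ U ^ 2 * (dens V - dens U) := by
  have hx : 0 < dens V / dens U := div_pos hV.2.1 hU.2.1
  have h1 : pres U * (dens V / dens U) ^ G.γ ≤ pres V := by
    rw [← Real.log_le_log_iff (mul_pos hU.1 (Real.rpow_pos_of_pos hx _)) hV.1,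
      Real.log_mul hU.1.ne' (Real.rpow_pos_of_pos hx _).ne', Real.log_rpow hx,
      Real.log_div hV.2.1.ne' hU.2.1.ne']
    simp only [negEntropy] at h
    linarith
  have h2 := one_add_mul_self_le_rpow_one_add (s := dens V / dens U - 1) (by linarith)
    G.one_lt.le
  rw [add_sub_cancel] at h2
  have h3 := mul_le_mul_of_nonneg_left h2 hU.1.le
  have h4 : pres U * (1 + G.γ * (dens V / dens U - 1)) =
      pres U + G.γ * pres U / dens U * (dens V - dens U) := by
    have := hU.2.1.ne'
    field_simp
  rw [(sonic_sq G.one_lt hU).1]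
  linarith

/-- The relative energy density is positive across any line that both flows cross
supersonically. -/
theorem rel_pos {U V : State} (hU : U ∈ supersonicStates G.γ)
    (hUB : totalEnthalpy G.γ U = G.qs ^ 2 / 2) (hUS : negEntropy G.γ U = negEntropy G.γ G.state₀)
    (hV : G.Compatible V) {e₁ e₂ : ℝ} (he : e₁ ^ 2 + e₂ ^ 2 = 1)
    (hUe : sonic G.γ U < velX U * e₁ + velY U * e₂)
    (hVe : sonic G.γ V ≤ velX V * e₁ + velY V * e₂) :
    0 ≤ e₁ * relEnergy G.γ U V + e₂ * relFlux G.γ U V ∧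
      (V ≠ U → 0 < e₁ * relEnergy G.γ U V + e₂ * relFlux G.γ U V) := by
  obtain ⟨hc2, hc0⟩ := sonic_sq G.one_lt hU
  obtain ⟨hd2, hd0⟩ := sonic_sq G.one_lt hV.supersonic
  have hVss := hV.supersonic
  have hγ1 := G.γ_sub_pos
  have hγ := G.γ_pos
  obtain ⟨T, hTd⟩ : ∃ T, T = pres U / dens U := ⟨_, rfl⟩
  have hT : 0 < T := by rw [hTd]; exact div_pos hU.1 hU.2.1
  obtain ⟨y, hyd⟩ : ∃ y, y = pres V / dens V / T := ⟨_, rfl⟩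
  have hy : 0 < y := by rw [hyd]; exact div_pos (div_pos hVss.1 hVss.2.1) hT
  have hyT : y * T = pres V / dens V := by rw [hyd]; field_simp
  have hpU : pres U = dens U * T := by rw [hTd]; have := hU.2.1.ne'; field_simp
  have hpV : pres V = dens V * (y * T) := by rw [hyT]; have := hVss.2.1.ne'; field_simp
  have hle : dens V ≤ dens U * y ^ (G.γ / (G.γ - 1) - 1) := by
    have := dens_le hU hVss (hV.entropy.trans hUS.ge)
    rw [← hTd, ← hyd] at this
    convert this using 3
    field_simp; ring
  have hB : G.γ / (G.γ - 1) * T * (y - 1) =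
      ((velX U ^ 2 + velY U ^ 2) - (velX V ^ 2 + velY V ^ 2)) / 2 := by
    have h1 := hUB.trans hV.enthalpy.symm
    simp only [totalEnthalpy] at h1
    rw [hpU, hpV] at h1
    have := hU.2.1.ne'; have := hVss.2.1.ne'
    field_simp at h1 ⊢
    linarith
  have hexp : e₁ * relEnergy G.γ U V + e₂ * relFlux G.γ U V =
      dens U * T * (velX U * e₁ + velY U * e₂) - dens V * ((velX V * e₁ + velY V * e₂) *
        (velX U * (velX V - velX U) + velY U * (velY V - velY U)) +
        y * T * (velX U * e₁ + velY U * e₂)) := by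
    simp only [relFlux, relEnergy, fluxX, fluxY, Matrix.cons_val]
    rw [hpU, hpV]
    ring
  have hpos : velX V ≠ velX U ∨ velY V ≠ velY U →
      0 < e₁ * relEnergy G.γ U V + e₂ * relFlux G.γ U V := by
    intro hne
    -- In the frame given by (e₁, e₂) the components along e play the roles of u and a in
    -- `energy_scalar`, with n = γ/(γ - 1). Its two supersonicity conditions are `hUe` and `hVe`.
    have hrot : velX U * (velX V - velX U) + velY U * (velY V - velY U) =
        (velX U * e₁ + velY U * e₂) * ((velX V * e₁ + velY V * e₂) - (velX U * e₁ + velY U * e₂)) +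
        (velY U * e₁ - velX U * e₂) *
          ((velY V * e₁ - velX V * e₂) - (velY U * e₁ - velX U * e₂)) := by
      linear_combination (-(velX U * (velX V - velX U) + velY U * (velY V - velY U))) * he
    have hn1 : ∀ a b : ℝ, (a * e₁ + b * e₂) ^ 2 + (b * e₁ - a * e₂) ^ 2 = a ^ 2 + b ^ 2 := by
      intro a b
      linear_combination (a ^ 2 + b ^ 2) * he
    rw [hexp, hrot]
    have hγn : G.γ / (G.γ - 1) - 1 = 1 / (G.γ - 1) := by field_simp; ring
    refine energy_scalar (n := G.γ / (G.γ - 1)) (ρ := dens U) ?_ hT hU.2.1 (hc0.trans hUe) ?_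
      hy.le (hd0.trans_le hVe) ?_ ?_ ?_ hVss.2.1 hle
    · rw [lt_div_iff₀ hγ1]; linarith
    · have h1 := pow_lt_pow_left₀ hUe hc0.le two_ne_zero
      rw [hc2, mul_div_assoc, ← hTd] at h1
      rw [hγn, div_mul_eq_mul_div, div_mul_eq_mul_div, one_mul]
      exact div_lt_div_of_pos_right h1 hγ1
    · have h1 := pow_le_pow_left₀ hd0.le hVe 2
      rw [hd2, mul_div_assoc, ← hyT] at h1
      rw [hγn, div_mul_eq_mul_div, div_mul_eq_mul_div, one_mul]
      exact div_le_div_of_nonneg_right h1 hγ1.le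
    · rw [hn1, hn1]; exact hB
    · by_contra hcon
      push Not at hcon
      obtain ⟨c1, c2⟩ := hcon
      have d1 : velX V = velX U := by
        linear_combination e₁ * c1 - e₂ * c2 + (velX U - velX V) * he
      have d2 : velY V = velY U := by
        linear_combination e₂ * c1 + e₁ * c2 + (velY U - velY V) * he
      exact hne.elim (fun h => h d1) fun h => h d2
  by_cases hne : velX V ≠ velX U ∨ velY V ≠ velY U
  · exact ⟨(hpos hne).le, fun _ => hpos hne⟩
  -- Equal velocities have equal temperatures by Bernoulli's law. Only the densities can then
  -- differ, and the entropy condition gives the sign.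
  · push Not at hne
    obtain ⟨d1, d2⟩ := hne
    have hy1 : y = 1 := by
      rw [d1, d2, sub_self, zero_div] at hB
      have h0 : G.γ / (G.γ - 1) * T ≠ 0 := (mul_pos (div_pos hγ hγ1) hT).ne'
      have := (mul_eq_zero.1 hB).resolve_left h0
      linarith
    have hval : e₁ * relEnergy G.γ U V + e₂ * relFlux G.γ U V =
        (dens U - dens V) * (T * (velX U * e₁ + velY U * e₂)) := by
      rw [hexp, d1, d2, hy1]; ring
    have hk : 0 < T * (velX U * e₁ + velY U * e₂) := mul_pos hT (hc0.trans hUe)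
    rw [hy1, Real.one_rpow, mul_one] at hle
    rw [hval]
    refine ⟨mul_nonneg (sub_nonneg.2 hle) hk.le, fun hVU => mul_pos (sub_pos.2 ?_) hk⟩
    refine lt_of_le_of_ne hle fun hd => hVU ?_
    ext i
    fin_cases i
    · exact d1
    · exact d2
    · show pres V = pres U
      rw [hpV, hpU, hd, hy1, one_mul]
    · exact hd

theorem relEnergy_nonneg {α : ℝ} (hα : α ∈ G.arc) {V : State} (hV : G.Compatible V) :
    0 ≤ relEnergy G.γ (G.state α) V ∧
      (relEnergy G.γ (G.state α) V = 0 → V = G.state α) := by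
  have h := rel_pos (state_supersonic hα) (totalEnthalpy_state hα) (negEntropy_state hα) hV
    (e₁ := 1) (e₂ := 0) (by norm_num) (by simpa using (state_supersonic hα).2.2)
    (by simpa using hV.supersonic.2.2.le)
  simp only [one_mul, zero_mul, add_zero] at h
  refine ⟨h.1, fun h0 => ?_⟩
  by_contra hne
  exact (h.2 hne).ne' h0

end Upstream

/-! ### Finite propagation speed for the relative energy -/

namespace Upstream

variable {G : Upstream}

theorem Compatible.sonic_sq_eq {V : State} (hV : G.Compatible V) :
    sonic G.γ V ^ 2 = G.cs ^ 2 -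
      (G.γ - 1) / 2 * (velX V ^ 2 + velY V ^ 2 - G.cs ^ 2) := by
  have h1 := hV.enthalpy
  have h2 := (sonic_sq G.one_lt hV.supersonic).1
  have hcs : (G.γ + 1) * G.cs ^ 2 = (G.γ - 1) * G.qs ^ 2 := by
    have := G.γ_add_pos.ne'
    rw [cs, mul_pow, k_sq]; field_simp
  have hr := hV.supersonic.2.1.ne'
  have hγ1 := G.γ_sub_pos.ne'
  have h3 : G.γ * pres V / ((G.γ - 1) * dens V) = sonic G.γ V ^ 2 / (G.γ - 1) := by
    rw [h2]; field_simp
  rw [totalEnthalpy, h3] at h1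
  field_simp at h1
  linear_combination h1 / 2 - hcs / 2

theorem relEnergy_upstream (V : State) : relEnergy G.γ G.state₀ V =
    G.u * (G.p - (pres V + dens V * velX V * (velX V - G.u))) := by
  simp only [relEnergy, fluxX, Matrix.cons_val]
  show (G.u ^ 2 + 0 ^ 2) * _ - G.u * _ - 0 * _ + G.p * G.u = _
  ring

theorem relFlux_upstream (V : State) : relFlux G.γ G.state₀ V =
    G.u * (dens V * velY V * (G.u - velX V)) := by
  simp only [relFlux, fluxY, Matrix.cons_val]
  show (G.u ^ 2 + 0 ^ 2) * _ - G.u * _ - 0 * _ + G.p * 0 = _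
  ring

theorem temp_ratio {V : State} (hV : G.Compatible V) :
    pres V / dens V / (G.p / G.ρ) =
      1 + (G.u ^ 2 - (velX V ^ 2 + velY V ^ 2)) * (G.γ - 1) / (2 * G.γ * (G.p / G.ρ)) := by
  have h1 := hV.enthalpy
  have h2 : totalEnthalpy G.γ G.state₀ = G.qs ^ 2 / 2 := by
    rw [← G.state_mach₀]; exact totalEnthalpy_state G.mach₀_mem_arc
  rw [← h2] at h1
  have h3 : totalEnthalpy G.γ G.state₀ = G.γ * G.p / ((G.γ - 1) * G.ρ) + (G.u ^ 2 + 0 ^ 2) / 2 := rfl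
  rw [h3] at h1
  simp only [totalEnthalpy] at h1
  have := hV.supersonic.2.1.ne'; have := G.γ_sub_pos.ne'; have := G.γ_pos.ne'
  have := G.p_pos.ne'; have := G.ρ_pos.ne'
  field_simp at h1 ⊢
  linear_combination h1

/-- Near the sonic states the relative energy with respect to the upstream state is bounded from
below. -/
theorem exists_near_sonic (G : Upstream) : ∃ ε > 0, ∃ κ > 0, ∀ V : State, G.Compatible V →
    G.cs < velX V → velX V ^ 2 + velY V ^ 2 < G.cs ^ 2 + ε → κ ≤ relEnergy G.γ G.state₀ V := by
  have hγ := G.γ_pos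
  have hγ1 := G.γ_sub_pos
  have hT : 0 < G.p / G.ρ := div_pos G.p_pos G.ρ_pos
  have hc2 : G.c ^ 2 = G.γ * (G.p / G.ρ) := by rw [c_sq, mul_div_assoc]
  let y : ℝ × ℝ → ℝ := fun q =>
    1 + (G.u ^ 2 - (q.1 ^ 2 + q.2 ^ 2)) * (G.γ - 1) / (2 * G.γ * (G.p / G.ρ))
  -- This is the relative energy of the state with velocity q and isentropic density. It is positive
  -- at (c_*, 0), the only point with q = c_* and u ≥ c_*, because c_* differs from u_∞.
  let m : ℝ × ℝ → ℝ := fun q => G.ρ * (G.p / G.ρ) * G.u - G.ρ * y q ^ (G.γ / (G.γ - 1) - 1) *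
    (q.1 * (G.u * (q.1 - G.u) + 0 * (q.2 - 0)) + y q * (G.p / G.ρ) * G.u)
  have hγn : G.γ / (G.γ - 1) - 1 = 1 / (G.γ - 1) := by field_simp; ring
  have hyv : y (G.cs, 0) * (G.γ * (G.p / G.ρ)) = G.cs ^ 2 := by
    simp only [y]
    rw [cs_sq, hc2]
    have := G.γ_add_pos.ne'; have := G.p_pos.ne'; have := G.ρ_pos.ne'
    field_simp
    ring
  have hy0 : 0 < y (G.cs, 0) := by
    have h1 := pow_pos G.cs_pos 2
    rw [← hyv] at h1
    exact pos_of_mul_pos_left h1 (mul_pos hγ hT).le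
  have hm0 : 0 < m (G.cs, 0) := by
    refine energy_scalar (n := G.γ / (G.γ - 1)) (v := 0) (b := 0) ?_ hT G.ρ_pos G.u_pos ?_
      hy0.le G.cs_pos ?_ ?_ (Or.inl G.cs_lt_u.ne)
      (mul_pos G.ρ_pos (Real.rpow_pos_of_pos hy0 _)) le_rfl
    · rw [lt_div_iff₀ hγ1]; linarith
    · rw [hγn, div_mul_eq_mul_div, div_mul_eq_mul_div, one_mul, ← hc2]
      exact div_lt_div_of_pos_right (pow_lt_pow_left₀ G.c_lt_u G.c_pos.le two_ne_zero) hγ1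
    · rw [hγn, div_mul_eq_mul_div, div_mul_eq_mul_div, one_mul, ← hyv]
      exact le_of_eq (by ring)
    · simp only [y]; have := G.p_pos.ne'; have := G.ρ_pos.ne'; field_simp; ring
  have hycont : ContinuousAt y (G.cs, 0) := by fun_prop
  have hmcont : ContinuousAt m (G.cs, 0) := by
    have := hycont.rpow_const (p := G.γ / (G.γ - 1) - 1) (Or.inl hy0.ne')
    fun_prop
  obtain ⟨δ, hδ, hball⟩ := Metric.eventually_nhds_iff.1
    (hmcont.tendsto.eventually_const_lt (half_lt_self hm0))
  -- Since u > c_*, the two bounds on ε force |v| < δ and u - c_* < δ. The value u_∞ p_∞ in κ covers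
  -- the case where the bracket multiplying the density is nonpositive.
  refine ⟨min (δ ^ 2) (δ * G.cs), lt_min (pow_pos hδ 2) (mul_pos hδ G.cs_pos),
    min (G.u * G.p) (m (G.cs, 0) / 2), lt_min (mul_pos G.u_pos G.p_pos) (half_pos hm0),
    fun V hV hcs hq => ?_⟩
  have h1 := hq.trans_le (add_le_add_right (min_le_left _ _) _)
  have h2 := hq.trans_le (add_le_add_right (min_le_right _ _) _)
  have hcs0 := G.cs_pos
  have hv : |velY V| < δ := by
    rw [← sq_lt_sq₀ (abs_nonneg _) hδ.le, sq_abs]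
    have := pow_lt_pow_left₀ hcs hcs0.le two_ne_zero
    linarith
  have hu : |velX V - G.cs| < δ := by
    rw [abs_of_pos (sub_pos.2 hcs), sub_lt_iff_lt_add']
    apply lt_of_pow_lt_pow_left₀ 2 (by linarith)
    have h3 := mul_pos hδ hcs0
    have h4 := pow_pos hδ 2
    have := sq_nonneg (velY V)
    linarith [add_sq G.cs δ]
  have hmV := hball (y := (velX V, velY V)) (by
    rw [Prod.dist_eq, Real.dist_eq, Real.dist_eq, sub_zero]
    exact max_lt hu hv)
  have hyV : y (velX V, velY V) = pres V / dens V / (G.p / G.ρ) := (temp_ratio hV).symm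
  have hle := dens_le (G := G) (U := G.state₀) (V := V)
    (by rw [← G.state_mach₀]; exact state_supersonic G.mach₀_mem_arc) hV.supersonic hV.entropy
  have hle' : dens V ≤ G.ρ * y (velX V, velY V) ^ (G.γ / (G.γ - 1) - 1) := by
    rw [hyV, hγn]; exact hle
  have hr := hV.supersonic.2.1
  have hpV : pres V = dens V * (y (velX V, velY V) * (G.p / G.ρ)) := by
    rw [hyV]; have := G.p_pos.ne'; have := G.ρ_pos.ne'; field_simp
  rw [relEnergy_upstream]
  obtain ⟨Y, hY⟩ : ∃ Y, Y = y (velX V, velY V) := ⟨_, rfl⟩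
  have hpρ : G.ρ * (G.p / G.ρ) = G.p := by have := G.ρ_pos.ne'; field_simp
  change m (G.cs, 0) / 2 < G.ρ * (G.p / G.ρ) * G.u -
    G.ρ * y (velX V, velY V) ^ (G.γ / (G.γ - 1) - 1) *
    (velX V * (G.u * (velX V - G.u) + 0 * (velY V - 0)) +
      y (velX V, velY V) * (G.p / G.ρ) * G.u) at hmV
  rw [← hY, hpρ] at hmV
  rw [← hY] at hle' hpV
  have hexp : G.u * (G.p - (pres V + dens V * velX V * (velX V - G.u))) =
      G.p * G.u - dens V * (velX V * (G.u * (velX V - G.u) + 0 * (velY V - 0)) +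
        Y * (G.p / G.ρ) * G.u) := by rw [hpV]; ring
  rw [hexp]
  rcases le_or_gt (velX V * (G.u * (velX V - G.u) + 0 * (velY V - 0)) +
        Y * (G.p / G.ρ) * G.u) 0 with h | h
  · refine (min_le_left _ _).trans ?_
    have := mul_nonneg hr.le (neg_nonneg.2 h)
    linarith
  · refine (min_le_right _ _).trans ?_
    have := mul_le_mul_of_nonneg_right hle' h.le
    linarith

/-- Lines of large slope are crossed by the relative energy in one direction only. -/
theorem exists_lateral (G : Upstream) : ∃ L ≥ 0, ∀ V : State, G.Compatible V →
    V ∈ region G.γ G.state₀ → 0 ≤ L * relEnergy G.γ G.state₀ V + relFlux G.γ G.state₀ V := by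
  obtain ⟨ε, hε, κ, hκ, hnear⟩ := exists_near_sonic G
  have hγ := G.γ_pos
  have hγ1 := G.γ_sub_pos
  have hT : 0 < G.p / G.ρ := div_pos G.p_pos G.ρ_pos
  have hss₀ : G.state₀ ∈ supersonicStates G.γ := by
    rw [← G.state_mach₀]; exact state_supersonic G.mach₀_mem_arc
  let c₁ := √(G.cs ^ 2 - (G.γ - 1) / 2 * ε)
  have hc₁ : c₁ < G.cs := by
    refine (Real.sqrt_lt' G.cs_pos).2 ?_
    have : 0 < (G.γ - 1) / 2 * ε := by positivity
    linarith
  have hc₁0 : 0 ≤ c₁ := Real.sqrt_nonneg _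
  let Y := 1 + G.u ^ 2 * (G.γ - 1) / (2 * G.γ * (G.p / G.ρ))
  let R₀ := G.ρ * Y ^ (1 / (G.γ - 1))
  let B := G.u * (R₀ * G.qs * (G.u + G.qs))
  -- The three lower bounds on L serve, in this order, the states near (c_*, 0), the supersonic
  -- crossing of the lines with normal direction (L, 1) by states with c ≤ c₁ < c_*, and the
  -- supersonic crossing by the upstream state.
  obtain ⟨L, hL⟩ : ∃ L, max (B / κ) (max ((c₁ + G.qs) / (G.cs - c₁)) (G.c / (G.u - G.c) + 1)) = L :=
    ⟨_, rfl⟩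
  have hL1 : B / κ ≤ L := by rw [← hL]; exact le_max_left _ _
  have hL2 : (c₁ + G.qs) / (G.cs - c₁) ≤ L := by
    rw [← hL]; exact (le_max_left _ _).trans (le_max_right _ _)
  have hL3 : G.c / (G.u - G.c) + 1 ≤ L := by
    rw [← hL]; exact (le_max_right _ _).trans (le_max_right _ _)
  have huc : 0 < G.u - G.c := sub_pos.2 G.c_lt_u
  have hL0 : 0 < L := by
    have := div_pos G.c_pos huc
    linarith
  refine ⟨L, hL0.le, fun V hV hreg => ?_⟩
  rw [region_state₀] at hreg
  obtain ⟨hcs, hq⟩ := hreg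
  have hq2 : velX V ^ 2 + velY V ^ 2 < G.qs ^ 2 := by
    have := (Real.sqrt_lt' G.qs_pos).1 hq
    exact this
  have hr := hV.supersonic.2.1
  have hvq : |velY V| ≤ G.qs := by
    rw [← sq_le_sq₀ (abs_nonneg _) G.qs_pos.le, sq_abs]
    linarith [sq_nonneg (velX V)]
  have huq : |velX V| ≤ G.qs := by
    rw [← sq_le_sq₀ (abs_nonneg _) G.qs_pos.le, sq_abs]
    linarith [sq_nonneg (velY V)]
  -- Near the sonic state (c_*, 0) characteristics become vertical and no fixed slope satisfies the
  -- hypotheses of `rel_pos`. There the lower bound κ of the energy, multiplied by L, dominates the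
  -- bounded flux.
  rcases lt_or_ge (velX V ^ 2 + velY V ^ 2) (G.cs ^ 2 + ε) with h | h
  · have h1 := hnear V hV hcs h
    have hle := dens_le (G := G) (U := G.state₀) (V := V) hss₀ hV.supersonic hV.entropy
    have hR : dens V ≤ R₀ := by
      refine hle.trans (mul_le_mul_of_nonneg_left ?_ G.ρ_pos.le)
      refine Real.rpow_le_rpow (div_nonneg (div_nonneg hV.supersonic.1.le hr.le) hT.le) ?_
        (by positivity)
      have h2 : pres V / dens V / (pres G.state₀ / dens G.state₀) = _ := temp_ratio hV
      rw [h2]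
      have : 0 < 2 * G.γ * (G.p / G.ρ) := by positivity
      simp only [Y]
      gcongr
      linarith [sq_nonneg (velX V), sq_nonneg (velY V)]
    have hB : |relFlux G.γ G.state₀ V| ≤ B := by
      rw [relFlux_upstream, abs_mul, abs_of_pos G.u_pos, abs_mul, abs_mul, abs_of_pos hr]
      refine mul_le_mul_of_nonneg_left ?_ G.u_pos.le
      have h3 : |G.u - velX V| ≤ G.u + G.qs := by
        refine (abs_sub _ _).trans ?_
        rw [abs_of_pos G.u_pos]
        linarith
      have hR0 : 0 ≤ R₀ := hr.le.trans hR
      exact mul_le_mul (mul_le_mul hR hvq (abs_nonneg _) hR0) h3 (abs_nonneg _)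
        (mul_nonneg hR0 G.qs_pos.le)
    have h4 := neg_le_of_abs_le hB
    rw [div_le_iff₀ hκ] at hL1
    have h5 := mul_le_mul_of_nonneg_left h1 hL0.le
    linarith
  · obtain ⟨s, hs⟩ : ∃ s, s = √(L ^ 2 + 1) := ⟨_, rfl⟩
    have hs0 : 0 < s := by rw [hs]; positivity
    have hs2 : s ^ 2 = L ^ 2 + 1 := by rw [hs]; exact Real.sq_sqrt (by positivity)
    have hsL : s ≤ L + 1 := by
      rw [hs]; apply Real.sqrt_le_iff.2 ⟨by linarith, by nlinarith⟩
    have hcV : sonic G.γ V ≤ c₁ := by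
      apply Real.le_sqrt_of_sq_le
      rw [hV.sonic_sq_eq]
      have := mul_le_mul_of_nonneg_left (a := (G.γ - 1) / 2) (by linarith :
        ε ≤ velX V ^ 2 + velY V ^ 2 - G.cs ^ 2) (by linarith)
      linarith
    have key := (rel_pos hss₀ (by rw [← G.state_mach₀]; exact totalEnthalpy_state G.mach₀_mem_arc)
      rfl hV (e₁ := L / s) (e₂ := 1 / s) (by field_simp; linarith) ?_ ?_).1
    · have : L * relEnergy G.γ G.state₀ V + relFlux G.γ G.state₀ V = s * (L / s *
          relEnergy G.γ G.state₀ V + 1 / s * relFlux G.γ G.state₀ V) := by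
        field_simp
      rw [this]
      exact mul_nonneg hs0.le key
    · show G.c < G.u * (L / s) + 0 * (1 / s)
      rw [zero_mul, add_zero, mul_div_assoc', lt_div_iff₀ hs0]
      have h1 : G.c < L * (G.u - G.c) := by
        rw [← div_lt_iff₀ huc]; linarith
      have := mul_le_mul_of_nonneg_left hsL G.c_pos.le
      linarith
    · refine hcV.trans ?_
      rw [mul_div_assoc', mul_one_div, ← add_div, le_div_iff₀ hs0]
      rw [div_le_iff₀ (sub_pos.2 hc₁)] at hL2
      have h1 := mul_le_mul_of_nonneg_left hsL hc₁0
      have h2 := mul_le_mul_of_nonneg_left hcs.le hL0.le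
      have h3 := neg_le_of_abs_le hvq
      linarith

end Upstream

/-! ### Admissible flows: entropy solutions extended by the upstream state -/

/-- Measurable and locally essentially bounded functions. -/
def LocMeas (O : Set (ℝ × ℝ)) (F : ℝ × ℝ → ℝ) : Prop :=
  AEStronglyMeasurable F (volume.restrict O) ∧ LocallyEssBounded O F

namespace LocMeas

variable {O : Set (ℝ × ℝ)} {F H : ℝ × ℝ → ℝ}

theorem add (hF : LocMeas O F) (hH : LocMeas O H) : LocMeas O fun z => F z + H z := by
  refine ⟨hF.1.add hH.1, fun R => ?_⟩
  obtain ⟨C, hC⟩ := hF.2 R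
  obtain ⟨D, hD⟩ := hH.2 R
  refine ⟨C + D, ?_⟩
  filter_upwards [hC, hD] with z h1 h2
  exact (abs_add_le _ _).trans (add_le_add h1 h2)

theorem neg (hF : LocMeas O F) : LocMeas O fun z => -F z := by
  refine ⟨hF.1.neg, fun R => ?_⟩
  obtain ⟨C, hC⟩ := hF.2 R
  refine ⟨C, ?_⟩
  filter_upwards [hC] with z h1
  rwa [abs_neg]

theorem sub (hF : LocMeas O F) (hH : LocMeas O H) : LocMeas O fun z => F z - H z := by
  simpa only [sub_eq_add_neg] using hF.add hH.neg

theorem mul (hF : LocMeas O F) (hH : LocMeas O H) : LocMeas O fun z => F z * H z := by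
  refine ⟨hF.1.mul hH.1, fun R => ?_⟩
  obtain ⟨C, hC⟩ := hF.2 R
  obtain ⟨D, hD⟩ := hH.2 R
  refine ⟨C * D, ?_⟩
  filter_upwards [hC, hD] with z h1 h2
  rw [abs_mul]
  exact mul_le_mul h1 h2 (abs_nonneg _) ((abs_nonneg _).trans h1)

theorem abs (hF : LocMeas O F) : LocMeas O fun z => |F z| := by
  refine ⟨hF.1.norm, fun R => ?_⟩
  obtain ⟨C, hC⟩ := hF.2 R
  refine ⟨C, ?_⟩
  filter_upwards [hC] with z h1
  rwa [abs_abs]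

theorem locallyIntegrableOn (hO : IsOpen O) (hF : LocMeas O F) : LocallyIntegrableOn F O :=
  hF.2.locallyIntegrableOn hO hF.1

theorem integrableOn (hF : LocMeas O F) {S : Set (ℝ × ℝ)} (hS : S ⊆ O)
    (hb : Bornology.IsBounded S) : IntegrableOn F S :=
  hF.2.integrableOn hF.1 hS hb

end LocMeas

theorem layer_subset_above (g : ℝ → ℝ) (R ε : ℝ) : layer g R ε ⊆ above g := fun _ hz => hz.2.2.1

/-- A function that is controlled near the wall by one with vanishing trace has vanishing trace. -/
theorem tendsto_layer_of_le {g : ℝ → ℝ} {K : NNReal} (hg : LipschitzWith K g) {A D F : ℝ × ℝ → ℝ}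
    {R : ℝ} (hD0 : ∀ z, 0 ≤ D z) (hDi : LocMeas (above g) D) (hF : LocMeas (above g) F)
    (hD : Tendsto (fun ε : ℝ => ε⁻¹ * ∫ z in layer g R ε, D z) (𝓝[>] 0) (𝓝 0))
    (hA : ∀ z, |A z| ≤ |F z| * D z) :
    Tendsto (fun ε : ℝ => ε⁻¹ * ∫ z in layer g R ε, |A z|) (𝓝[>] 0) (𝓝 0) := by
  obtain ⟨r, hr⟩ := (isBounded_layer hg R 1).subset_ball 0
  obtain ⟨C, hC⟩ := hF.2 r
  have h0 := hD.const_mul C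
  rw [mul_zero] at h0
  refine squeeze_zero' ?_ ?_ h0
  · filter_upwards [self_mem_nhdsWithin] with ε hε
    exact mul_nonneg (inv_nonneg.2 (le_of_lt hε)) (integral_nonneg fun z => abs_nonneg _)
  · filter_upwards [Ioo_mem_nhdsGT zero_lt_one] with ε hε
    rw [mul_left_comm]
    refine mul_le_mul_of_nonneg_left ?_ (inv_nonneg.2 hε.1.le)
    have hsub : layer g R ε ⊆ above g ∩ Metric.ball 0 r := fun z hz =>
      ⟨hz.2.2.1, hr ⟨hz.1, hz.2.1, hz.2.2.1, hz.2.2.2.trans (by linarith [hε.2])⟩⟩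
    rw [← integral_const_mul]
    refine integral_mono_of_nonneg (Eventually.of_forall fun z => abs_nonneg _)
      ((hDi.integrableOn (layer_subset_above g R ε) (isBounded_layer hg R ε)).const_mul C) ?_
    filter_upwards [ae_mono (Measure.restrict_mono hsub le_rfl) hC] with z hz
    exact (hA z).trans (mul_le_mul_of_nonneg_right hz (hD0 z))

theorem isOpen_supersonic (γ : ℝ) : IsOpen (supersonicStates γ) :=
  isOpen_iff_mem_nhds.2 isOpen_supersonicStates

/-- The upstream state for `x ≤ 0`, and `V` for `x > 0`. -/
def extend (G : Upstream) (V : ℝ × ℝ → State) (z : ℝ × ℝ) : State :=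
  if 0 < z.1 then V z else G.state₀

/-- Measurable flows that are uniformly supersonic on bounded sets. -/
structure Tame (γ : ℝ) (g : ℝ → ℝ) (V : ℝ × ℝ → State) : Prop where
  meas : AEStronglyMeasurable V (volume.restrict (above g))
  range : ∀ R : ℝ, ∃ S ⊆ supersonicStates γ, IsCompact S ∧
    ∀ᵐ z ∂(volume.restrict (above g ∩ Metric.ball 0 R)), V z ∈ S

theorem Tame.supersonic {γ : ℝ} {g : ℝ → ℝ} {V : ℝ × ℝ → State} (hg : Continuous g)
    (h : Tame γ g V) : ∀ᵐ z ∂(volume.restrict (above g)), V z ∈ supersonicStates γ := by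
  have hO := isOpen_above hg
  have h1 : ∀ n : ℕ, ∀ᵐ z : ℝ × ℝ, z ∈ above g ∩ Metric.ball 0 (n : ℝ) →
      V z ∈ supersonicStates γ := by
    intro n
    obtain ⟨S, hS, -, hae⟩ := h.range n
    rw [ae_restrict_iff' (hO.inter Metric.isOpen_ball).measurableSet] at hae
    filter_upwards [hae] with z hz hzm using hS (hz hzm)
  rw [ae_restrict_iff' hO.measurableSet]
  filter_upwards [ae_all_iff.2 h1] with z hz hza
  obtain ⟨n, hn⟩ := exists_nat_gt ‖z‖
  exact hz n ⟨hza, by rwa [mem_ball_zero_iff]⟩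

theorem Tame.comp {γ : ℝ} {g : ℝ → ℝ} {V : ℝ × ℝ → State} (hg : Continuous g)
    (h : Tame γ g V) {f : State → ℝ} (hf : ContinuousOn f (supersonicStates γ)) :
    LocMeas (above g) fun z => f (V z) := by
  classical
  constructor
  · have hm : Measurable ((supersonicStates γ).piecewise f fun _ => 0) :=
      hf.measurable_piecewise continuousOn_const (isOpen_supersonic γ).measurableSet
    have h1 : AEStronglyMeasurable (fun z => (supersonicStates γ).piecewise f (fun _ => 0) (V z))
        (volume.restrict (above g)) :=
      (hm.comp_aemeasurable h.meas.aemeasurable).aestronglyMeasurable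
    refine h1.congr ?_
    filter_upwards [h.supersonic hg] with z hz
    rw [piecewise_eq_of_mem _ _ _ hz]
  · intro R
    obtain ⟨S, hS, hSc, hae⟩ := h.range R
    obtain ⟨C, hC⟩ := (hSc.image_of_continuousOn (hf.mono hS)).isBounded.exists_norm_le
    refine ⟨C, ?_⟩
    filter_upwards [hae] with z hz
    exact hC _ (mem_image_of_mem _ hz)

theorem Tame.apply {γ : ℝ} {g : ℝ → ℝ} {V : ℝ × ℝ → State} (hg : Continuous g)
    (h : Tame γ g V) (i : Fin 4) : LocMeas (above g) fun z => V z i :=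
  h.comp hg (f := fun U => U i) (continuous_apply i).continuousOn

theorem continuousOn_fluxX {γ : ℝ} (hγ : 1 < γ) (i : Fin 4) :
    ContinuousOn (fun U => fluxX γ U i) (supersonicStates γ) := fun _ hU =>
  ((continuous_apply i).continuousAt.comp
    (contDiffAt_fluxX (n := 0) hγ hU.2.1).continuousAt).continuousWithinAt

theorem continuousOn_fluxY {γ : ℝ} (hγ : 1 < γ) (i : Fin 4) :
    ContinuousOn (fun U => fluxY γ U i) (supersonicStates γ) := fun _ hU =>
  ((continuous_apply i).continuousAt.comp
    (contDiffAt_fluxY (n := 0) hγ hU.2.1).continuousAt).continuousWithinAt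

/-- The flows above the wall, extended by the upstream state, that satisfy the entropy inequalities,
the slip condition and the bounds of the region `u > c_*`, `q < q_*`. -/
structure Admissible (G : Upstream) (g : ℝ → ℝ) (V : ℝ × ℝ → State) : Prop
    extends Tame G.γ g V where
  upstream : ∀ z : ℝ × ℝ, z.1 ≤ 0 → V z = G.state₀
  region : ∀ᵐ z ∂(volume.restrict (above g)), V z ∈ region G.γ G.state₀
  dissipative : ∀ η Q, IsConvexEntropyPair G.γ η Q →
    Dissipative (above g) (fun z => η (fluxX G.γ (V z))) fun z => Q (fluxX G.γ (V z))
  slip : ∀ R : ℝ, Tendsto (fun ε : ℝ => ε⁻¹ * ∫ z in layer g R ε,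
    |velX (V z) * wallW g z.1 - velY (V z)|) (𝓝[>] 0) (𝓝 0)

theorem state₀_supersonic (G : Upstream) : G.state₀ ∈ supersonicStates G.γ := by
  rw [← G.state_mach₀]; exact Upstream.state_supersonic G.mach₀_mem_arc

namespace Wall

variable {G : Upstream} {g : ℝ → ℝ} {K : NNReal}

theorem locMeas_slope (W : Wall G g K) : LocMeas (above g) fun z => wallW g z.1 := by
  refine ⟨(W.measurable_slope.comp measurable_fst).aestronglyMeasurable, fun R => ⟨K, ?_⟩⟩
  have h : ∀ᵐ z : ℝ × ℝ, HasDerivAt g (wallW g z.1) z.1 :=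
    Measure.quasiMeasurePreserving_fst.ae W.ae_hasDerivAt
  filter_upwards [ae_restrict_of_ae h] with z hz
  exact hz.le_of_lipschitz W.lip

theorem locMeas_defect (W : Wall G g K) {V : ℝ × ℝ → State} (hV : Tame G.γ g V) :
    LocMeas (above g) fun z => |velX (V z) * wallW g z.1 - velY (V z)| :=
  (((hV.apply W.lip.continuous 0).mul W.locMeas_slope).sub (hV.apply W.lip.continuous 1)).abs

theorem tame_extend (W : Wall G g K) {V : ℝ × ℝ → State}
    (hV : IsEntropySolution G.γ g G.state₀ V) : Tame G.γ g (extend G V) := by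
  classical
  have hm0 : MeasurableSet {z : ℝ × ℝ | 0 < z.1} :=
    (isOpen_lt continuous_const continuous_fst).measurableSet
  constructor
  · have h1 : AEStronglyMeasurable V ((volume.restrict (above g)).restrict {z | 0 < z.1}) := by
      rw [Measure.restrict_restrict hm0]
      exact hV.measurable
    have h2 := AEStronglyMeasurable.piecewise hm0 h1
      (aestronglyMeasurable_const (b := G.state₀))
    exact h2
  · intro R
    obtain ⟨S, hS, hSc, hae⟩ := hV.compact_range R
    refine ⟨S ∪ {G.state₀}, union_subset hS (singleton_subset_iff.2 (state₀_supersonic G)),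
      hSc.union isCompact_singleton, ?_⟩
    rw [ae_restrict_iff' ((isOpen_flowDomain W.lip.continuous).inter
      Metric.isOpen_ball).measurableSet] at hae
    rw [ae_restrict_iff' ((isOpen_above W.lip.continuous).inter Metric.isOpen_ball).measurableSet]
    filter_upwards [hae] with z hz hzm
    by_cases h0 : 0 < z.1
    · left
      rw [extend, if_pos h0]
      exact hz ⟨⟨h0, hzm.1⟩, hzm.2⟩
    · right
      rw [extend, if_neg h0]
      rfl

/-- The initial term of the entropy inequality is exactly the contribution of the half plane x ≤ 0
filled with U_∞. Smooth test functions are then replaced by Lipschitz ones. -/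
theorem dissipative_extend (W : Wall G g K) {V : ℝ × ℝ → State}
    (hV : IsEntropySolution G.γ g G.state₀ V) {η Q : (Fin 4 → ℝ) → ℝ}
    (h : IsConvexEntropyPair G.γ η Q) : Dissipative (above g)
      (fun z => η (fluxX G.γ (extend G V z))) fun z => Q (fluxX G.γ (extend G V z)) := by
  have hg := W.lip.continuous
  have hO := isOpen_above hg
  have hT := W.tame_extend hV
  have hη : ContinuousOn (fun U => η (fluxX G.γ U)) (supersonicStates G.γ) := fun U hU =>
    (ContinuousAt.comp (f := fluxX G.γ) (h.smooth_entropy U hU).continuousAt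
      (contDiffAt_fluxX (n := 0) G.one_lt hU.2.1).continuousAt).continuousWithinAt
  have hQ : ContinuousOn (fun U => Q (fluxX G.γ U)) (supersonicStates G.γ) := fun U hU =>
    (ContinuousAt.comp (f := fluxX G.γ) (h.smooth_flux U hU).continuousAt
      (contDiffAt_fluxX (n := 0) G.one_lt hU.2.1).continuousAt).continuousWithinAt
  have iη := (hT.comp hg hη).locallyIntegrableOn hO
  have iQ := (hT.comp hg hQ).locallyIntegrableOn hO
  refine dissipative_of_smooth hO iη iQ fun ψ hψ hc hs h0 => ?_
  obtain ⟨C, hC⟩ := lipschitz_of_smooth hψ hc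
  rw [integral_above_eq hg W.flat hψ hc hs (a := η (fluxX G.γ G.state₀))
    (b := Q (fluxX G.γ G.state₀)) (fun z _ hz0 => by
      rw [extend, if_neg hz0.not_gt]; exact ⟨rfl, rfl⟩) (Dissipative.integrable iη iQ hC hc hs)]
  refine (hV.entropy η Q h ψ hψ hc hs h0).trans (le_of_eq ?_)
  congr 1
  refine setIntegral_congr_fun (isOpen_flowDomain hg).measurableSet fun z hz => ?_
  simp only [extend, if_pos hz.1]

/-- The normalizing factor √(1 + w²) is locally bounded, so removing it does not affect the
vanishing of the trace. -/
theorem slip_extend (W : Wall G g K) {V : ℝ × ℝ → State}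
    (hV : IsEntropySolution G.γ g G.state₀ V) (R : ℝ) :
    Tendsto (fun ε : ℝ => ε⁻¹ * ∫ z in layer g R ε,
      |velX (extend G V z) * wallW g z.1 - velY (extend G V z)|) (𝓝[>] 0) (𝓝 0) := by
  have hg := W.lip.continuous
  have h1 := hV.slip R
  have hT := W.tame_extend hV
  have hs0 : ∀ x, 0 < √(1 + wallW g x ^ 2) := fun x => Real.sqrt_pos.2 (by positivity)
  have hdef := W.locMeas_defect hT
  have hsq : LocMeas (above g) fun z => √(1 + wallW g z.1 ^ 2) := by
    refine ⟨((W.measurable_slope.comp measurable_fst).pow_const 2).const_add 1 |>.sqrt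
      |>.aestronglyMeasurable, fun R => ?_⟩
    obtain ⟨C, hC⟩ := W.locMeas_slope.2 R
    refine ⟨√(1 + C ^ 2), ?_⟩
    filter_upwards [hC] with z hz
    rw [abs_of_pos (hs0 _)]
    apply Real.sqrt_le_sqrt
    rw [← sq_abs (wallW g z.1)]
    have := pow_le_pow_left₀ (abs_nonneg _) hz 2
    linarith
  have hquot : LocMeas (above g) fun z => |(velX (extend G V z) * wallW g z.1 -
      velY (extend G V z)) / √(1 + wallW g z.1 ^ 2)| := by
    refine ⟨?_, fun R => ?_⟩
    · have h2 : Measurable fun z : ℝ × ℝ => √(1 + wallW g z.1 ^ 2) :=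
        ((W.measurable_slope.comp measurable_fst).pow_const 2).const_add 1 |>.sqrt
      exact ((((hT.apply hg 0).mul W.locMeas_slope).sub (hT.apply hg 1)).1.div₀
        h2.aestronglyMeasurable).norm
    · obtain ⟨C, hC⟩ := hdef.2 R
      refine ⟨C, ?_⟩
      filter_upwards [hC] with z hz
      rw [abs_abs] at hz ⊢
      rw [abs_div]
      refine (div_le_self (abs_nonneg _) ?_).trans hz
      rw [abs_of_pos (hs0 _)]
      exact Real.one_le_sqrt.2 (by linarith [sq_nonneg (wallW g z.1)])
  refine tendsto_layer_of_le W.lip (fun z => abs_nonneg _) hquot hsq ?_ fun z => ?_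
  · refine h1.congr fun ε => ?_
    congr 1
    refine setIntegral_congr_fun (measurableSet_layer hg R ε) fun z hz => ?_
    simp only [extend, if_pos hz.1, wallW_of_pos hz.1]
  · rw [abs_div]
    have := (hs0 z.1).ne'
    rw [abs_of_pos (hs0 z.1)]
    field_simp
    exact le_rfl

theorem admissible_extend (W : Wall G g K) {V : ℝ × ℝ → State}
    (hV : IsEntropySolution G.γ g G.state₀ V)
    (hreg : ∀ᵐ z ∂(volume.restrict (flowDomain g)), V z ∈ SteadyEuler.region G.γ G.state₀) :
    Admissible G g (extend G V) where
  toTame := W.tame_extend hV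
  upstream := fun z hz => by rw [extend, if_neg hz.not_gt]
  region := by
    rw [ae_restrict_iff' (isOpen_flowDomain W.lip.continuous).measurableSet] at hreg
    rw [ae_restrict_iff' (isOpen_above W.lip.continuous).measurableSet]
    filter_upwards [hreg] with z hz hza
    by_cases h0 : 0 < z.1
    · rw [extend, if_pos h0]; exact hz ⟨h0, hza⟩
    · rw [extend, if_neg h0, Upstream.region_state₀, ← G.state_mach₀]
      exact Upstream.region_state G.mach₀_mem_arc
  dissipative := fun η Q h => W.dissipative_extend hV h
  slip := W.slip_extend hV

theorem extend_fanState (W : Wall G g K) {z : ℝ × ℝ} (hz : z ∈ above g) :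
    extend G (fanState G g) z = fanState G g z := by
  by_cases h0 : 0 < z.1
  · rw [extend, if_pos h0]
  · rw [extend, if_neg h0, W.fanState_of_nonpos hz (not_lt.1 h0)]

end Wall

theorem Dissipative.congr_ae {O : Set (ℝ × ℝ)} {F G F' G' : ℝ × ℝ → ℝ} (h : Dissipative O F G)
    (hF : ∀ᵐ z ∂(volume.restrict O), F z = F' z) (hG : ∀ᵐ z ∂(volume.restrict O), G z = G' z) :
    Dissipative O F' G' := fun χ h1 h2 h3 h4 => by
  refine (h χ h1 h2 h3 h4).trans (le_of_eq (integral_congr_ae ?_))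
  filter_upwards [hF, hG] with z hz hz'
  rw [hz, hz']

/-! ### Enthalpy and entropy of an admissible flow -/

namespace Admissible

variable {G : Upstream} {g : ℝ → ℝ} {K : NNReal} {V : ℝ × ℝ → State}

theorem dissipative_state (W : Wall G g K) (hV : Admissible G g V) {a b : State → ℝ}
    (h : IsConvexEntropyPair G.γ (a ∘ fluxInv G.γ) (b ∘ fluxInv G.γ)) :
    Dissipative (above g) (fun z => a (V z)) fun z => b (V z) := by
  have hs := hV.supersonic W.lip.continuous
  refine (hV.dissipative _ _ h).congr_ae ?_ ?_ <;>
  · filter_upwards [hs] with z hz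
    rw [Function.comp_apply, fluxInv_fluxX G.one_lt hz]

/-- Transported quantities that vanish upstream and are dissipated vanish. -/
theorem transport_eq_zero (W : Wall G g K) (hV : Admissible G g V) {f : State → ℝ}
    (hf : ContinuousOn f (supersonicStates G.γ)) (hf0 : ∀ U ∈ supersonicStates G.γ, 0 ≤ f U)
    (hfu : f G.state₀ = 0)
    (hdis : Dissipative (above g) (fun z => fluxX G.γ (V z) 0 * f (V z))
      fun z => fluxY G.γ (V z) 0 * f (V z)) :
    ∀ᵐ z ∂(volume.restrict (above g)), f (V z) = 0 := by
  have hg := W.lip.continuous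
  have hΦ := hV.comp hg ((continuousOn_fluxX G.one_lt 0).mul hf)
  have hΨ := hV.comp hg ((continuousOn_fluxY G.one_lt 0).mul hf)
  have hs := hV.supersonic hg
  have hcs := G.cs_pos
  have hreg := hV.region
  rw [Upstream.region_state₀] at hreg
  have key := ae_eq_zero_of_dissipative W.lip W.ae_hasDerivAt W.measurable_slope hΦ.1 hΨ.1 hΦ.2 hΨ.2
    (fun z hz => by
      simp only [Pi.mul_apply]
      rw [hV.upstream z hz, hfu, mul_zero, mul_zero]; exact ⟨rfl, rfl⟩) hdis ?_ ?_ ?_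
  · filter_upwards [key, hs, hreg] with z hz h1 h2
    refine (mul_eq_zero.1 hz).resolve_left (mul_pos h1.2.1 (hcs.trans h2.1)).ne'
  · filter_upwards [hs, hreg] with z h1 h2
    exact mul_nonneg (mul_pos h1.2.1 (hcs.trans h2.1)).le (hf0 _ h1)
  · intro X
    -- In the region u > c_* and |v| < q_*, so the slopes of streamlines are bounded by q_*/c_*.
    refine ⟨G.qs / G.cs, (div_pos G.qs_pos hcs).le, 0, ?_⟩
    filter_upwards [hs, hreg] with z h1 h2 _ _ _
    have h3 : |velY (V z)| ≤ speed (V z) := Real.abs_le_sqrt (by linarith [sq_nonneg (velX (V z))])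
    have h4 := neg_le_of_abs_le (h3.trans h2.2.le)
    have h5 : G.qs ≤ G.qs / G.cs * velX (V z) := by
      rw [div_mul_eq_mul_div, le_div_iff₀ hcs]
      exact mul_le_mul_of_nonneg_left h2.1.le G.qs_pos.le
    have h6 : G.qs / G.cs * (fluxX G.γ (V z) 0 * f (V z)) + fluxY G.γ (V z) 0 * f (V z) =
        dens (V z) * f (V z) * (G.qs / G.cs * velX (V z) + velY (V z)) := by
      simp only [fluxX, fluxY, Matrix.cons_val]; ring
    show 0 ≤ G.qs / G.cs * (fluxX G.γ (V z) 0 * f (V z)) + fluxY G.γ (V z) 0 * f (V z)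
    rw [h6]
    exact mul_nonneg (mul_nonneg h1.2.1.le (hf0 _ h1)) (by linarith)
  · intro R
    refine tendsto_layer_of_le W.lip (fun z => abs_nonneg _) (W.locMeas_defect hV.toTame)
      (hV.comp hg ((continuous_apply 3).continuousOn.mul hf)) (hV.slip R) fun z => le_of_eq ?_
    rw [← abs_mul, ← abs_neg]
    congr 1
    simp only [Pi.mul_apply, fluxX, fluxY, Matrix.cons_val, dens]
    ring

theorem enthalpy_eq (W : Wall G g K) (hV : Admissible G g V) :
    ∀ᵐ z ∂(volume.restrict (above g)), totalEnthalpy G.γ (V z) = G.qs ^ 2 / 2 := by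
  obtain ⟨b, hb⟩ : ∃ b, b = G.qs ^ 2 / 2 := ⟨_, rfl⟩
  rw [← hb]
  have hE : totalEnthalpy G.γ G.state₀ = b := by
    rw [hb, ← G.state_mach₀]; exact Upstream.totalEnthalpy_state G.mach₀_mem_arc
  have hc : ContinuousOn (fun U => (totalEnthalpy G.γ U - b) ^ 2) (supersonicStates G.γ) :=
    fun U hU => (((contDiffAt_totalEnthalpy (n := 0) G.one_lt hU.2.1).continuousAt.sub
      continuousAt_const).pow 2).continuousWithinAt
  have hd := hV.dissipative_state W (isConvexEntropyPair_enthalpy G.one_lt b)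
  have h1 := hV.transport_eq_zero W hc (fun U _ => sq_nonneg _) (by rw [hE, sub_self, sq, zero_mul])
    hd
  filter_upwards [h1] with z hz
  exact sub_eq_zero.1 ((pow_eq_zero_iff two_ne_zero).1 hz)

/-- Shocks in V may raise the entropy, so only an inequality can be expected. It is all that the
positivity and the dissipation of the relative energy use. -/
theorem negEntropy_le (W : Wall G g K) (hV : Admissible G g V) :
    ∀ᵐ z ∂(volume.restrict (above g)), negEntropy G.γ (V z) ≤ negEntropy G.γ G.state₀ := by
  obtain ⟨b, hb⟩ : ∃ b, b = negEntropy G.γ G.state₀ := ⟨_, rfl⟩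
  rw [← hb]
  have hc : ContinuousOn (fun U => max (negEntropy G.γ U - b) 0 ^ 3) (supersonicStates G.γ) := by
    intro U hU
    have hd : ContinuousAt (fun U : State => Real.log (dens U)) U :=
      ContinuousAt.log (continuous_apply 3).continuousAt hU.2.1.ne'
    have hp : ContinuousAt (fun U : State => Real.log (pres U)) U :=
      ContinuousAt.log (continuous_apply 2).continuousAt hU.1.ne'
    have hs : ContinuousAt (negEntropy G.γ) U := (continuousAt_const.mul hd).sub hp
    have hm : ContinuousAt (fun U => max (negEntropy G.γ U - b) 0) U :=
      (hs.sub continuousAt_const).max continuousAt_const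
    exact (hm.pow 3).continuousWithinAt
  have hd := hV.dissipative_state W (isConvexEntropyPair_negEntropy G.one_lt b)
  have h1 := hV.transport_eq_zero W hc (fun U _ => pow_nonneg (le_max_right _ _) 3)
    (by rw [hb, sub_self, max_self, zero_pow three_ne_zero]) hd
  filter_upwards [h1] with z hz
  have := (pow_eq_zero_iff three_ne_zero).1 hz
  exact sub_nonpos.1 ((le_max_left _ _).trans this.le)

theorem compatible (W : Wall G g K) (hV : Admissible G g V) :
    ∀ᵐ z ∂(volume.restrict (above g)), G.Compatible (V z) := by
  filter_upwards [hV.supersonic W.lip.continuous, hV.enthalpy_eq W, hV.negEntropy_le W]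
    with z h1 h2 h3 using ⟨h1, h2, h3⟩

end Admissible

/-! ### Dissipation of the relative energy -/

theorem integral_fderiv_eq_zero {θ : ℝ × ℝ → ℝ} {C : NNReal} (hθ : LipschitzWith C θ)
    (hc : HasCompactSupport θ) (v : ℝ × ℝ) : ∫ z, fderiv ℝ θ z v = 0 := by
  have h := integral_mul_fderiv (LipschitzWith.const (1 : ℝ) : LipschitzWith 0 _) hθ hc v
  simpa using h

theorem setIntegral_fderiv_eq_zero {O : Set (ℝ × ℝ)} {θ : ℝ × ℝ → ℝ} {C : NNReal}
    (hθ : LipschitzWith C θ) (hc : HasCompactSupport θ) (hs : tsupport θ ⊆ O) (v : ℝ × ℝ) :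
    ∫ z in O, fderiv ℝ θ z v = 0 := by
  rw [setIntegral_eq_integral_of_forall_compl_eq_zero fun z hz => ?_, integral_fderiv_eq_zero hθ hc]
  rw [fderiv_eq_zero_of_notMem_tsupport fun h => hz (hs h)]
  rfl

/-- A weak conservation law, tested with a product of Lipschitz functions. -/
theorem integral_test_mul {O : Set (ℝ × ℝ)} {F H : ℝ × ℝ → ℝ}
    (hF : LocallyIntegrableOn F O) (hH : LocallyIntegrableOn H O)
    (h0 : ∀ (θ : ℝ × ℝ → ℝ) (C : NNReal), LipschitzWith C θ → HasCompactSupport θ →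
      tsupport θ ⊆ O → ∫ z in O, (F z * fderiv ℝ θ z (1, 0) + H z * fderiv ℝ θ z (0, 1)) = 0)
    {b χ : ℝ × ℝ → ℝ} {B C : NNReal} {A : ℝ} (hb : LipschitzWith B b) (hbA : ∀ z, |b z| ≤ A)
    (hχ : LipschitzWith C χ) (hc : HasCompactSupport χ) (hs : tsupport χ ⊆ O) :
    IntegrableOn (fun z => b z * (F z * fderiv ℝ χ z (1, 0) + H z * fderiv ℝ χ z (0, 1)) +
      χ z * (F z * fderiv ℝ b z (1, 0) + H z * fderiv ℝ b z (0, 1))) O ∧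
    ∫ z in O, (b z * (F z * fderiv ℝ χ z (1, 0) + H z * fderiv ℝ χ z (0, 1)) +
      χ z * (F z * fderiv ℝ b z (1, 0) + H z * fderiv ℝ b z (0, 1))) = 0 := by
  obtain ⟨D, hD⟩ := hχ.continuous.bounded_above_of_compact_support hc
  obtain ⟨E, hE⟩ := lipschitzWith_mul_of_bounded hb hχ hbA hD
  have hcE : HasCompactSupport fun z => b z * χ z := hc.mul_left
  have hsE : tsupport (fun z => b z * χ z) ⊆ O := (tsupport_mul_subset_right).trans hs
  have hae : (fun z => F z * fderiv ℝ (fun z => b z * χ z) z (1, 0) +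
      H z * fderiv ℝ (fun z => b z * χ z) z (0, 1)) =ᵐ[volume.restrict O] fun z =>
      b z * (F z * fderiv ℝ χ z (1, 0) + H z * fderiv ℝ χ z (0, 1)) +
      χ z * (F z * fderiv ℝ b z (1, 0) + H z * fderiv ℝ b z (0, 1)) := by
    filter_upwards [ae_restrict_of_ae (hb.ae_differentiableAt (μ := volume)),
      ae_restrict_of_ae (hχ.ae_differentiableAt (μ := volume))] with z h1 h2
    have h3 : fderiv ℝ (fun z => b z * χ z) z = b z • fderiv ℝ χ z + χ z • fderiv ℝ b z :=
      (h1.hasFDerivAt.mul h2.hasFDerivAt).fderiv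
    have h4 : ∀ v, fderiv ℝ (fun z => b z * χ z) z v =
        b z * fderiv ℝ χ z v + χ z * fderiv ℝ b z v := fun v => by rw [h3]; rfl
    rw [h4, h4]
    ring
  exact ⟨(Dissipative.integrable hF hH hE hcE hsE).congr hae,
    (integral_congr_ae hae).symm.trans (h0 _ _ hE hcE hsE)⟩

variable {G : Upstream} {g : ℝ → ℝ} {K : NNReal} {V : ℝ × ℝ → State}

/-- A conserved quantity and its negative are both convex entropies, so the two inequalities combine
to an equality for signed test functions. -/
theorem Admissible.conservation (W : Wall G g K) (hV : Admissible G g V) (i : Fin 4)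
    {θ : ℝ × ℝ → ℝ} {C : NNReal} (hθ : LipschitzWith C θ) (hc : HasCompactSupport θ)
    (hs : tsupport θ ⊆ above g) : ∫ z in above g, (fluxX G.γ (V z) i * fderiv ℝ θ z (1, 0) +
      fluxY G.γ (V z) i * fderiv ℝ θ z (0, 1)) = 0 := by
  have hg := W.lip.continuous
  have hO := isOpen_above hg
  have h1 := hV.dissipative_state W (isConvexEntropyPair_linear G.one_lt 1 i)
  have h2 := hV.dissipative_state W (isConvexEntropyPair_linear G.one_lt (-1) i)
  simp only [one_mul, neg_mul] at h1 h2
  exact Dissipative.integral_eq_zero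
    ((hV.comp hg (continuousOn_fluxX G.one_lt i)).locallyIntegrableOn hO)
    ((hV.comp hg (continuousOn_fluxY G.one_lt i)).locallyIntegrableOn hO) h1 h2 hθ hc hs

theorem Wall.locMeas_relEnergy (W : Wall G g K) {U : ℝ × ℝ → State} (hU : Tame G.γ g U)
    (hV : Tame G.γ g V) : LocMeas (above g) (fun z => relEnergy G.γ (U z) (V z)) ∧
      LocMeas (above g) fun z => relFlux G.γ (U z) (V z) := by
  have hg := W.lip.continuous
  have hu := hU.apply hg 0
  have hv := hU.apply hg 1
  have hp := hU.apply hg 2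
  have hX := fun i => hV.comp hg (continuousOn_fluxX G.one_lt i)
  have hY := fun i => hV.comp hg (continuousOn_fluxY G.one_lt i)
  have hq := (hu.mul hu).add (hv.mul hv)
  constructor
  · have h := ((((hq.mul (hX 0)).sub (hu.mul (hX 1))).sub (hv.mul (hX 2)))).add (hp.mul hu)
    simpa only [relEnergy, velX, velY, pres, sq] using h
  · have h := ((((hq.mul (hY 0)).sub (hu.mul (hY 1))).sub (hv.mul (hY 2)))).add (hp.mul hv)
    simpa only [relFlux, velX, velY, pres, sq] using h

/-- The production of relative energy in a rarefaction wave. `t` is the strength of the wave. -/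
theorem Upstream.relEnergy_production {α : ℝ} (hα : α ∈ G.arc) {U : State} (hU : G.Compatible U)
    {t ax ay : ℝ} (hx : ax = -Real.sin α * t) (hy : ay = Real.cos α * t) (ht : 0 ≤ t) :
    (-2 * (1 - G.k ^ 2) * G.tang α * G.snd α) * (fluxX G.γ U 0 * ax + fluxY G.γ U 0 * ay) +
      ((1 - G.k ^ 2) * G.tang α * Real.sin α) * (fluxX G.γ U 1 * ax + fluxY G.γ U 1 * ay) +
      (-(1 - G.k ^ 2) * G.tang α * Real.cos α) * (fluxX G.γ U 2 * ax + fluxY G.γ U 2 * ay) +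
      (G.rho α * (2 / (G.γ + 1)) * G.tang α * G.snd α * G.velU α +
        G.prs α * (-(1 - G.k ^ 2) * G.tang α * Real.sin α)) * ax +
      (G.rho α * (2 / (G.γ + 1)) * G.tang α * G.snd α * G.velV α +
        G.prs α * ((1 - G.k ^ 2) * G.tang α * Real.cos α)) * ay ≤ 0 := by
  have h1 : 0 ≤ pres U - G.prs α - G.snd α ^ 2 * (dens U - G.rho α) := by
    have := pres_sub_ge (state_supersonic hα) hU.supersonic
      (hU.entropy.trans (negEntropy_state hα).ge)
    rwa [sonic_state hα] at this
  have hκ : 0 ≤ (1 - G.k ^ 2) * G.tang α := by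
    rw [one_sub_k_sq]
    exact mul_nonneg (div_pos two_pos G.γ_add_pos).le (arc_tang_pos hα).le
  have hd := hU.supersonic.2.1
  -- The production is the negative of this product: a square of the defect in normal velocity plus
  -- the excess of the pressure over its tangent line in ρ. The factor t ≥ 0 expresses that the wave
  -- expands.
  have h2 : 0 ≤ t * ((1 - G.k ^ 2) * G.tang α) *
      (dens U * (velX U * Real.sin α - velY U * Real.cos α - G.snd α) ^ 2 +
        (pres U - G.prs α - G.snd α ^ 2 * (dens U - G.rho α))) :=
    mul_nonneg (mul_nonneg ht hκ) (add_nonneg (mul_nonneg hd.le (sq_nonneg _)) h1)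
  have h3 := G.vel_normal α
  have h4 := Real.sin_sq_add_cos_sq α
  rw [← one_sub_k_sq, hx, hy]
  simp only [fluxX, fluxY, Matrix.cons_val]
  refine le_of_eq_of_le ?_ (neg_nonpos.2 h2)
  linear_combination (-(G.rho α * (1 - G.k ^ 2) * G.tang α * G.snd α) * t) * h3 +
    (G.prs α - pres U) * (1 - G.k ^ 2) * G.tang α * t * h4

theorem Wall.admissible_fanState (W : Wall G g K) : Admissible G g (extend G (fanState G g)) :=
  W.admissible_extend W.isEntropySolution_fanState <| by
    rw [ae_restrict_iff' (isOpen_flowDomain W.lip.continuous).measurableSet]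
    exact Eventually.of_forall fun z hz => W.region_fanState (flowDomain_subset g hz)

/-- The relative energy of an admissible flow with respect to the fan is dissipated. -/
theorem Admissible.relEnergy_dissipative (W : Wall G g K) (hV : Admissible G g V) :
    Dissipative (above g) (fun z => relEnergy G.γ (extend G (fanState G g) z) (V z))
      fun z => relFlux G.γ (extend G (fanState G g) z) (V z) := by
  rintro χ ⟨C, hχ⟩ hc hs h0
  have hg := W.lip.continuous
  have hO := isOpen_above hg
  obtain ⟨hΦ, hΨ⟩ := W.locMeas_relEnergy W.admissible_fanState.toTame hV.toTame
  have hint := Dissipative.integrable (hΦ.locallyIntegrableOn hO) (hΨ.locallyIntegrableOn hO) hχ hc hs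
  obtain ⟨B, a, O, β, ha, -, hSO, hOg, heq, hmem, hsub, hae⟩ := W.exists_lipschitz_angle hc hs
  have hst := fun α (hα : α ∈ G.arc) i => Wall.contDiffAt_state_apply (G := G) hα i
  -- Relative energy and flux combine the first three flux pairs of V with the constant pairs (1, 0)
  -- and (0, 1), the coefficients being functions of the angle. Each weak conservation law is tested
  -- with its coefficient times χ.
  have test : ∀ {F H : ℝ × ℝ → ℝ} {f : ℝ → ℝ}, (∀ α ∈ G.arc, ContDiffAt ℝ 1 f α) →
      LocallyIntegrableOn F (above g) → LocallyIntegrableOn H (above g) →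
      (∀ (θ : ℝ × ℝ → ℝ) (C : NNReal), LipschitzWith C θ → HasCompactSupport θ →
        tsupport θ ⊆ above g →
        ∫ z in above g, (F z * fderiv ℝ θ z (1, 0) + H z * fderiv ℝ θ z (0, 1)) = 0) →
      IntegrableOn (fun z => f (a z) * (F z * fderiv ℝ χ z (1, 0) + H z * fderiv ℝ χ z (0, 1)) +
        χ z * (F z * fderiv ℝ (fun z => f (a z)) z (1, 0) +
          H z * fderiv ℝ (fun z => f (a z)) z (0, 1))) (above g) ∧
      ∫ z in above g, (f (a z) * (F z * fderiv ℝ χ z (1, 0) + H z * fderiv ℝ χ z (0, 1)) +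
        χ z * (F z * fderiv ℝ (fun z => f (a z)) z (1, 0) +
          H z * fderiv ℝ (fun z => f (a z)) z (0, 1))) = 0 := by
    intro F H f hf hF hH hcons
    obtain ⟨D, hD⟩ := Wall.lipschitz_comp_angle ha hmem hsub hf
    have hfc : ContinuousOn f (Icc β G.mach₀) := fun α hα =>
      (hf α (hsub hα)).continuousAt.continuousWithinAt
    obtain ⟨A, hA⟩ := (isCompact_Icc.image_of_continuousOn hfc).isBounded.exists_norm_le
    exact integral_test_mul hF hH hcons hD (fun z => hA _ (mem_image_of_mem _ (hmem z))) hχ hc hs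
  have hX := fun i => (hV.comp hg (continuousOn_fluxX G.one_lt i)).locallyIntegrableOn hO
  have hY := fun i => (hV.comp hg (continuousOn_fluxY G.one_lt i)).locallyIntegrableOn hO
  have hcons := fun i (θ : ℝ × ℝ → ℝ) (C : NNReal) (h1 : LipschitzWith C θ)
    (h2 : HasCompactSupport θ) (h3 : tsupport θ ⊆ above g) => hV.conservation W i h1 h2 h3
  have hone : LocallyIntegrableOn (fun _ : ℝ × ℝ => (1 : ℝ)) (above g) :=
    (locallyIntegrable_const 1).locallyIntegrableOn _
  have hzero : LocallyIntegrableOn (fun _ : ℝ × ℝ => (0 : ℝ)) (above g) :=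
    (locallyIntegrable_const 0).locallyIntegrableOn _
  have hu : ∀ α ∈ G.arc, ContDiffAt ℝ 1 G.velU α := fun α hα => hst α hα 0
  have hv : ∀ α ∈ G.arc, ContDiffAt ℝ 1 G.velV α := fun α hα => hst α hα 1
  have hp : ∀ α ∈ G.arc, ContDiffAt ℝ 1 G.prs α := fun α hα => hst α hα 2
  have T0 := test (f := fun α => G.velU α ^ 2 + G.velV α ^ 2)
    (fun α hα => ((hu α hα).pow 2).add ((hv α hα).pow 2)) (hX 0) (hY 0) (hcons 0)
  have T1 := test (f := fun α => -G.velU α) (fun α hα => (hu α hα).neg) (hX 1) (hY 1) (hcons 1)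
  have T2 := test (f := fun α => -G.velV α) (fun α hα => (hv α hα).neg) (hX 2) (hY 2) (hcons 2)
  have T3 := test (f := fun α => G.prs α * G.velU α) (fun α hα => (hp α hα).mul (hu α hα))
    hone hzero (fun θ C h1 h2 h3 => by simpa using setIntegral_fderiv_eq_zero h1 h2 h3 (1, 0))
  have T4 := test (f := fun α => G.prs α * G.velV α) (fun α hα => (hp α hα).mul (hv α hα))
    hzero hone (fun θ C h1 h2 h3 => by simpa using setIntegral_fderiv_eq_zero h1 h2 h3 (0, 1))
  have hsum := integral_add ((((T0.1.add T1.1).add T2.1).add T3.1)) T4.1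
  have hsum3 := integral_add ((T0.1.add T1.1).add T2.1) T3.1
  have hsum2 := integral_add (T0.1.add T1.1) T2.1
  have hsum1 := integral_add T0.1 T1.1
  have hi := (((T0.1.add T1.1).add T2.1).add T3.1).add T4.1
  simp only [Pi.add_apply] at hsum hsum3 hsum2 hsum1
  rw [hsum3, hsum2, hsum1, T0.2, T1.2, T2.2, T3.2, T4.2] at hsum
  norm_num only at hsum
  -- The five identities add up to zero. Pointwise their integrands differ from the wanted one by χ
  -- times the production, which is nonpositive.
  refine (le_of_eq hsum.symm).trans ?_
  refine integral_mono_ae hi hint ?_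
  filter_upwards [ae_restrict_of_ae hae, hV.compatible W, ae_restrict_mem hO.measurableSet]
    with z hz hVz hza
  by_cases hzs : z ∈ tsupport χ
  · have hzO := hSO hzs
    have hα := hsub (hmem z)
    have hsnd := Upstream.arc_snd_pos hα
    have hU := G.hasDerivAt_velU (a z)
    have hV' := G.hasDerivAt_velV (a z)
    have hP := G.hasDerivAt_prs hsnd
    have d0 : HasDerivAt (fun α => G.velU α ^ 2 + G.velV α ^ 2)
        (-2 * (1 - G.k ^ 2) * G.tang (a z) * G.snd (a z)) (a z) := by
      refine ((hU.pow 2).add (hV'.pow 2)).congr_deriv ?_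
      have := G.vel_normal (a z)
      norm_num
      linear_combination (-2 * (1 - G.k ^ 2) * G.tang (a z)) * this
    have d1 : HasDerivAt (fun α => -G.velU α)
        ((1 - G.k ^ 2) * G.tang (a z) * Real.sin (a z)) (a z) := hU.neg.congr_deriv (by ring)
    have d2 : HasDerivAt (fun α => -G.velV α)
        (-(1 - G.k ^ 2) * G.tang (a z) * Real.cos (a z)) (a z) := hV'.neg.congr_deriv (by ring)
    have d3 := hP.mul hU
    have d4 := hP.mul hV'
    have e0 := Wall.fderiv_comp_angle hz.1 d0
    have e1 := Wall.fderiv_comp_angle hz.1 d1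
    have e2 := Wall.fderiv_comp_angle hz.1 d2
    have e3 : ∀ v, fderiv ℝ (fun z => G.prs (a z) * G.velU (a z)) z v = _ :=
      Wall.fderiv_comp_angle hz.1 d3
    have e4 : ∀ v, fderiv ℝ (fun z => G.prs (a z) * G.velV (a z)) z v = _ :=
      Wall.fderiv_comp_angle hz.1 d4
    rw [e0, e0, e1, e1, e2, e2, e3, e3, e4, e4, W.extend_fanState hza, fanState, ← heq hzO]
    have hcos := Upstream.arc_cos_pos hα
    obtain ⟨t, ht⟩ : ∃ t, t = fderiv ℝ a z (0, 1) / Real.cos (a z) := ⟨_, rfl⟩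
    obtain ⟨hz1, hz2⟩ := hz.2 hzO
    have hprod := Upstream.relEnergy_production hα hVz (t := t) (ax := fderiv ℝ a z (1, 0))
      (ay := fderiv ℝ a z (0, 1))
      (by rw [ht]; field_simp; linear_combination hz1) (by rw [ht]; field_simp)
      (by rw [ht]; exact div_nonneg hz2 hcos.le)
    have := mul_nonneg (h0 z) (neg_nonneg.2 hprod)
    show _ ≤ ((G.velU (a z) ^ 2 + G.velV (a z) ^ 2) * fluxX G.γ (V z) 0 -
      G.velU (a z) * fluxX G.γ (V z) 1 - G.velV (a z) * fluxX G.γ (V z) 2 +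
      G.prs (a z) * G.velU (a z)) * fderiv ℝ χ z (1, 0) +
      ((G.velU (a z) ^ 2 + G.velV (a z) ^ 2) * fluxY G.γ (V z) 0 -
      G.velU (a z) * fluxY G.γ (V z) 1 - G.velV (a z) * fluxY G.γ (V z) 2 +
      G.prs (a z) * G.velV (a z)) * fderiv ℝ χ z (0, 1)
    rw [← sub_nonneg]
    refine this.trans (le_of_eq ?_)
    ring
  · rw [fderiv_eq_zero_of_notMem_tsupport hzs, image_eq_zero_of_notMem_tsupport hzs]
    simp

/-! ### Uniqueness -/

variable {U : ℝ × ℝ → State}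


theorem Admissible.relEnergy_wall (W : Wall G g K) (hU : Admissible G g U)
    (hV : Admissible G g V) (R : ℝ) : Tendsto (fun ε : ℝ => ε⁻¹ * ∫ z in layer g R ε,
      |relFlux G.γ (U z) (V z) - wallW g z.1 * relEnergy G.γ (U z) (V z)|) (𝓝[>] 0) (𝓝 0) := by
  have hg := W.lip.continuous
  have dU := W.locMeas_defect hU.toTame
  have dV := W.locMeas_defect hV.toTame
  have u := hU.apply hg
  have v := hV.apply hg
  have F1 := (v 3).mul ((((u 0).mul (u 0)).add ((u 1).mul (u 1))).sub
    (((u 0).mul (v 0)).add ((u 1).mul (v 1))))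
  have F2 := (v 2).sub (u 2)
  refine tendsto_layer_of_le W.lip (fun z => add_nonneg (abs_nonneg _) (abs_nonneg _))
    (dU.add dV) (F1.abs.add F2.abs) ?_ fun z => ?_
  · have h := (hU.slip R).add (hV.slip R)
    rw [add_zero] at h
    refine h.congr fun ε => ?_
    have hsub := layer_subset_above g R ε
    have hb := isBounded_layer W.lip R ε
    rw [integral_add (dU.integrableOn hsub hb) (dV.integrableOn hsub hb), mul_add]
  · refine le_trans ?_ (mul_le_mul_of_nonneg_right (le_abs_self _)
      (add_nonneg (abs_nonneg _) (abs_nonneg _)))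
    rw [relFlux_sub, ← abs_neg (velX (U z) * wallW g z.1 - velY (U z)),
      ← abs_neg (velX (V z) * wallW g z.1 - velY (V z))]
    refine (abs_sub _ _).trans ?_
    have e1 : velY (V z) - wallW g z.1 * velX (V z) = -(velX (V z) * wallW g z.1 - velY (V z)) := by
      ring
    have e2 : velY (U z) - wallW g z.1 * velX (U z) = -(velX (U z) * wallW g z.1 - velY (U z)) := by
      ring
    have e3 : dens (V z) * (velX (U z) ^ 2 + velY (U z) ^ 2 -
        (velX (U z) * velX (V z) + velY (U z) * velY (V z))) = V z 3 * (U z 0 * U z 0 +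
        U z 1 * U z 1 - (U z 0 * V z 0 + U z 1 * V z 1)) := by
      simp only [dens, velX, velY]; ring
    rw [e1, e2, e3, show pres (V z) - pres (U z) = V z 2 - U z 2 from rfl]
    generalize V z 3 * (U z 0 * U z 0 + U z 1 * U z 1 - (U z 0 * V z 0 + U z 1 * V z 1)) = A
    rw [abs_mul, abs_mul]
    have h2 := mul_nonneg (abs_nonneg A) (abs_nonneg (-(velX (U z) * wallW g z.1 - velY (U z))))
    have h3 := mul_nonneg (abs_nonneg (V z 2 - U z 2))
      (abs_nonneg (-(velX (V z) * wallW g z.1 - velY (V z))))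
    linarith

/-- Admissible flows coincide with the fan of simple waves. -/
theorem Admissible.ae_eq_fanState (W : Wall G g K) (hV : Admissible G g V) :
    ∀ᵐ z ∂(volume.restrict (above g)), V z = fanState G g z := by
  have hO := isOpen_above W.lip.continuous
  have hU := W.admissible_fanState
  obtain ⟨hΦ, hΨ⟩ := W.locMeas_relEnergy hU.toTame hV.toTame
  have hc := hV.compatible W
  have key := ae_eq_zero_of_dissipative W.lip W.ae_hasDerivAt W.measurable_slope hΦ.1 hΨ.1 hΦ.2 hΨ.2
    (fun z hz => ?_) (hV.relEnergy_dissipative W) ?_ (fun X => ?_) (hU.relEnergy_wall W hV)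
  · filter_upwards [key, hc, ae_restrict_mem hO.measurableSet] with z hz h1 h2
    rw [W.extend_fanState h2] at hz
    exact (Upstream.relEnergy_nonneg (W.fanAngle_mem h2).2.2 h1).2 hz
  · rw [hU.upstream z hz, hV.upstream z hz, relEnergy, relFlux]
    simp only [fluxX, fluxY, Matrix.cons_val]
    constructor <;> ring
  · filter_upwards [hc, ae_restrict_mem hO.measurableSet] with z h1 h2
    rw [W.extend_fanState h2]
    exact (Upstream.relEnergy_nonneg (W.fanAngle_mem h2).2.2 h1).1
  -- For x < X and y > X tan μ, with μ the upstream Mach angle, the point is above the leading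
  -- characteristic, so the wave is U_∞ and the lateral bound is needed only relative to the
  -- upstream state.
  · obtain ⟨L, hL, hlat⟩ := G.exists_lateral
    refine ⟨L, hL, Real.tan G.mach₀ * X, ?_⟩
    filter_upwards [hc, hV.region, ae_restrict_mem hO.measurableSet] with z h1 h2 h3 h4 h5 h6
    have hle : Real.tan G.mach₀ * z.1 ≤ z.2 :=
      (mul_le_mul_of_nonneg_left h5.le W.fanData.pos.le).trans h6.le
    have : extend G (fanState G g) z = G.state₀ := by
      rw [W.extend_fanState h3, fanState, fanAngle, W.fanData.fanSpeed_upstream h3 hle,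
        Wall.arctan_tan_mach₀, G.state_mach₀]
    rw [this]
    exact hlat _ h1 h2

end SteadyEuler

end

/-! ### Existence and uniqueness of the flow -/

theorem corollary3p1
    (γ : ℝ) (hγ : 1 < γ)
    (uinf pinf ρinf : ℝ) (hp : 0 < pinf) (hρ : 0 < ρinf)
    (Uinf : SteadyEuler.State) (hUinf : Uinf = ![uinf, 0, pinf, ρinf])
    (hu : SteadyEuler.sonic γ Uinf < uinf)
    (g : ℝ → ℝ) (hLip : ∃ K, LipschitzWith K g) (hg0 : ∀ x ≤ 0, g x = 0)
    (hdiff : ∀ x > 0, DifferentiableWithinAt ℝ g (Set.Ioi x) x)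
    (hmono : AntitoneOn (SteadyEuler.wallSlope g) (Set.Ioi 0))
    (hTV : BoundedVariationOn (SteadyEuler.wallSlope g) (Set.Ioi 0))
    (hangle : ∀ x > 0, Real.arctan (SteadyEuler.wallSlope g x) ∈
      Set.Ioo (SteadyEuler.thetaCrit γ Uinf) 0) :
    ∃ U : ℝ × ℝ → SteadyEuler.State,
      SteadyEuler.IsEntropySolution γ g Uinf U ∧
      (∀ z ∈ SteadyEuler.flowDomain g, U z ∈ SteadyEuler.region γ Uinf) ∧
      SteadyEuler.ConnectsByRarefaction γ g Uinf U ∧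
      ∀ V : ℝ × ℝ → SteadyEuler.State,
        SteadyEuler.IsEntropySolution γ g Uinf V →
        (∀ᵐ z ∂(MeasureTheory.volume.restrict (SteadyEuler.flowDomain g)),
          V z ∈ SteadyEuler.region γ Uinf) →
        V =ᵐ[MeasureTheory.volume.restrict (SteadyEuler.flowDomain g)] U := by
  subst hUinf
  obtain ⟨K, hK⟩ := hLip
  let G : SteadyEuler.Upstream := ⟨γ, uinf, pinf, ρinf, hγ, hp, hρ, hu⟩
  have W : SteadyEuler.Wall G g K := ⟨hK, hg0, hdiff, hmono, hangle⟩
  refine ⟨SteadyEuler.fanState G g, W.isEntropySolution_fanState,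
    fun z hz => W.region_fanState (SteadyEuler.flowDomain_subset g hz), W.connects,
    fun V hV hreg => ?_⟩
  have hg := hK.continuous
  have h := (W.admissible_extend hV hreg).ae_eq_fanState W
  rw [MeasureTheory.ae_restrict_iff' (SteadyEuler.isOpen_above hg).measurableSet] at h
  filter_upwards [MeasureTheory.ae_restrict_of_ae h,
    MeasureTheory.ae_restrict_mem (SteadyEuler.isOpen_flowDomain hg).measurableSet] with z hz hzm
  have hz' := hz (SteadyEuler.flowDomain_subset g hzm)
  rwa [SteadyEuler.extend, if_pos hzm.1] at hz'
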